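/- Let $\mathbb{T}^4=\mathbb{C}^2/(\mathbb{Z}+i\mathbb{Z})^2$ with complex coordinates $(w,z)=(x_1+iy_1,\,x_2+iy_2)$, and let $\mathbb{T}^2=\mathbb{C}/(\mathbb{Z}+i\mathbb{Z})$ with coordinate $z$. Let $A(w,z)=(w+z,z)$, i.e. in the real coordinates $(x_1,y_1,x_2,y_2)$ $$A=\begin{pmatrix}1&0&1&0\\0&1&0&1\\0&0&1&0\\0&0&0&1\end{pmatrix}.$$ Let $M=\mathbb{T}^4\times\mathbb{R}/\big((p,s)\sim(Ap,s+1)\big)$, which is $\mathbb{T}^4\times[0,1]/\big((p,0)\sim(Ap,1)\big)$, be the suspension of $A$, and let $\mathcal{F}_A$ be the foliation of $M$ whose leaves are the images of the lines $\{p\}\times\mathbb{R}$. A smooth complex-valued form $\alpha$ on $M$ is called basic if $i_X\alpha=i_Xd\alpha=0$ for every vector field $X$ tangent to the leaves, and $H^\bullet(M/\mathcal{F}_A)$ denotes the cohomology of the complex of basic forms (over $\mathbb{C}$). Let $$V=\Big\{(b,c,e)\in C^\infty(\mathbb{T}^2,\mathbb{C})^3 \;:\; \tfrac{\partial b}{\partial\bar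 z}-\tfrac{\partial c}{\partial z}=0,\ \tfrac{\partial c}{\partial\bar z}-\tfrac{\partial e}{\partial z}=0\Big\}.$$ Then $\mathcal{F}_A$ has codimension $4$ and is transversely holomorphic for the complex structure of $\mathbb{T}^4$, and there are $\mathbb{C}$-linear isomorphisms $$H^0(M/\mathcal{F}_A)\cong\mathbb{C},\quad H^1(M/\mathcal{F}_A)\cong\mathbb{C}^2,\quad H^2(M/\mathcal{F}_A)\cong V\oplus\mathbb{C},\quad H^3(M/\mathcal{F}_A)\cong\mathbb{C}^2,\quad H^4(M/\mathcal{F}_A)\cong C^\infty(\mathbb{T}^2,\mathbb{C}),$$ under which the following elements correspond to the classes of the following closed basic forms (written on the covering $\mathbb{C}^2\times\mathbb{R}$ of $M$): $\lambda\mapsto[\lambda]$ in degree $0$; $(\lambda,\mu)\mapsto[\lambda\,dz+\mu\,d\bar z]$ in degree $1$; $((b,c,e),\lambda)\mapsto[b\,dw\wedge dz+c\,(dw\wedge d\bar z+d\bar w\wedge dz)+e\,d\bar w\wedge d\bar z+\lambda\,dz\wedge d\bar z]$ in degree $2$; $(\lambda,\mu)\mapsto[\lambda\,dw\wedge dz\wedge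 d\bar z+\mu\,d\bar w\wedge dz\wedge d\bar z]$ in degree $3$; $g\mapsto[g(z)\,dw\wedge dz\wedge d\bar w\wedge d\bar z]$ in degree $4$. The space $V$ is infinite dimensional. Consequently the basic cohomology is infinite dimensional in degrees $2$ and $4$ but finite dimensional in degree $3$. -/

import Mathlib

open scoped Manifold ContDiff Topology
open Set

section Forms

variable (E : Type*) [NormedAddCommGroup E] [NormedSpace ℝ E]
  (M : Type*) [TopologicalSpace M] [ChartedSpace E M]
  (W : Type*) [NormedAddCommGroup W] [NormedSpace ℝ W]

/-- `W`-valued `k`-forms on `M`, without any regularity: a `k`-linear alternating map on each tangent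
space of `M`. -/
abbrev RoughForm (k : ℕ) : Type _ :=
  (x : M) → (TangentSpace 𝓘(ℝ, E) x) [⋀^Fin k]→L[ℝ] W

end Forms

section Forms

variable {E : Type*} [NormedAddCommGroup E] [NormedSpace ℝ E]
  {M : Type*} [TopologicalSpace M] [ChartedSpace E M]
  {E' : Type*} [NormedAddCommGroup E'] [NormedSpace ℝ E']
  {N : Type*} [TopologicalSpace N] [ChartedSpace E' N]
  {W : Type*} [NormedAddCommGroup W] [NormedSpace ℝ W]

namespace RoughForm

/-- Pullback of a form along a map. -/
noncomputable def pullback {k : ℕ} (f : N → M) (α : RoughForm E M W k) : RoughForm E' N W k :=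
  fun x => (α (f x)).compContinuousLinearMap (mfderiv 𝓘(ℝ, E') 𝓘(ℝ, E) f x)

/-- The expression of a form in a chart, as a form on (an open subset of) the model space. -/
noncomputable def inChart {k : ℕ} (e : OpenPartialHomeomorph M E) (α : RoughForm E M W k) :
    E → E [⋀^Fin k]→L[ℝ] W :=
  fun y => pullback (E' := E) (N := E) e.symm α y

/-- A form is smooth if its expression in every chart of the atlas is smooth. -/
def IsSmooth {k : ℕ} (α : RoughForm E M W k) : Prop :=
  ∀ e ∈ atlas E M, ContDiffOn ℝ ∞ (inChart e α) e.target

/-- The exterior derivative, computed at `x` in the preferred chart at `x`. -/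
noncomputable def d {k : ℕ} (α : RoughForm E M W k) : RoughForm E M W (k + 1) :=
  fun x => ContinuousAlternatingMap.compContinuousLinearMap
    (extDeriv (inChart (chartAt E x) α) (chartAt E x x))
    (mfderiv 𝓘(ℝ, E) 𝓘(ℝ, E) (chartAt E x) x)

theorem inChart_add {k : ℕ} (e : OpenPartialHomeomorph M E) (α β : RoughForm E M W k) :
    inChart e (α + β) = inChart e α + inChart e β := rfl

theorem IsSmooth.zero {k : ℕ} : IsSmooth (0 : RoughForm E M W k) :=
  fun _ _ => contDiffOn_const (c := (0 : E [⋀^Fin k]→L[ℝ] W))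

theorem IsSmooth.add {k : ℕ} {α β : RoughForm E M W k} (hα : IsSmooth α) (hβ : IsSmooth β) :
    IsSmooth (α + β) := fun e he => (hα e he).add (hβ e he)

theorem IsSmooth.differentiableAt {k : ℕ} {α : RoughForm E M W k} (hα : IsSmooth α) (x : M) :
    DifferentiableAt ℝ (inChart (chartAt E x) α) (chartAt E x x) :=
  ((hα _ (chart_mem_atlas E x)).contDiffAt ((chartAt E x).open_target.mem_nhds
    (mem_chart_target E x))).differentiableAt (by simp)

theorem d_add {k : ℕ} {α β : RoughForm E M W k} (hα : IsSmooth α) (hβ : IsSmooth β) :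
    d (α + β) = d α + d β := by
  funext x
  unfold d
  rw [inChart_add, extDeriv_add (hα.differentiableAt x) (hβ.differentiableAt x)]
  rfl

variable [NormedSpace ℂ W] [SMulCommClass ℝ ℂ W]

theorem inChart_smul {k : ℕ} (e : OpenPartialHomeomorph M E) (c : ℂ) (α : RoughForm E M W k) :
    inChart e (c • α) = c • inChart e α := rfl

theorem IsSmooth.smul {k : ℕ} (c : ℂ) {α : RoughForm E M W k} (hα : IsSmooth α) :
    IsSmooth (c • α) := fun e he => (hα e he).const_smul c

theorem d_smul {k : ℕ} (c : ℂ) {α : RoughForm E M W k} (hα : IsSmooth α) :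
    d (c • α) = c • d α := by
  funext x
  have key : extDeriv (c • inChart (chartAt E x) α) (chartAt E x x) =
      c • extDeriv (inChart (chartAt E x) α) (chartAt E x x) := by
    have h := fderiv_const_smul (𝕜 := ℝ) (hα.differentiableAt x) c
    ext v
    simp only [extDeriv, h, ContinuousAlternatingMap.smul_apply,
      ContinuousAlternatingMap.alternatizeUncurryFin_apply, _root_.smul_apply,
      Finset.smul_sum]
    exact Finset.sum_congr rfl fun i _ => smul_comm _ _ _
  unfold d
  rw [inChart_smul, key]
  rfl

end RoughForm
end Forms

/-! ### Foliations -/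

/-- A foliation on the manifold `M`, transversely modelled on the manifold `T`: an open cover `U i`,
submersions `f i : U i → T` with connected fibres (the plaques), and local diffeomorphisms `γ i j`
of `T` with `f j = γ i j ∘ f i` on `U i ∩ U j`. -/
structure Foliation (E : Type*) [NormedAddCommGroup E] [NormedSpace ℝ E]
    (M : Type*) [TopologicalSpace M] [ChartedSpace E M]
    (E' : Type*) [NormedAddCommGroup E'] [NormedSpace ℝ E']
    (T : Type*) [TopologicalSpace T] [ChartedSpace E' T] where
  ι : Type
  U : ι → Set M
  isOpen_U : ∀ i, IsOpen (U i)
  cover : ⋃ i, U i = univ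
  f : ι → M → T
  smooth_f : ∀ i, ContMDiffOn 𝓘(ℝ, E) 𝓘(ℝ, E') ∞ (f i) (U i)
  submersion_f : ∀ i, ∀ x ∈ U i,
    Function.Surjective (mfderiv 𝓘(ℝ, E) 𝓘(ℝ, E') (f i) x)
  connected_plaque : ∀ i, ∀ t ∈ f i '' U i, IsConnected (U i ∩ f i ⁻¹' {t})
  γ : ι → ι → OpenPartialHomeomorph T T
  smooth_γ : ∀ i j, (U i ∩ U j).Nonempty →
    ContMDiffOn 𝓘(ℝ, E') 𝓘(ℝ, E') ∞ (γ i j) (γ i j).source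
  smooth_γ_symm : ∀ i j, (U i ∩ U j).Nonempty →
    ContMDiffOn 𝓘(ℝ, E') 𝓘(ℝ, E') ∞ (γ i j).symm (γ i j).target
  mem_source : ∀ i j, ∀ x ∈ U i ∩ U j, f i x ∈ (γ i j).source
  cocycle : ∀ i j, ∀ x ∈ U i ∩ U j, f j x = γ i j (f i x)

namespace Foliation

variable {E : Type*} [NormedAddCommGroup E] [NormedSpace ℝ E]
  {M : Type*} [TopologicalSpace M] [ChartedSpace E M]
  {E' : Type*} [NormedAddCommGroup E'] [NormedSpace ℝ E']
  {T : Type*} [TopologicalSpace T] [ChartedSpace E' T]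
  (F : Foliation E M E' T)
  {W : Type*} [NormedAddCommGroup W] [NormedSpace ℝ W]

/-- The codimension, that is, the real dimension of the transverse manifold. -/
noncomputable def codimension (_F : Foliation E M E' T) : ℕ := Module.finrank ℝ E'

/-- The foliation is transversely holomorphic for the given complex structure on `T`: the atlas of
`T` is holomorphic, and so are the `γ i j` and their inverses. -/
def IsTransverselyHolomorphic [NormedSpace ℂ E'] [IsScalarTower ℝ ℂ E'] : Prop :=
  IsManifold 𝓘(ℂ, E') ω T ∧ ∀ i j, (F.U i ∩ F.U j).Nonempty →
    MDifferentiableOn 𝓘(ℂ, E') 𝓘(ℂ, E') (F.γ i j) (F.γ i j).source ∧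
    MDifferentiableOn 𝓘(ℂ, E') 𝓘(ℂ, E') (F.γ i j).symm (F.γ i j).target

/-- `v` is tangent to the leaf through `x`, that is, to the plaque through `x`. -/
def IsTangent (x : M) (v : TangentSpace 𝓘(ℝ, E) x) : Prop :=
  ∃ i, x ∈ F.U i ∧ mfderiv 𝓘(ℝ, E) 𝓘(ℝ, E') (F.f i) x v = 0

/-- horizontal: `i_X α = 0` for all `X` tangent -/
def IsHorizontal {k : ℕ} (α : RoughForm E M W k) : Prop :=
  ∀ (x : M) (u : Fin k → TangentSpace 𝓘(ℝ, E) x), (∃ j, F.IsTangent x (u j)) → α x u = 0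

theorem IsHorizontal.add {F : Foliation E M E' T} {k : ℕ} {α β : RoughForm E M W k}
    (hα : F.IsHorizontal α)
    (hβ : F.IsHorizontal β) : F.IsHorizontal (α + β) := fun x u hu => by
  have h1 := hα x u hu
  have h2 := hβ x u hu
  simp [h1, h2]

theorem IsHorizontal.zero {F : Foliation E M E' T} {k : ℕ} :
    F.IsHorizontal (0 : RoughForm E M W k) := fun _ _ _ => rfl

variable [NormedSpace ℂ W] [SMulCommClass ℝ ℂ W]

theorem IsHorizontal.smul {F : Foliation E M E' T} {k : ℕ} (c : ℂ) {α : RoughForm E M W k}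
    (hα : F.IsHorizontal α) : F.IsHorizontal (c • α) := fun x u hu => by
  have h1 := hα x u hu
  simp [h1]

theorem d_zero {k : ℕ} : RoughForm.d (0 : RoughForm E M W k) = 0 := by
  have h := RoughForm.d_smul (0 : ℂ) (RoughForm.IsSmooth.zero (E := E) (M := M) (W := W) (k := k))
  rwa [zero_smul, zero_smul] at h

variable (W)

/-- The smooth basic forms: `i_X α = 0` and `i_X dα = 0` for all `X` tangent to the leaves. -/
def basicForms (k : ℕ) : Submodule ℂ (RoughForm E M W k) where
  carrier := {α | RoughForm.IsSmooth α ∧ F.IsHorizontal α ∧ F.IsHorizontal (RoughForm.d α)}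
  add_mem' := fun hα hβ => ⟨hα.1.add hβ.1, hα.2.1.add hβ.2.1, by
    rw [RoughForm.d_add hα.1 hβ.1]; exact hα.2.2.add hβ.2.2⟩
  zero_mem' := ⟨.zero, .zero, by rw [d_zero]; exact .zero⟩
  smul_mem' := fun c _ hα => ⟨hα.1.smul c, hα.2.1.smul c, by
    rw [RoughForm.d_smul c hα.1]; exact hα.2.2.smul c⟩

/-- The exterior derivative on basic forms. -/
noncomputable def dBasic (k : ℕ) : F.basicForms W k →ₗ[ℂ] RoughForm E M W (k + 1) where
  toFun α := RoughForm.d α.1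
  map_add' α β := RoughForm.d_add α.2.1 β.2.1
  map_smul' c α := RoughForm.d_smul c α.2.1

/-- Closed basic forms. -/
noncomputable def closedForms (k : ℕ) : Submodule ℂ (RoughForm E M W k) :=
  (LinearMap.ker (F.dBasic W k)).map (F.basicForms W k).subtype

/-- Differentials of basic forms of the preceding degree. -/
noncomputable def exactForms : (k : ℕ) → Submodule ℂ (RoughForm E M W k)
  | 0 => ⊥
  | k + 1 => LinearMap.range (F.dBasic W k)

/-- The basic de Rham cohomology, with coefficients in `W`. -/
noncomputable abbrev basicCohomology (k : ℕ) : Type _ :=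
  F.closedForms W k ⧸ (F.exactForms W k).submoduleOf (F.closedForms W k)

end Foliation

/-! ### Quotient manifolds of vector spaces -/

section Cover

variable {E : Type*} [NormedAddCommGroup E]
  {Q : Type*} [TopologicalSpace Q]

/-- `π : E → Q` is a covering of `Q` by a vector space: the charts of `Q` are the local inverses of
`π`, and two points in the same fibre are related by a smooth deck transformation. -/
structure IsUniformization (𝕜 : Type*) [NontriviallyNormedField 𝕜] [NormedSpace 𝕜 E]
    [ChartedSpace E Q] (π : E → Q) : Prop where
  surjective : Function.Surjective π
  chart_symm : ∀ e ∈ atlas E Q, ∀ x ∈ e.target, e.symm x = π x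
  deck : ∀ x y, π x = π y →
    ∃ g : E → E, ContDiff 𝕜 ω g ∧ g x = y ∧ ∀ z, π (g z) = π z

theorem atlas_symm_of_isLocalHomeomorph {π : E → Q} (h : IsLocalHomeomorph π)
    (hs : Function.Surjective π) :
    letI : ChartedSpace E Q := h.chartedSpace hs
    ∀ e ∈ atlas E Q, ∀ x ∈ e.target, e.symm x = π x := by
  rintro e ⟨q, rfl⟩ x _
  simp only [OpenPartialHomeomorph.coe_trans_symm, Function.comp_apply,
    IsLocalHomeomorph.localInverseAt_symm, chartAt_self_eq]
  rfl

namespace IsUniformization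

variable {𝕜 : Type*} [NontriviallyNormedField 𝕜] [NormedSpace 𝕜 E]
    [ChartedSpace E Q] {π : E → Q}
    {E' : Type*} [NormedAddCommGroup E'] [NormedSpace 𝕜 E']
    {N : Type*} [TopologicalSpace N] [ChartedSpace E' N]

theorem isManifold (h : IsUniformization 𝕜 π) : IsManifold 𝓘(𝕜, E) ω Q := by
  refine isManifold_of_contDiffOn _ _ _ fun e e' he he' => ?_
  simp only [modelWithCornersSelf_coe, modelWithCornersSelf_coe_symm, Function.comp_id,
    Function.id_comp, preimage_id, range_id, inter_univ]
  intro x hx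
  have hx1 : x ∈ e.target := by simpa using hx.1
  have hx2 : e.symm x ∈ e'.source := hx.2
  have hy : π x = π (e' (e.symm x)) := by
    rw [← h.chart_symm e' he' _ (e'.map_source hx2), e'.left_inv hx2, h.chart_symm e he x hx1]
  obtain ⟨g, hg, hgx, hgπ⟩ := h.deck _ _ hy
  refine ContDiffAt.contDiffWithinAt ?_
  refine hg.contDiffAt.congr_of_eventuallyEq ?_
  have h1 : ∀ᶠ x' in 𝓝 x, g x' ∈ e'.target := by
    refine hg.continuous.continuousAt.eventually_mem (e'.open_target.mem_nhds ?_)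
    rw [hgx]; exact e'.map_source hx2
  filter_upwards [h1, e.open_target.mem_nhds hx1] with x' h1 h2
  show e' (e.symm x') = g x'
  rw [h.chart_symm e he x' h2, ← hgπ, ← h.chart_symm e' he' _ h1, e'.right_inv h1]

theorem eventuallyEq (h : IsUniformization 𝕜 π) (x : E) : ∃ g : E → E, ContDiff 𝕜 ω g ∧
    g x = chartAt E (π x) (π x) ∧ ∀ᶠ x' in 𝓝 x, π x' = (chartAt E (π x)).symm (g x') := by
  have hy : π x = π (chartAt E (π x) (π x)) := by
    rw [← h.chart_symm _ (chart_mem_atlas E _) _ (mem_chart_target E _),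
      (chartAt E (π x)).left_inv (mem_chart_source E _)]
  obtain ⟨g, hg, hgx, hgπ⟩ := h.deck _ _ hy
  refine ⟨g, hg, hgx, ?_⟩
  have h1 : ∀ᶠ x' in 𝓝 x, g x' ∈ (chartAt E (π x)).target := by
    refine hg.continuous.continuousAt.eventually_mem ((chartAt E (π x)).open_target.mem_nhds ?_)
    rw [hgx]; exact mem_chart_target E _
  filter_upwards [h1] with x' h1
  rw [h.chart_symm _ (chart_mem_atlas E _) _ h1, hgπ]

theorem contMDiff (h : IsUniformization 𝕜 π) : ContMDiff 𝓘(𝕜, E) 𝓘(𝕜, E) ω π := by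
  have := h.isManifold
  intro x
  obtain ⟨g, hg, hgx, hev⟩ := h.eventuallyEq x
  refine ContMDiffAt.congr_of_eventuallyEq ?_ hev
  have h1 : ContMDiffAt 𝓘(𝕜, E) 𝓘(𝕜, E) ω (chartAt E (π x)).symm (g x) :=
    (contMDiffOn_chart_symm (I := 𝓘(𝕜, E)) (n := ω) (x := π x)).contMDiffAt
      ((chartAt E (π x)).open_target.mem_nhds (hgx ▸ mem_chart_target E _))
  exact h1.comp x hg.contMDiff.contMDiffAt

theorem eventually_chart (h : IsUniformization 𝕜 π) (q : Q) :
    ∀ᶠ q' in 𝓝 q, π (chartAt E q q') = q' := by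
  filter_upwards [(chartAt E q).open_source.mem_nhds (mem_chart_source E q)] with q' hq
  rw [← h.chart_symm _ (chart_mem_atlas E _) _ ((chartAt E q).map_source hq),
    (chartAt E q).left_inv hq]

theorem contMDiffAt_of_comp (h : IsUniformization 𝕜 π) {f : Q → N} {q : Q} {n : ℕ∞ω}
    (hf : ∀ y, π y = q → ContMDiffAt 𝓘(𝕜, E) 𝓘(𝕜, E') n (f ∘ π) y) :
    ContMDiffAt 𝓘(𝕜, E) 𝓘(𝕜, E') n f q := by
  have := h.isManifold
  have := this.of_le (m := n) le_top
  have h1 : ContMDiffAt 𝓘(𝕜, E) 𝓘(𝕜, E') n ((f ∘ π) ∘ (chartAt E q : Q → E)) q := by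
    refine ContMDiffAt.comp (g := f ∘ π) q (hf (chartAt E q q) (h.eventually_chart q).self_of_nhds) ?_
    exact (contMDiffOn_chart (I := 𝓘(𝕜, E)) (n := n) (x := q)).contMDiffAt
      ((chartAt E q).open_source.mem_nhds (mem_chart_source E q))
  refine h1.congr_of_eventuallyEq ?_
  filter_upwards [h.eventually_chart q] with q' hq
  simp [hq]

theorem surjective_mfderiv (h : IsUniformization 𝕜 π) (x : E) :
    Function.Surjective (mfderiv 𝓘(𝕜, E) 𝓘(𝕜, E) π x) := by
  have := h.isManifold
  have hd : ∀ y, MDifferentiableAt 𝓘(𝕜, E) 𝓘(𝕜, E) π y := fun y =>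
    (h.contMDiff y).mdifferentiableAt (by simp)
  have key : ∀ q : Q, Function.Surjective (mfderiv 𝓘(𝕜, E) 𝓘(𝕜, E) π (chartAt E q q)) := by
    intro q
    have hc : MDifferentiableAt 𝓘(𝕜, E) 𝓘(𝕜, E) (chartAt E q) q :=
      ((contMDiffOn_chart (I := 𝓘(𝕜, E)) (n := ω) (x := q)).contMDiffAt
        ((chartAt E q).open_source.mem_nhds (mem_chart_source E q))).mdifferentiableAt (by simp)
    have h1 := mfderiv_comp q (hd (chartAt E q q)) hc
    have h2 : mfderiv 𝓘(𝕜, E) 𝓘(𝕜, E) (π ∘ chartAt E q) q =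
        mfderiv 𝓘(𝕜, E) 𝓘(𝕜, E) (id : Q → Q) q :=
      Filter.EventuallyEq.mfderiv_eq (h.eventually_chart q)
    intro v
    refine ⟨mfderiv 𝓘(𝕜, E) 𝓘(𝕜, E) (chartAt E q) q v, ?_⟩
    have h3 := DFunLike.congr_fun (h1.symm.trans h2) v
    rw [mfderiv_id] at h3
    exact h3
  have transfer : ∀ (y z : E) (g : E → E), ContDiff 𝕜 ω g → g y = z → π ∘ g = π →
      Function.Surjective (mfderiv 𝓘(𝕜, E) 𝓘(𝕜, E) π y) →
      Function.Surjective (mfderiv 𝓘(𝕜, E) 𝓘(𝕜, E) π z) := by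
    rintro y z g hg rfl hgπ hs
    have h1 := mfderiv_comp (I' := 𝓘(𝕜, E)) y (hd (g y))
      (hg.contMDiff.contMDiffAt.mdifferentiableAt (by simp))
    have h2 : Function.Surjective (mfderiv 𝓘(𝕜, E) 𝓘(𝕜, E) (π ∘ g) y) := by
      rw [hgπ]; exact hs
    rw [h1] at h2
    exact Function.Surjective.of_comp h2
  have hy : π (chartAt E (π x) (π x)) = π x := (h.eventually_chart (π x)).self_of_nhds
  obtain ⟨g, hg, hgx, hgπ⟩ := h.deck _ _ hy
  exact transfer _ _ g hg hgx (funext hgπ) (key _)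

end IsUniformization

end Cover

/-! ### Tori -/

/-- The lattice `ℤ + ℤ i` in `ℂ`. -/
def intLattice : AddSubgroup ℂ where
  carrier := {z | ∃ m n : ℤ, z = m + n * Complex.I}
  zero_mem' := ⟨0, 0, by simp⟩
  add_mem' := by
    rintro _ _ ⟨m, n, rfl⟩ ⟨m', n', rfl⟩
    exact ⟨m + m', n + n', by push_cast; ring⟩
  neg_mem' := by
    rintro _ ⟨m, n, rfl⟩
    exact ⟨-m, -n, by push_cast; ring⟩

/-- The torus `𝕋² = ℂ / (ℤ + ℤ i)`, with coordinate `z`. -/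
abbrev Torus2 : Type := ℂ ⧸ intLattice

/-- The torus `𝕋⁴ = ℂ² / (ℤ + ℤ i)²`, with coordinates `(w, z)`. -/
abbrev Torus4 : Type := (ℂ × ℂ) ⧸ intLattice.prod intLattice

theorem intLattice_discrete {v : ℂ} (hv : v ∈ intLattice) (h : ‖v‖ < 1) : v = 0 := by
  obtain ⟨m, n, rfl⟩ := hv
  have h1 : |(m : ℝ)| < 1 := by
    simpa using (Complex.abs_re_le_norm _).trans_lt h
  have h2 : |(n : ℝ)| < 1 := by
    simpa using (Complex.abs_im_le_norm _).trans_lt h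
  have h3 : m = 0 := Int.abs_lt_one_iff.1 (by exact_mod_cast h1)
  have h4 : n = 0 := Int.abs_lt_one_iff.1 (by exact_mod_cast h2)
  simp [h3, h4]

theorem intLattice_prod_discrete {v : ℂ × ℂ} (hv : v ∈ intLattice.prod intLattice)
    (h : ‖v‖ < 1) : v = 0 := by
  have hv' := AddSubgroup.mem_prod.1 hv
  exact Prod.ext (intLattice_discrete hv'.1 ((norm_fst_le v).trans_lt h))
    (intLattice_discrete hv'.2 ((norm_snd_le v).trans_lt h))

theorem isLocalHomeomorph_of_isOpenMap {X Y : Type*} [TopologicalSpace X] [TopologicalSpace Y]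
    {f : X → Y} (hc : Continuous f) (ho : IsOpenMap f)
    (hi : ∀ x, ∃ U, IsOpen U ∧ x ∈ U ∧ InjOn f U) : IsLocalHomeomorph f := by
  rw [isLocalHomeomorph_iff_isOpenEmbedding_restrict]
  intro x
  obtain ⟨U, hU, hx, hinj⟩ := hi x
  exact ⟨U, hU.mem_nhds hx, .of_continuous_injective_isOpenMap
    (hc.comp continuous_subtype_val) (injOn_iff_injective.1 hinj) (ho.domRestrict hU)⟩

theorem isLocalHomeomorph_mk {E : Type*} [NormedAddCommGroup E] (S : AddSubgroup E)
    (hS : ∀ v ∈ S, ‖v‖ < 1 → v = 0) : IsLocalHomeomorph (QuotientAddGroup.mk : E → E ⧸ S) := by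
  refine isLocalHomeomorph_of_isOpenMap continuous_quot_mk QuotientAddGroup.isOpenMap_coe
    fun x => ⟨Metric.ball x (1 / 2), Metric.isOpen_ball, Metric.mem_ball_self (by norm_num), ?_⟩
  intro y hy z hz hyz
  have h1 : -y + z ∈ S := QuotientAddGroup.eq.1 hyz
  have h2 : ‖-y + z‖ < 1 := by
    rw [neg_add_eq_sub, ← dist_eq_norm]
    have := dist_triangle_right z y x
    rw [Metric.mem_ball] at hy hz
    linarith
  have h3 := hS _ h1 h2
  rw [neg_add_eq_zero] at h3
  exact h3

theorem uniformization_mk {𝕜 E : Type*} [NontriviallyNormedField 𝕜] [NormedAddCommGroup E]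
    [NormedSpace 𝕜 E] (S : AddSubgroup E)
    (hS : IsLocalHomeomorph (QuotientAddGroup.mk : E → E ⧸ S)) :
    letI : ChartedSpace E (E ⧸ S) := hS.chartedSpace Quotient.mk_surjective
    IsUniformization 𝕜 (QuotientAddGroup.mk : E → E ⧸ S) := by
  let _ : ChartedSpace E (E ⧸ S) := hS.chartedSpace Quotient.mk_surjective
  refine ⟨Quotient.mk_surjective, atlas_symm_of_isLocalHomeomorph hS Quotient.mk_surjective, ?_⟩
  intro x y hxy
  have h1 : -x + y ∈ S := QuotientAddGroup.eq.1 hxy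
  refine ⟨fun z => z + (-x + y), contDiff_id.add contDiff_const, add_neg_cancel_left _ _, fun z => ?_⟩
  exact (QuotientAddGroup.mk_add_of_mem z h1)

theorem isLocalHomeomorph_torus2 : IsLocalHomeomorph (QuotientAddGroup.mk : ℂ → Torus2) :=
  isLocalHomeomorph_mk _ fun _ => intLattice_discrete

theorem isLocalHomeomorph_torus4 : IsLocalHomeomorph (QuotientAddGroup.mk : ℂ × ℂ → Torus4) :=
  isLocalHomeomorph_mk _ fun _ => intLattice_prod_discrete

/-- The charts of `𝕋²` are the local inverses of `ℂ → 𝕋²`. -/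
noncomputable instance : ChartedSpace ℂ Torus2 :=
  isLocalHomeomorph_torus2.chartedSpace Quotient.mk_surjective

/-- The charts of `𝕋⁴` are the local inverses of `ℂ² → 𝕋⁴`. -/
noncomputable instance : ChartedSpace (ℂ × ℂ) Torus4 :=
  isLocalHomeomorph_torus4.chartedSpace Quotient.mk_surjective

theorem uniformization_torus2 (𝕜 : Type*) [NontriviallyNormedField 𝕜] [NormedSpace 𝕜 ℂ] :
    IsUniformization 𝕜 (QuotientAddGroup.mk : ℂ → Torus2) := uniformization_mk _ _

theorem uniformization_torus4 (𝕜 : Type*) [NontriviallyNormedField 𝕜] [NormedSpace 𝕜 (ℂ × ℂ)] :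
    IsUniformization 𝕜 (QuotientAddGroup.mk : ℂ × ℂ → Torus4) := uniformization_mk _ _

instance : IsManifold 𝓘(ℝ, ℂ) ∞ Torus2 :=
  (uniformization_torus2 ℝ).isManifold.of_le le_top

instance : IsManifold 𝓘(ℝ, ℂ × ℂ) ∞ Torus4 :=
  (uniformization_torus4 ℝ).isManifold.of_le le_top

/-- The complex structure of `𝕋⁴`. -/
instance : IsManifold 𝓘(ℂ, ℂ × ℂ) ω Torus4 :=
  (uniformization_torus4 ℂ).isManifold

/-! ### The linear map and its suspension -/

/-- The complex-linear unipotent map `A (w, z) = (w + z, z)` of `ℂ²`. -/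
noncomputable def shear : (ℂ × ℂ) ≃L[ℂ] (ℂ × ℂ) where
  toFun p := (p.1 + p.2, p.2)
  invFun p := (p.1 - p.2, p.2)
  map_add' p q := by ext <;> simp; ring
  map_smul' c p := by ext <;> simp; ring
  left_inv p := by simp
  right_inv p := by simp
  continuous_toFun := by fun_prop
  continuous_invFun := by fun_prop

theorem shear_apply (p : ℂ × ℂ) : shear p = (p.1 + p.2, p.2) := rfl
theorem shear_symm_apply (p : ℂ × ℂ) : shear.symm p = (p.1 - p.2, p.2) := rfl

/-- In the real coordinates `(x₁, y₁, x₂, y₂)`, with `w = x₁ + i y₁` and `z = x₂ + i y₂`, the map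
`shear` is given by the integral matrix of the suspension. -/
theorem shear_matrix (p : ℂ × ℂ) :
    ![(shear p).1.re, (shear p).1.im, (shear p).2.re, (shear p).2.im] =
      (!![1, 0, 1, 0; 0, 1, 0, 1; 0, 0, 1, 0; 0, 0, 0, 1] : Matrix (Fin 4) (Fin 4) ℝ).mulVec
        ![p.1.re, p.1.im, p.2.re, p.2.im] := by
  ext i
  fin_cases i <;> simp [shear_apply, Matrix.mulVec, dotProduct, Fin.sum_univ_four]

theorem map_shear : (intLattice.prod intLattice).map (shear : (ℂ × ℂ) ≃+ (ℂ × ℂ)).toAddMonoidHom =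
    intLattice.prod intLattice := by
  ext p
  rw [AddSubgroup.mem_map]
  constructor
  · rintro ⟨q, hq, rfl⟩
    exact ⟨intLattice.add_mem hq.1 hq.2, hq.2⟩
  · intro hp
    exact ⟨shear.symm p, ⟨intLattice.sub_mem hp.1 hp.2, hp.2⟩, shear.apply_symm_apply p⟩

/-- The automorphism of `𝕋⁴` induced by `A`. -/
noncomputable def torusShear : Torus4 ≃ₜ Torus4 where
  toEquiv := (QuotientAddGroup.congr _ _ (shear : (ℂ × ℂ) ≃+ (ℂ × ℂ)) map_shear).toEquiv
  continuous_toFun := Continuous.quotient_lift (f := fun p => ((shear p : ℂ × ℂ) : Torus4)) (continuous_quot_mk.comp shear.continuous) _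
  continuous_invFun := Continuous.quotient_lift (f := fun p => ((shear.symm p : ℂ × ℂ) : Torus4)) (continuous_quot_mk.comp shear.symm.continuous) _

theorem torusShear_mk (p : ℂ × ℂ) : torusShear (p : Torus4) = (shear p : ℂ × ℂ) := rfl

theorem torusShear_zpow_mk (n : ℤ) (p : ℂ × ℂ) :
    (torusShear ^ n) (p : Torus4) = ((p.1 + n * p.2, p.2) : ℂ × ℂ) := by
  induction n using Int.induction_on generalizing p with
  | zero => simp
  | succ n ih =>
    rw [zpow_add_one, Homeomorph.mul_apply, torusShear_mk, ih, shear_apply]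
    push_cast
    congr 2
    ring
  | pred n ih =>
    rw [zpow_sub_one, Homeomorph.mul_apply]
    have : torusShear⁻¹ (p : Torus4) = (shear.symm p : ℂ × ℂ) := rfl
    rw [this, ih, shear_symm_apply]
    push_cast
    congr 2
    ring

/-- The relation `(p, s) ∼ (Aⁿ p, s + n)` on `𝕋⁴ × ℝ`. -/
def suspensionSetoid : Setoid (Torus4 × ℝ) where
  r x y := ∃ n : ℤ, (torusShear ^ n) x.1 = y.1 ∧ x.2 + n = y.2
  iseqv := {
    refl := fun x => ⟨0, by simp⟩
    symm := by
      rintro x y ⟨n, h1, h2⟩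
      refine ⟨-n, ?_, by push_cast; linarith⟩
      rw [← h1, ← Homeomorph.mul_apply, ← zpow_add]
      simp
    trans := by
      rintro x y z ⟨n, h1, h2⟩ ⟨m, h3, h4⟩
      refine ⟨m + n, ?_, by push_cast; linarith⟩
      rw [← h3, ← h1, ← Homeomorph.mul_apply, ← zpow_add] }

/-- The suspension of `𝕋⁴` by `A`: the 5-manifold `𝕋⁴ × ℝ / (p, s) ∼ (A p, s + 1)`, which is
`𝕋⁴ × [0, 1] / (p, 0) ∼ (A p, 1)`. -/
def Suspension : Type := Quotient suspensionSetoid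

namespace Suspension

instance : TopologicalSpace Suspension := inferInstanceAs (TopologicalSpace (Quotient _))

/-- The quotient map `𝕋⁴ × ℝ → M`. -/
def mk (x : Torus4 × ℝ) : Suspension := Quotient.mk suspensionSetoid x

theorem mk_eq_iff {x y : Torus4 × ℝ} :
    mk x = mk y ↔ ∃ n : ℤ, (torusShear ^ n) x.1 = y.1 ∧ x.2 + n = y.2 := Quotient.eq

theorem mk_surjective : Function.Surjective mk := Quotient.mk_surjective

theorem continuous_mk : Continuous mk := continuous_quotient_mk'

theorem isOpenMap_mk : IsOpenMap mk := by
  intro U hU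
  refine isOpen_coinduced.2 ?_
  have : mk ⁻¹' (mk '' U) = ⋃ n : ℤ, (fun y : Torus4 × ℝ => ((torusShear ^ n) y.1, y.2 + n)) ⁻¹' U := by
    ext y
    simp only [mem_preimage, mem_image, mem_iUnion]
    constructor
    · rintro ⟨x, hx, hxy⟩
      obtain ⟨n, h1, h2⟩ := mk_eq_iff.1 hxy.symm
      exact ⟨n, by rw [h1, h2]; exact hx⟩
    · rintro ⟨n, hn⟩
      exact ⟨_, hn, (mk_eq_iff.2 ⟨n, rfl, rfl⟩).symm⟩
  change IsOpen (mk ⁻¹' (mk '' U))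
  rw [this]
  refine isOpen_iUnion fun n => hU.preimage ?_
  exact ((torusShear ^ n).continuous.comp continuous_fst).prodMk (continuous_snd.add continuous_const)

theorem isLocalHomeomorph_mk : IsLocalHomeomorph mk := by
  refine isLocalHomeomorph_of_isOpenMap continuous_mk isOpenMap_mk fun x =>
    ⟨univ ×ˢ Ioo (x.2 - 1 / 2) (x.2 + 1 / 2), isOpen_univ.prod isOpen_Ioo, ⟨trivial, by constructor <;> linarith⟩, ?_⟩
  rintro y ⟨-, hy⟩ z ⟨-, hz⟩ hyz
  obtain ⟨n, h1, h2⟩ := mk_eq_iff.1 hyz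
  have hn : n = 0 := by
    have h3 : |(n : ℝ)| < 1 := by
      rw [abs_lt]; constructor <;> linarith [hy.1, hy.2, hz.1, hz.2]
    exact Int.abs_lt_one_iff.1 (by exact_mod_cast h3)
  subst hn
  exact Prod.ext (by simpa using h1) (by simpa using h2)

/-- The covering `ℂ² × ℝ → M`. -/
def proj (x : (ℂ × ℂ) × ℝ) : Suspension := mk ((x.1 : Torus4), x.2)

theorem proj_surjective : Function.Surjective proj := by
  intro q
  obtain ⟨⟨p, s⟩, rfl⟩ := mk_surjective q
  obtain ⟨v, rfl⟩ := QuotientAddGroup.mk_surjective p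
  exact ⟨(v, s), rfl⟩

theorem isLocalHomeomorph_proj : IsLocalHomeomorph proj := by
  refine isLocalHomeomorph_mk.comp (f := fun x : (ℂ × ℂ) × ℝ => ((x.1 : Torus4), x.2)) ?_
  refine isLocalHomeomorph_of_isOpenMap
    (isLocalHomeomorph_torus4.continuous.prodMap continuous_id)
    (isLocalHomeomorph_torus4.isOpenMap.prodMap IsOpenMap.id) fun x => ?_
  obtain ⟨U, hU, hUi⟩ := (isLocalHomeomorph_iff_isOpenEmbedding_restrict.1 isLocalHomeomorph_torus4) x.1
  refine ⟨interior U ×ˢ univ, isOpen_interior.prod isOpen_univ, ⟨mem_interior_iff_mem_nhds.2 hU, trivial⟩, ?_⟩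
  rintro y ⟨hy, -⟩ z ⟨hz, -⟩ hyz
  have h1 := (injOn_iff_injective.2 hUi.injective) (interior_subset hy) (interior_subset hz) (congrArg Prod.fst hyz)
  exact Prod.ext h1 (Prod.ext_iff.1 hyz).2

/-- The charts of `M` are the local inverses of the covering `ℂ² × ℝ → M`. -/
noncomputable instance : ChartedSpace ((ℂ × ℂ) × ℝ) Suspension :=
  isLocalHomeomorph_proj.chartedSpace proj_surjective

theorem uniformization_proj : IsUniformization ℝ proj := by
  refine ⟨proj_surjective, atlas_symm_of_isLocalHomeomorph isLocalHomeomorph_proj proj_surjective, ?_⟩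
  intro x y hxy
  obtain ⟨n, h1, h2⟩ := mk_eq_iff.1 hxy
  simp only at h1 h2
  rw [torusShear_zpow_mk] at h1
  have h3 := QuotientAddGroup.eq.1 h1
  refine ⟨fun v => ((v.1.1 + n * v.1.2, v.1.2) + (-(x.1.1 + n * x.1.2, x.1.2) + y.1), v.2 + n), ?_, ?_, ?_⟩
  · fun_prop
  · exact Prod.ext (add_neg_cancel_left _ _) h2
  · intro v
    refine (mk_eq_iff.2 ⟨n, ?_, rfl⟩).symm
    change (torusShear ^ n) (v.1 : Torus4) = _
    rw [torusShear_zpow_mk]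
    exact (QuotientAddGroup.mk_add_of_mem _ h3).symm

instance : IsManifold 𝓘(ℝ, (ℂ × ℂ) × ℝ) ∞ Suspension :=
  uniformization_proj.isManifold.of_le le_top

end Suspension

namespace Suspension

instance : T2Space Torus4 := by
  refine (t2Space_iff_of_isOpenQuotientMap (π := (QuotientAddGroup.mk : ℂ × ℂ → Torus4))
    ⟨QuotientAddGroup.mk_surjective, continuous_quot_mk, QuotientAddGroup.isOpenMap_coe⟩).2 ?_
  have hc : IsClosed ((intLattice.prod intLattice : AddSubgroup (ℂ × ℂ)) : Set (ℂ × ℂ)) := by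
    have : (intLattice : Set ℂ) = Complex.re ⁻¹' (range ((↑) : ℤ → ℝ)) ∩
        Complex.im ⁻¹' (range ((↑) : ℤ → ℝ)) := by
      ext z
      constructor
      · rintro ⟨m, n, rfl⟩
        exact ⟨⟨m, by simp⟩, ⟨n, by simp⟩⟩
      · rintro ⟨⟨m, hm⟩, ⟨n, hn⟩⟩
        exact ⟨m, n, Complex.ext (by simp [hm]) (by simp [hn])⟩
    have h1 : IsClosed (intLattice : Set ℂ) := by
      rw [this]
      have h2 : IsClosed (range ((↑) : ℤ → ℝ)) := Int.isClosedEmbedding_coe_real.isClosed_range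
      exact (h2.preimage Complex.continuous_re).inter (h2.preimage Complex.continuous_im)
    exact h1.prod h1
  have : {q : (ℂ × ℂ) × (ℂ × ℂ) | (q.1 : Torus4) = q.2} = (fun q => -q.1 + q.2) ⁻¹'
      ((intLattice.prod intLattice : AddSubgroup (ℂ × ℂ)) : Set (ℂ × ℂ)) := by
    ext q
    exact QuotientAddGroup.eq
  rw [this]
  exact hc.preimage (by fun_prop)

instance : T2Space Suspension := by
  refine (t2Space_iff_of_isOpenQuotientMap (π := mk)
    ⟨mk_surjective, continuous_mk, isOpenMap_mk⟩).2 ?_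
  have hU : {q : (Torus4 × ℝ) × (Torus4 × ℝ) | mk q.1 = mk q.2} =
      ⋃ n : ℤ, {q : (Torus4 × ℝ) × (Torus4 × ℝ) | (torusShear ^ n) q.1.1 = q.2.1 ∧ q.1.2 + (n : ℝ) = q.2.2} := by
    ext q
    simp [mk_eq_iff]
  rw [hU]
  refine LocallyFinite.isClosed_iUnion ?_ fun n => ?_
  · intro q
    refine ⟨{p | |(p.2.2 - p.1.2) - (q.2.2 - q.1.2)| < 1}, ?_, ?_⟩
    · refine IsOpen.mem_nhds (isOpen_lt (by fun_prop) continuous_const) (by simp)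
    · refine (Set.finite_Icc (⌊q.2.2 - q.1.2 - 1⌋) (⌈q.2.2 - q.1.2 + 1⌉)).subset ?_
      rintro n ⟨p, ⟨-, hp⟩, hp'⟩
      have h3 : p.2.2 - p.1.2 = n := by linarith
      rw [mem_ofPred_eq, h3, abs_lt] at hp'
      constructor
      · exact_mod_cast (Int.floor_le _).trans (by linarith [hp'.1] : _ ≤ (n : ℝ))
      · exact_mod_cast (by linarith [hp'.2] : (n : ℝ) ≤ _).trans (Int.le_ceil _)
  · refine IsClosed.inter (isClosed_eq ?_ (by fun_prop)) (isClosed_eq (by fun_prop) (by fun_prop))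
    exact (torusShear ^ n).continuous.comp (by fun_prop)

instance : CompactSpace Suspension := by
  refine ⟨?_⟩
  have hK : IsCompact (((Icc (0 : ℝ) 1 ×ℂ Icc (0 : ℝ) 1) ×ˢ (Icc (0 : ℝ) 1 ×ℂ Icc (0 : ℝ) 1)) ×ˢ
      Icc (0 : ℝ) 1) :=
    ((isCompact_Icc.reProdIm isCompact_Icc).prod (isCompact_Icc.reProdIm isCompact_Icc)).prod
      isCompact_Icc
  have h1 := hK.image isLocalHomeomorph_proj.continuous
  convert h1
  symm
  rw [eq_univ_iff_forall]
  intro q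
  obtain ⟨⟨p, s⟩, rfl⟩ := mk_surjective q
  have h2 : mk (p, s) = mk ((torusShear ^ (-⌊s⌋)) p, Int.fract s) :=
    mk_eq_iff.2 ⟨-⌊s⌋, rfl, by
      rw [Int.cast_neg, ← sub_eq_add_neg]
      exact Int.self_sub_floor s⟩
  rw [h2]
  obtain ⟨v, hv⟩ := QuotientAddGroup.mk_surjective ((torusShear ^ (-⌊s⌋)) p)
  let r : ℂ → ℂ := fun z => ⟨Int.fract z.re, Int.fract z.im⟩
  have hr : ∀ z, -z + r z ∈ intLattice := fun z => ⟨-⌊z.re⌋, -⌊z.im⌋, by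
    have h3 := Int.self_sub_floor z.re
    have h4 := Int.self_sub_floor z.im
    apply Complex.ext
    · simp only [r, Complex.add_re, Complex.neg_re, Complex.mul_re, Complex.intCast_re,
        Complex.intCast_im, Complex.I_re, Complex.I_im]
      push_cast
      linarith
    · simp only [r, Complex.add_im, Complex.neg_im, Complex.mul_im, Complex.intCast_re,
        Complex.intCast_im, Complex.I_re, Complex.I_im]
      push_cast
      linarith⟩
  have hr' : ∀ z, r z ∈ (Icc (0 : ℝ) 1 ×ℂ Icc (0 : ℝ) 1) := fun z =>
    ⟨⟨Int.fract_nonneg _, (Int.fract_lt_one _).le⟩, ⟨Int.fract_nonneg _, (Int.fract_lt_one _).le⟩⟩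
  refine ⟨((r v.1, r v.2), Int.fract s), ⟨⟨hr' _, hr' _⟩,
    Int.fract_nonneg _, (Int.fract_lt_one _).le⟩, ?_⟩
  rw [← hv]
  refine congrArg (fun p => mk (p, Int.fract s)) ?_
  have h5 : -v + (r v.1, r v.2) ∈ intLattice.prod intLattice := ⟨hr _, hr _⟩
  exact (QuotientAddGroup.eq.2 h5).symm

/-- The part of `M` over the open arc `(a, a + 1/2)` of the circle `ℝ / ℤ`. -/
def chartDomain (a : ℝ) : Set Suspension := mk '' (univ ×ˢ Ioo a (a + 1 / 2))

/-- The projection to `𝕋⁴` along the lines `{p} × ℝ`, cut open at `a`: the class of `(p, s)` with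
`s ∈ [a, a + 1)` goes to `p`. -/
noncomputable def transverseProj (a : ℝ) : Suspension → Torus4 :=
  Quotient.lift (fun x => (torusShear ^ (-⌊x.2 - a⌋)) x.1) <| by
    rintro x y ⟨n, h1, h2⟩
    have h3 : y.2 - a = x.2 - a + n := by linarith
    change (torusShear ^ (-⌊x.2 - a⌋)) x.1 = (torusShear ^ (-⌊y.2 - a⌋)) y.1
    rw [h3, ← h1, Int.floor_add_intCast, ← Homeomorph.mul_apply, ← zpow_add]
    congr 2
    ring

theorem transverseProj_mk (a : ℝ) (x : Torus4 × ℝ) :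
    transverseProj a (mk x) = (torusShear ^ (-⌊x.2 - a⌋)) x.1 := rfl

theorem transverseProj_of_mem {a : ℝ} {x : Torus4 × ℝ} (hx : x.2 ∈ Ioo a (a + 1 / 2)) :
    transverseProj a (mk x) = x.1 := by
  have : ⌊x.2 - a⌋ = 0 := by
    rw [Int.floor_eq_iff]
    constructor <;> push_cast <;> linarith [hx.1, hx.2]
  rw [transverseProj_mk, this]
  simp

theorem contMDiffOn_transverseProj (a : ℝ) :
    ContMDiffOn 𝓘(ℝ, (ℂ × ℂ) × ℝ) 𝓘(ℝ, ℂ × ℂ) ∞ (transverseProj a) (chartDomain a) := by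
  rintro q ⟨⟨p, s⟩, ⟨-, hs⟩, rfl⟩
  refine ContMDiffAt.contMDiffWithinAt ?_
  refine uniformization_proj.contMDiffAt_of_comp fun y hy => ?_
  obtain ⟨n, h1, h2⟩ := mk_eq_iff.1 hy
  simp only at h1 h2 hs
  have hev : transverseProj a ∘ proj =ᶠ[𝓝 y] fun x =>
      (((x.1.1 + (n : ℂ) * x.1.2, x.1.2) : ℂ × ℂ) : Torus4) := by
    have hn : ∀ᶠ x : (ℂ × ℂ) × ℝ in 𝓝 y, x.2 + n ∈ Ioo a (a + 1 / 2) := by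
      refine ContinuousAt.eventually_mem (by fun_prop) (isOpen_Ioo.mem_nhds ?_)
      rw [h2]; exact hs
    filter_upwards [hn] with x hx
    have hfl : -⌊x.2 - a⌋ = n := by
      rw [neg_eq_iff_eq_neg, Int.floor_eq_iff]
      constructor <;> push_cast <;> linarith [hx.1, hx.2]
    change (torusShear ^ (-⌊x.2 - a⌋)) (x.1 : Torus4) = _
    rw [hfl, torusShear_zpow_mk]
  refine ContMDiffAt.congr_of_eventuallyEq ?_ hev
  refine ContMDiffAt.comp (g := (QuotientAddGroup.mk : ℂ × ℂ → Torus4)) y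
    (((uniformization_torus4 ℝ).contMDiff.of_le le_top).contMDiffAt) ?_
  refine ContDiffAt.contMDiffAt ?_
  fun_prop

theorem surjective_mfderiv_transverseProj (a : ℝ) (q : Suspension) (hq : q ∈ chartDomain a) :
    Function.Surjective (mfderiv 𝓘(ℝ, (ℂ × ℂ) × ℝ) 𝓘(ℝ, ℂ × ℂ) (transverseProj a) q) := by
  have hsm := contMDiffOn_transverseProj a
  have hopen : IsOpen (chartDomain a) := isOpenMap_mk _ (isOpen_univ.prod isOpen_Ioo)
  have hd := (hsm.contMDiffAt (hopen.mem_nhds hq)).mdifferentiableAt (by simp)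
  obtain ⟨⟨p, s⟩, ⟨-, hs⟩, rfl⟩ := hq
  obtain ⟨v, rfl⟩ := QuotientAddGroup.mk_surjective p
  have hev : transverseProj a ∘ proj =ᶠ[𝓝 (v, s)] (QuotientAddGroup.mk : ℂ × ℂ → Torus4) ∘ Prod.fst := by
    have hn : ∀ᶠ x : (ℂ × ℂ) × ℝ in 𝓝 (v, s), x.2 ∈ Ioo a (a + 1 / 2) :=
      ContinuousAt.eventually_mem (by fun_prop) (isOpen_Ioo.mem_nhds hs)
    filter_upwards [hn] with x hx
    exact transverseProj_of_mem hx
  have h1 := mfderiv_comp (I' := 𝓘(ℝ, (ℂ × ℂ) × ℝ)) (f := proj) (v, s) hd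
    ((uniformization_proj.contMDiff _).mdifferentiableAt (by simp))
  have h2 := mfderiv_comp (I := 𝓘(ℝ, (ℂ × ℂ) × ℝ)) (I' := 𝓘(ℝ, ℂ × ℂ)) (I'' := 𝓘(ℝ, ℂ × ℂ))
    (g := (QuotientAddGroup.mk : ℂ × ℂ → Torus4)) (f := Prod.fst) (v, s)
    (((uniformization_torus4 ℝ).contMDiff _).mdifferentiableAt (by simp))
    (contDiff_fst.contMDiff.contMDiffAt.mdifferentiableAt (n := 1) (by simp))
  have h3 := hev.mfderiv_eq (I := 𝓘(ℝ, (ℂ × ℂ) × ℝ)) (I' := 𝓘(ℝ, ℂ × ℂ))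
  have h4 : Function.Surjective (mfderiv 𝓘(ℝ, (ℂ × ℂ) × ℝ) 𝓘(ℝ, ℂ × ℂ)
      ((QuotientAddGroup.mk : ℂ × ℂ → Torus4) ∘ Prod.fst) ((v, s) : (ℂ × ℂ) × ℝ)) := by
    rw [h2]
    refine ((uniformization_torus4 ℝ).surjective_mfderiv v).comp ?_
    rw [mfderiv_eq_fderiv, fderiv_fst]
    exact Prod.fst_surjective
  have h5 : Function.Surjective ((mfderiv 𝓘(ℝ, (ℂ × ℂ) × ℝ) 𝓘(ℝ, ℂ × ℂ) (transverseProj a) (proj (v, s))).comp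
      (mfderiv 𝓘(ℝ, (ℂ × ℂ) × ℝ) 𝓘(ℝ, (ℂ × ℂ) × ℝ) proj (v, s))) := by
    rw [← h1, h3]; exact h4
  exact Function.Surjective.of_comp h5

theorem contMDiff_torusShear_zpow (n : ℤ) :
    ContMDiff 𝓘(ℝ, ℂ × ℂ) 𝓘(ℝ, ℂ × ℂ) ∞ (torusShear ^ n) := by
  intro q
  refine (uniformization_torus4 ℝ).contMDiffAt_of_comp fun y _ => ?_
  have : (torusShear ^ n) ∘ (QuotientAddGroup.mk : ℂ × ℂ → Torus4) =
      (QuotientAddGroup.mk : ℂ × ℂ → Torus4) ∘ fun x => (x.1 + (n : ℂ) * x.2, x.2) :=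
    funext fun x => torusShear_zpow_mk n x
  rw [this]
  refine ContMDiffAt.comp y
    (((uniformization_torus4 ℝ).contMDiff.of_le le_top).contMDiffAt) ?_
  refine ContDiffAt.contMDiffAt ?_
  fun_prop

/-- The suspension foliation on `M`, whose leaves are the images of the lines `{p} × ℝ`. Its
holonomy pseudogroup on `𝕋⁴` is generated by `A`. -/
noncomputable def foliation : Foliation ((ℂ × ℂ) × ℝ) Suspension (ℂ × ℂ) Torus4 where
  ι := ℝ
  U := chartDomain
  isOpen_U a := isOpenMap_mk _ (isOpen_univ.prod isOpen_Ioo)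
  cover := by
    rw [eq_univ_iff_forall]
    intro q
    obtain ⟨⟨p, s⟩, rfl⟩ := mk_surjective q
    exact mem_iUnion.2 ⟨s - 1 / 4, _, ⟨trivial, by constructor <;> simp only <;> linarith⟩, rfl⟩
  f := transverseProj
  smooth_f := contMDiffOn_transverseProj
  submersion_f := surjective_mfderiv_transverseProj
  connected_plaque a t _ := by
    have : chartDomain a ∩ transverseProj a ⁻¹' {t} = mk '' ({t} ×ˢ Ioo a (a + 1 / 2)) := by
      ext q
      constructor
      · rintro ⟨⟨x, hx, rfl⟩, ht⟩
        rw [mem_preimage, transverseProj_of_mem hx.2] at ht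
        exact ⟨x, ⟨ht, hx.2⟩, rfl⟩
      · rintro ⟨x, hx, rfl⟩
        refine ⟨⟨x, ⟨trivial, hx.2⟩, rfl⟩, ?_⟩
        rw [mem_preimage, transverseProj_of_mem hx.2]
        exact hx.1
    rw [this]
    exact (isConnected_singleton.prod (isConnected_Ioo (by linarith))).image _
      continuous_mk.continuousOn
  γ a b := (torusShear ^ round (b - a)).toOpenPartialHomeomorph
  smooth_γ a b _ := (contMDiff_torusShear_zpow _).contMDiffOn
  smooth_γ_symm a b _ := by
    have h : ⇑(torusShear ^ round (b - a)).toOpenPartialHomeomorph.symm =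
        ⇑(torusShear ^ (-round (b - a))) := by rw [zpow_neg]; rfl
    rw [h]
    exact (contMDiff_torusShear_zpow _).contMDiffOn
  mem_source _ _ _ _ := trivial
  cocycle a b q hq := by
    obtain ⟨⟨x, hx, rfl⟩, ⟨y, hy, hxy⟩⟩ := hq
    obtain ⟨n, h1, h2⟩ := mk_eq_iff.1 hxy.symm
    have hn : round (b - a) = n := by
      rw [round_eq, Int.floor_eq_iff]
      constructor <;> linarith [hx.2.1, hx.2.2, hy.2.1, hy.2.2]
    rw [transverseProj_of_mem hx.2, ← hxy, transverseProj_of_mem hy.2, hn, ← h1]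
    rfl

end Suspension

/-! ### Smooth functions on `𝕋²` and the space `V` -/

/-- The space `C^∞(𝕋², ℂ)`. -/
def SmoothTorus2 : Submodule ℂ (Torus2 → ℂ) where
  carrier := {g | ContMDiff 𝓘(ℝ, ℂ) 𝓘(ℝ, ℂ) ∞ g}
  add_mem' := fun hf hg => hf.add hg
  zero_mem' := contMDiff_const
  smul_mem' := fun c _ hf =>
    ((contDiff_const_smul (𝕜 := ℝ) (n := ∞) (F := ℂ) c).contMDiff).comp hf

/-- A function on `𝕋²`, seen as a periodic function on `ℂ`. -/
def periodic (g : SmoothTorus2) (z : ℂ) : ℂ := g.1 (z : Torus2)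

theorem contDiff_periodic (g : SmoothTorus2) : ContDiff ℝ ∞ (periodic g) :=
  contMDiff_iff_contDiff.1
    (ContMDiff.comp g.2 ((uniformization_torus2 ℝ).contMDiff.of_le le_top))

theorem differentiable_periodic (g : SmoothTorus2) : Differentiable ℝ (periodic g) :=
  (contDiff_periodic g).differentiable (by simp)

/-- The operator `∂ / ∂z = (∂ / ∂x - i ∂ / ∂y) / 2`. -/
noncomputable def wirtinger (g : ℂ → ℂ) (z : ℂ) : ℂ :=
  (fderiv ℝ g z 1 - Complex.I * fderiv ℝ g z Complex.I) / 2

/-- The operator `∂ / ∂z̄ = (∂ / ∂x + i ∂ / ∂y) / 2`. -/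
noncomputable def wirtingerBar (g : ℂ → ℂ) (z : ℂ) : ℂ :=
  (fderiv ℝ g z 1 + Complex.I * fderiv ℝ g z Complex.I) / 2

theorem fderiv_periodic_add (f g : SmoothTorus2) (z v : ℂ) :
    fderiv ℝ (periodic (f + g)) z v = fderiv ℝ (periodic f) z v + fderiv ℝ (periodic g) z v := by
  have : periodic (f + g) = periodic f + periodic g := rfl
  rw [this, fderiv_add (differentiable_periodic f z) (differentiable_periodic g z)]
  rfl

theorem fderiv_periodic_smul (c : ℂ) (g : SmoothTorus2) (z v : ℂ) :
    fderiv ℝ (periodic (c • g)) z v = c * fderiv ℝ (periodic g) z v := by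
  have : periodic (c • g) = c • periodic g := rfl
  rw [this, fderiv_const_smul (differentiable_periodic g z)]
  rfl

theorem fderiv_periodic_zero (z v : ℂ) : fderiv ℝ (periodic 0) z v = 0 := by
  have h := fderiv_periodic_smul 0 0 z v
  rwa [zero_smul, zero_mul] at h

/-- The space `V` of triples `(b, c, e)` of smooth functions on `𝕋²` with
`∂b/∂z̄ = ∂c/∂z` and `∂c/∂z̄ = ∂e/∂z`. -/
def spaceV : Submodule ℂ (SmoothTorus2 × SmoothTorus2 × SmoothTorus2) where
  carrier := {p | ∀ z,
    wirtingerBar (periodic p.1) z - wirtinger (periodic p.2.1) z = 0 ∧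
    wirtingerBar (periodic p.2.1) z - wirtinger (periodic p.2.2) z = 0}
  add_mem' := by
    intro p q hp hq z
    obtain ⟨h1, h2⟩ := hp z
    obtain ⟨h3, h4⟩ := hq z
    simp only [wirtinger, wirtingerBar, Prod.fst_add, Prod.snd_add, fderiv_periodic_add] at *
    constructor
    · linear_combination h1 + h3
    · linear_combination h2 + h4
  zero_mem' := by
    intro z
    simp [wirtinger, wirtingerBar, fderiv_periodic_zero]
  smul_mem' := by
    intro c p hp z
    obtain ⟨h1, h2⟩ := hp z
    simp only [wirtinger, wirtingerBar, Prod.smul_fst, Prod.smul_snd, fderiv_periodic_smul] at *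
    constructor
    · linear_combination c * h1
    · linear_combination c * h2

/-! ### Representatives of cohomology classes -/

namespace Suspension

/-- The covector `dw` on the covering `ℂ² × ℝ` of `M`, which has coordinates `((w, z), s)`. -/
def dw (u : (ℂ × ℂ) × ℝ) : ℂ := u.1.1

/-- The covector `dz`. -/
def dz (u : (ℂ × ℂ) × ℝ) : ℂ := u.1.2

/-- The covector `dw̄`. -/
def dwBar (u : (ℂ × ℂ) × ℝ) : ℂ := (starRingEnd ℂ) u.1.1

/-- The covector `dz̄`. -/
def dzBar (u : (ℂ × ℂ) × ℝ) : ℂ := (starRingEnd ℂ) u.1.2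

/-- The wedge product `θ₁ ∧ … ∧ θₖ` of covectors, evaluated on `u₁, …, uₖ`. -/
noncomputable def wedge {k : ℕ} (θ : Fin k → ((ℂ × ℂ) × ℝ → ℂ)) (u : Fin k → (ℂ × ℂ) × ℝ) : ℂ :=
  Matrix.det (Matrix.of fun i j => θ i (u j))

/-- The basic class `h` contains a closed basic form whose pullback to `ℂ² × ℝ`, at the point `x`,
takes the value `η x u` on `u₁, …, uₖ`. -/
def IsRepresentedBy {k : ℕ} (h : foliation.basicCohomology ℂ k)
    (η : (ℂ × ℂ) × ℝ → (Fin k → (ℂ × ℂ) × ℝ) → ℂ) : Prop :=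
  ∃ α : foliation.closedForms ℂ k, Submodule.Quotient.mk α = h ∧
    ∀ x (u : Fin k → (ℂ × ℂ) × ℝ), RoughForm.pullback proj α.1 x u = η x u

end Suspension

/-!
A basic form is determined by its lift to `ℂ² × ℝ`, a horizontal form which does not depend on the
last coordinate and is invariant under the deck transformations. On fixed vectors the lift is
periodic under a lattice, hence bounded, whereas its values on the images of these vectors under
the `n`-th power of the shear are polynomial in `n`. A bounded polynomial is constant, so the
covectors of a basic form are invariant under the shear, and its coefficients are functions on the
torus `𝕋⁴` invariant under the shear. Since the shear translates the fibre over `z` by `z`, and the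
multiples of a generic `z` are dense modulo the lattice, such functions depend on `z` only.

Basic forms are therefore combinations of finitely many constant covectors with coefficients in
`C^∞(𝕋²)`, on which `d` acts through `∂/∂z` and `∂/∂z̄`. These are combinations of the commuting
derivatives along two periods, for each of which `C^∞(𝕋²)` is the direct sum of the range and the
kernel: a function is the derivative of a smooth function exactly when its means along the closed
orbits vanish.
-/

universe u

/-! ### Parametric integrals -/

section ParametricIntegral

variable {E F : Type u} [NormedAddCommGroup E] [NormedSpace ℝ E] [ProperSpace E]
  [NormedAddCommGroup F] [NormedSpace ℝ F] {a b : ℝ}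

theorem hasFDerivAt_intervalIntegral_of_contDiff {G : E × ℝ → F} (hG : ContDiff ℝ 1 G) (p : E) :
    HasFDerivAt (fun p => ∫ t in a..b, G (p, t))
      (∫ t in a..b, (fderiv ℝ G (p, t)).comp (ContinuousLinearMap.inl ℝ E ℝ)) p := by
  have hG' : Continuous fun q => (fderiv ℝ G q).comp (ContinuousLinearMap.inl ℝ E ℝ) :=
    (hG.continuous_fderiv one_ne_zero).clm_comp continuous_const
  obtain ⟨C, hC⟩ := ((isCompact_closedBall p 1).prod
    (isCompact_uIcc (a := a) (b := b))).exists_bound_of_continuousOn hG'.continuousOn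
  refine intervalIntegral.hasFDerivAt_integral_of_dominated_of_fderiv_le (𝕜 := ℝ)
    (F := fun p t => G (p, t)) (bound := fun _ => C)
    (F' := fun p t => (fderiv ℝ G (p, t)).comp (ContinuousLinearMap.inl ℝ E ℝ))
    (Metric.ball_mem_nhds p one_pos) ?_ ?_ ?_ ?_ intervalIntegrable_const ?_
  · exact .of_forall fun q => (hG.continuous.comp (by fun_prop)).aestronglyMeasurable
  · exact (hG.continuous.comp (by fun_prop)).intervalIntegrable _ _
  · exact (hG'.comp (by fun_prop)).aestronglyMeasurable
  · exact .of_forall fun t ht q hq =>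
      hC (q, t) ⟨Metric.ball_subset_closedBall hq, uIoc_subset_uIcc ht⟩
  · exact .of_forall fun t _ q _ =>
      (hG.differentiable one_ne_zero (q, t)).hasFDerivAt.comp q (hasFDerivAt_prodMk_left q t)

theorem contDiff_nat_intervalIntegral (n : ℕ) {F : Type u} [NormedAddCommGroup F]
    [NormedSpace ℝ F] {G : E × ℝ → F} (hG : ContDiff ℝ ∞ G) :
    ContDiff ℝ n fun p => ∫ t in a..b, G (p, t) := by
  induction n generalizing F with
  | zero =>
    exact contDiff_zero.2 <| continuous_iff_continuousAt.2 fun p =>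
      (hasFDerivAt_intervalIntegral_of_contDiff (hG.of_le (by simp)) p).continuousAt
  | succ n ih =>
    refine (contDiff_succ_iff_hasFDerivAt (n := n)).2
      ⟨_, ?_, hasFDerivAt_intervalIntegral_of_contDiff (hG.of_le (by simp))⟩
    exact ih (G := fun q => (fderiv ℝ G q).comp (ContinuousLinearMap.inl ℝ E ℝ))
      ((hG.fderiv_right (m := ∞) (by simp)).clm_comp contDiff_const)

theorem contDiff_intervalIntegral {G : E × ℝ → F} (hG : ContDiff ℝ ∞ G) :
    ContDiff ℝ ∞ fun p => ∫ t in a..b, G (p, t) :=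
  contDiff_infty.2 fun n => contDiff_nat_intervalIntegral n hG

theorem fderiv_integral_smul_comp_add {c : ℝ → ℝ} (hc : ContDiff ℝ ∞ c) {f : E → F}
    (hf : ContDiff ℝ ∞ f) (v w z : E) :
    fderiv ℝ (fun z => ∫ t in a..b, c t • f (z + t • v)) z w =
      ∫ t in a..b, c t • fderiv ℝ f (z + t • v) w := by
  let G : E × ℝ → F := fun q => c q.2 • f (q.1 + q.2 • v)
  have hG : ContDiff ℝ ∞ G := by fun_prop
  have hG' : Continuous fun t : ℝ => (fderiv ℝ G (z, t)).comp (ContinuousLinearMap.inl ℝ E ℝ) :=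
    ((hG.continuous_fderiv (by simp)).clm_comp continuous_const).comp (by fun_prop)
  change fderiv ℝ (fun z => ∫ t in a..b, G (z, t)) z w = _
  rw [(hasFDerivAt_intervalIntegral_of_contDiff (hG.of_le (by simp)) z).fderiv,
    ContinuousLinearMap.intervalIntegral_apply (hG'.intervalIntegrable _ _)]
  refine intervalIntegral.integral_congr fun t _ => ?_
  have hslice : HasFDerivAt (G ∘ fun z => (z, t)) _ z :=
    (hG.differentiable (by simp) (z, t)).hasFDerivAt.comp z (hasFDerivAt_prodMk_left z t)
  have hslice' : HasFDerivAt (fun z => c t • f (z + t • v)) _ z :=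
    ((hf.differentiable (by simp) (z + t • v)).hasFDerivAt.comp z
      ((hasFDerivAt_id z).add_const (t • v))).const_smul (c t)
  exact DFunLike.congr_fun (hslice.unique hslice') w

end ParametricIntegral

/-! ### Smooth functions on `𝕋²` -/

/-- A smooth function on `ℂ` with periods `ℤ + ℤ i`: a smooth function on `𝕋²`, read on the
universal covering. -/
structure IsSmoothPeriodic (f : ℂ → ℂ) : Prop where
  contDiff : ContDiff ℝ ∞ f
  periodic : ∀ v ∈ intLattice, Function.Periodic f v

theorem isSmoothPeriodic_periodic (g : SmoothTorus2) : IsSmoothPeriodic (periodic g) :=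
  ⟨contDiff_periodic g, fun _ hv z => congrArg g.1 (QuotientAddGroup.mk_add_of_mem z hv)⟩

theorem periodic_zero (z : ℂ) : periodic 0 z = 0 := rfl

theorem periodic_sub (f g : SmoothTorus2) (z : ℂ) :
    periodic (f - g) z = periodic f z - periodic g z := rfl

namespace IsSmoothPeriodic

variable {f : ℂ → ℂ}

/-- The function on `𝕋²` induced by a smooth periodic function. -/
noncomputable def toTorus (hf : IsSmoothPeriodic f) : SmoothTorus2 :=
  ⟨Quotient.lift f fun x y hxy => by
    rw [← hf.periodic _ (QuotientAddGroup.leftRel_apply.1 hxy) x, add_neg_cancel_left],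
    fun _ => (uniformization_torus2 ℝ).contMDiffAt_of_comp fun y _ => hf.contDiff.contMDiff y⟩

theorem periodic_toTorus (hf : IsSmoothPeriodic f) : _root_.periodic hf.toTorus = f := rfl

theorem fderiv_apply (hf : IsSmoothPeriodic f) (v : ℂ) :
    IsSmoothPeriodic fun z => fderiv ℝ f z v where
  contDiff := (hf.contDiff.fderiv_right (m := ∞) (by simp)).clm_apply contDiff_const
  periodic w hw z := by
    beta_reduce
    rw [← fderiv_comp_add_right, funext (hf.periodic w hw)]

theorem integral_smul_comp_add (hf : IsSmoothPeriodic f) {c : ℝ → ℝ} (hc : ContDiff ℝ ∞ c) (v : ℂ) :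
    IsSmoothPeriodic fun z => ∫ t in (0 : ℝ)..1, c t • f (z + t • v) where
  contDiff := by
    have := hf.contDiff
    exact contDiff_intervalIntegral (G := fun q : ℂ × ℝ => c q.2 • f (q.1 + q.2 • v)) (by fun_prop)
  periodic w hw z := by
    have h : ∀ t : ℝ, f (z + w + t • v) = f (z + t • v) := fun t => by
      rw [add_right_comm, hf.periodic w hw]
    simp only [h]

end IsSmoothPeriodic

theorem periodic_injective : Function.Injective periodic := fun _ _ h =>
  Subtype.ext <| funext <| QuotientAddGroup.mk_surjective.forall.2 <| congrFun h

theorem smoothTorus2_ext {f g : SmoothTorus2} (h : ∀ z, periodic f z = periodic g z) : f = g :=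
  periodic_injective (funext h)

/-- The constant functions on `𝕋²`. -/
def constTorus2 : ℂ →ₗ[ℂ] SmoothTorus2 where
  toFun c := ⟨fun _ => c, contMDiff_const⟩
  map_add' _ _ := rfl
  map_smul' _ _ := rfl

theorem constTorus2_injective : Function.Injective constTorus2 := fun _ _ h =>
  congrArg (fun g => periodic g 0) h

/-- The derivative in the direction `v` on `C^∞(𝕋²)`. -/
noncomputable def dirDeriv (v : ℂ) : SmoothTorus2 →ₗ[ℂ] SmoothTorus2 where
  toFun g := ((isSmoothPeriodic_periodic g).fderiv_apply v).toTorus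
  map_add' f g := smoothTorus2_ext fun z => fderiv_periodic_add f g z v
  map_smul' c g := smoothTorus2_ext fun z => fderiv_periodic_smul c g z v

theorem commute_dirDeriv (v w : ℂ) : Commute (dirDeriv v) (dirDeriv w) := by
  refine LinearMap.ext fun g => smoothTorus2_ext fun z => ?_
  have hg : DifferentiableAt ℝ (fderiv ℝ (periodic g)) z :=
    ((contDiff_periodic g).fderiv_right (m := ∞) (by simp)).differentiable (by simp) z
  have hdd : ∀ v w, periodic (dirDeriv v (dirDeriv w g)) z =
      fderiv ℝ (fderiv ℝ (periodic g)) z v w := fun v w => by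
    change fderiv ℝ (fun z => fderiv ℝ (periodic g) z w) z v = _
    rw [fderiv_clm_apply hg (differentiableAt_const w)]
    simp
  have hsymm : IsSymmSndFDerivAt ℝ (periodic g) z :=
    (contDiff_periodic g).contDiffAt.isSymmSndFDerivAt <| by
      rw [minSmoothness_of_isRCLikeNormedField]
      exact WithTop.coe_le_coe.2 le_top
  exact (hdd v w).trans ((hsymm v w).trans (hdd w v).symm)

section LineIntegral

variable {c : ℝ → ℝ} (hc : ContDiff ℝ ∞ c)

/-- The weighted integral `z ↦ ∫₀¹ c(t) g(z + t v) dt`. For a period `v`, the weights `1` and `t`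
give the mean of `g` along the circle `z + ℝ v` and a primitive of `g` minus this mean. -/
noncomputable def lineIntegral (v : ℂ) (g : SmoothTorus2) : SmoothTorus2 :=
  ((isSmoothPeriodic_periodic g).integral_smul_comp_add hc v).toTorus

theorem dirDeriv_lineIntegral (v w : ℂ) (g : SmoothTorus2) :
    dirDeriv w (lineIntegral hc v g) = lineIntegral hc v (dirDeriv w g) :=
  smoothTorus2_ext fun z => fderiv_integral_smul_comp_add hc (contDiff_periodic g) v w z

theorem lineIntegral_zero (v : ℂ) : lineIntegral hc v 0 = 0 := by
  refine smoothTorus2_ext fun z => ?_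
  have h : ∀ z, periodic 0 z = 0 := fun _ => rfl
  simp only [lineIntegral, IsSmoothPeriodic.periodic_toTorus, h, smul_zero,
    intervalIntegral.integral_zero]

theorem periodic_lineIntegral_dirDeriv {v : ℂ} (hv : v ∈ intLattice) (g : SmoothTorus2) (z : ℂ) :
    periodic (lineIntegral hc v (dirDeriv v g)) z =
      (c 1 - c 0) • periodic g z - ∫ t in (0 : ℝ)..1, deriv c t • periodic g (z + t • v) := by
  have hline : ∀ t : ℝ, HasDerivAt (fun t : ℝ => periodic g (z + t • v))
      (fderiv ℝ (periodic g) (z + t • v) v) t := fun t => by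
    have h : HasDerivAt (fun t : ℝ => z + t • v) v t := by
      simpa using ((hasDerivAt_id t).smul_const v).const_add z
    exact (differentiable_periodic g _).hasFDerivAt.comp_hasDerivAt t h
  have hcont : Continuous fun t : ℝ => fderiv ℝ (periodic g) (z + t • v) v :=
    (((contDiff_periodic g).continuous_fderiv (by simp)).comp (by fun_prop)).clm_apply
      continuous_const
  have hparts := intervalIntegral.integral_smul_deriv_eq_deriv_smul (a := 0) (b := 1)
    (fun t _ => (hc.differentiable (by simp) t).hasDerivAt) (fun t _ => hline t)
    ((hc.continuous_deriv (by simp)).intervalIntegrable _ _) (hcont.intervalIntegrable _ _)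
  have hper : periodic g (z + v) = periodic g z := (isSmoothPeriodic_periodic g).periodic v hv z
  rw [one_smul, zero_smul, add_zero, hper, ← sub_smul] at hparts
  exact hparts

end LineIntegral

theorem isCompl_range_ker_dirDeriv {v : ℂ} (hv : v ∈ intLattice) :
    IsCompl (LinearMap.range (dirDeriv v)) (LinearMap.ker (dirDeriv v)) := by
  let mean := lineIntegral (contDiff_const (c := (1 : ℝ))) v
  let primitive := lineIntegral (contDiff_id (E := ℝ)) v
  have hmean (g) : mean (dirDeriv v g) = 0 := smoothTorus2_ext fun z => by
    simp only [mean, periodic_lineIntegral_dirDeriv _ hv, deriv_const, sub_self, zero_smul,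
      intervalIntegral.integral_zero]
    rfl
  have hprimitive (g) : primitive (dirDeriv v g) + mean g = g := smoothTorus2_ext fun z => by
    change periodic (primitive (dirDeriv v g)) z + ∫ t in (0 : ℝ)..1, (1 : ℝ) • _ = _
    simp only [primitive, periodic_lineIntegral_dirDeriv _ hv, id_eq, sub_zero, one_smul, deriv_id,
      sub_add_cancel]
  constructor
  · rw [Submodule.disjoint_def]
    rintro _ ⟨g, rfl⟩ hg
    rw [← hprimitive (dirDeriv v g), hmean, LinearMap.mem_ker.1 hg, add_zero]
    exact lineIntegral_zero _ v
  · rw [codisjoint_iff, Submodule.eq_top_iff']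
    refine fun g => Submodule.mem_sup.2 ⟨_, ⟨primitive g, rfl⟩, mean g, ?_, ?_⟩
    · exact (dirDeriv_lineIntegral _ v v g).trans (hmean g)
    · exact (congrArg (· + mean g) (dirDeriv_lineIntegral _ v v g)).trans (hprimitive g)

/-! ### Commuting endomorphisms whose range and kernel are complementary -/

section CommutingEndomorphisms

variable {R V : Type*} [Ring R] [AddCommGroup V] [Module R V] {D D' : Module.End R V}

theorem apply_eq_zero_of_isCompl_range_ker (hD : IsCompl (LinearMap.range D) (LinearMap.ker D))
    {x : V} (hx : D (D x) = 0) : D x = 0 :=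
  Submodule.disjoint_def.1 hD.disjoint _ ⟨x, rfl⟩ hx

theorem exists_eq_apply_add_of_isCompl_range_ker
    (hD : IsCompl (LinearMap.range D) (LinearMap.ker D)) (x : V) :
    ∃ p m, D m = 0 ∧ x = D p + m := by
  have hx : x ∈ LinearMap.range D ⊔ LinearMap.ker D := hD.sup_eq_top ▸ Submodule.mem_top
  obtain ⟨_, ⟨p, rfl⟩, m, hm, hx⟩ := Submodule.mem_sup.1 hx
  exact ⟨p, m, hm, hx.symm⟩

variable (hcomm : Commute D D') (hD : IsCompl (LinearMap.range D) (LinearMap.ker D))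
  (hD' : IsCompl (LinearMap.range D') (LinearMap.ker D'))

include hcomm in
theorem apply_apply_comm_of_commute (x : V) : D (D' x) = D' (D x) := LinearMap.congr_fun hcomm x

include hcomm hD hD' in
theorem exists_eq_apply_add_of_mem_ker {x : V} (hx : D x = 0) :
    ∃ q c, D q = 0 ∧ D c = 0 ∧ D' c = 0 ∧ x = D' q + c := by
  obtain ⟨r, c, hc, rfl⟩ := exists_eq_apply_add_of_isCompl_range_ker hD' x
  obtain ⟨s, q, hq, rfl⟩ := exists_eq_apply_add_of_isCompl_range_ker hD r
  have hsc : D (D (D' s)) + D c = 0 := by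
    simpa [apply_apply_comm_of_commute hcomm, hq] using hx
  have hD'DD : D' (D (D s)) = 0 := by
    refine apply_eq_zero_of_isCompl_range_ker hD' ?_
    simpa [← apply_apply_comm_of_commute hcomm, hc] using congrArg D' hsc
  have hDD' : D (D' s) = 0 := by
    refine apply_eq_zero_of_isCompl_range_ker hD ?_
    simpa only [apply_apply_comm_of_commute hcomm] using hD'DD
  refine ⟨q, c, hq, ?_, hc, ?_⟩
  · rwa [hDD', map_zero, zero_add] at hsc
  · rw [map_add, ← apply_apply_comm_of_commute hcomm, hDD', zero_add]

include hcomm hD hD' in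
theorem exists_eq_apply_add_apply_add (x : V) :
    ∃ p q c, D q = 0 ∧ D c = 0 ∧ D' c = 0 ∧ x = D p + D' q + c := by
  obtain ⟨p, m, hm, rfl⟩ := exists_eq_apply_add_of_isCompl_range_ker hD x
  obtain ⟨q, c, hq, hc, hc', rfl⟩ := exists_eq_apply_add_of_mem_ker hcomm hD hD' hm
  exact ⟨p, q, c, hq, hc, hc', (add_assoc _ _ _).symm⟩

include hcomm hD hD' in
theorem apply_add_apply_eq_zero {f g : V} (h : D (D f + D' g) = 0) (h' : D' (D f + D' g) = 0) :
    D f + D' g = 0 := by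
  obtain ⟨p, m, hm, rfl⟩ := exists_eq_apply_add_of_isCompl_range_ker hD g
  have hsum : D f + D' (D p + m) = D (f + D' p) + D' m := by
    rw [map_add, map_add, apply_apply_comm_of_commute hcomm, add_assoc]
  have hfp : D (f + D' p) = 0 := by
    refine apply_eq_zero_of_isCompl_range_ker hD ?_
    rwa [hsum, map_add, apply_apply_comm_of_commute hcomm m, hm, map_zero, add_zero] at h
  rw [hsum, hfp, zero_add] at h' ⊢
  exact apply_eq_zero_of_isCompl_range_ker hD' h'

include hcomm hD hD' in
theorem exists_potential {a b : V} (hab : D' a = D b) :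
    ∃ f l m, (D l = 0 ∧ D' l = 0) ∧ (D m = 0 ∧ D' m = 0) ∧ a = l + D f ∧ b = m + D' f := by
  obtain ⟨p, l, hl, rfl⟩ := exists_eq_apply_add_of_isCompl_range_ker hD a
  have hD'l : D' l = D (b - D' p) := by
    rw [map_sub, ← hab, map_add, apply_apply_comm_of_commute hcomm, add_sub_cancel_left]
  have hb : D (b - D' p) = 0 := by
    refine apply_eq_zero_of_isCompl_range_ker hD ?_
    rw [← hD'l, apply_apply_comm_of_commute hcomm, hl, map_zero]
  obtain ⟨q, m, hq, hm, hm', hbq⟩ := exists_eq_apply_add_of_mem_ker hcomm hD hD' hb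
  refine ⟨p + q, l, m, ⟨hl, hD'l.trans hb⟩, ⟨hm, hm'⟩, ?_, ?_⟩
  · rw [map_add, hq, add_zero, add_comm]
  · rw [map_add, eq_add_of_sub_eq hbq]
    abel

end CommutingEndomorphisms

/-! ### The operators `∂` and `∂̄` on `𝕋²` -/

open Complex (I I_mul_I)

theorem one_mem_intLattice : (1 : ℂ) ∈ intLattice := ⟨1, 0, by simp⟩

theorem I_mem_intLattice : I ∈ intLattice := ⟨0, 1, by simp⟩

/-- The operator `∂ / ∂z` on `C^∞(𝕋²)`. -/
noncomputable def del : SmoothTorus2 →ₗ[ℂ] SmoothTorus2 :=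
  (2⁻¹ : ℂ) • (dirDeriv 1 - I • dirDeriv I)

/-- The operator `∂ / ∂z̄` on `C^∞(𝕋²)`. -/
noncomputable def delBar : SmoothTorus2 →ₗ[ℂ] SmoothTorus2 :=
  (2⁻¹ : ℂ) • (dirDeriv 1 + I • dirDeriv I)

theorem del_apply (g : SmoothTorus2) : del g = (2⁻¹ : ℂ) • (dirDeriv 1 g - I • dirDeriv I g) := rfl

theorem delBar_apply (g : SmoothTorus2) :
    delBar g = (2⁻¹ : ℂ) • (dirDeriv 1 g + I • dirDeriv I g) := rfl

theorem periodic_del (g : SmoothTorus2) (z : ℂ) :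
    periodic (del g) z = wirtinger (periodic g) z :=
  (div_eq_inv_mul _ (2 : ℂ)).symm

theorem periodic_delBar (g : SmoothTorus2) (z : ℂ) :
    periodic (delBar g) z = wirtingerBar (periodic g) z :=
  (div_eq_inv_mul _ (2 : ℂ)).symm

theorem fderiv_eq_wirtinger (f : ℂ → ℂ) (z v : ℂ) :
    fderiv ℝ f z v = wirtinger f z * v + wirtingerBar f z * (starRingEnd ℂ) v := by
  have hv : fderiv ℝ f z v = v.re * fderiv ℝ f z 1 + v.im * fderiv ℝ f z I := by
    conv_lhs => rw [show v = v.re • (1 : ℂ) + v.im • I by simp [Complex.re_add_im]]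
    rw [map_add, map_smul, map_smul, Complex.real_smul, Complex.real_smul]
  have hre : v + (starRingEnd ℂ) v = 2 * v.re := by exact_mod_cast Complex.add_conj v
  have him : v - (starRingEnd ℂ) v = 2 * v.im * I := by exact_mod_cast Complex.sub_conj v
  rw [hv, wirtinger, wirtingerBar]
  linear_combination -fderiv ℝ f z 1 / 2 * hre + I * fderiv ℝ f z I / 2 * him +
    v.im * fderiv ℝ f z I * I_mul_I

theorem fderiv_periodic_eq_del_add_delBar (g : SmoothTorus2) (z v : ℂ) :
    fderiv ℝ (periodic g) z v =
      periodic (del g) z * v + periodic (delBar g) z * (starRingEnd ℂ) v := by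
  rw [fderiv_eq_wirtinger, periodic_del, periodic_delBar]

theorem del_add_delBar (g : SmoothTorus2) : del g + delBar g = dirDeriv 1 g := by
  rw [del_apply, delBar_apply]
  module

theorem del_sub_delBar (g : SmoothTorus2) : del g - delBar g = -I • dirDeriv I g := by
  rw [del_apply, delBar_apply]
  module

theorem dirDeriv_const (v c : ℂ) : dirDeriv v (constTorus2 c) = 0 :=
  smoothTorus2_ext fun z => by
    change fderiv ℝ (fun _ => c) z v = 0
    rw [fderiv_fun_const, Pi.zero_apply, zero_apply]

theorem del_const (c : ℂ) : del (constTorus2 c) = 0 := by simp [del_apply, dirDeriv_const]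

theorem delBar_const (c : ℂ) : delBar (constTorus2 c) = 0 := by simp [delBar_apply, dirDeriv_const]

theorem exists_const_of_dirDeriv_eq_zero {g : SmoothTorus2} (hx : dirDeriv 1 g = 0)
    (hy : dirDeriv I g = 0) : ∃ l, g = constTorus2 l := by
  have hfderiv : ∀ z, fderiv ℝ (periodic g) z = 0 := fun z => by
    refine ContinuousLinearMap.ext fun v => ?_
    have hvx : fderiv ℝ (periodic g) z 1 = 0 := congrArg (periodic · z) hx
    have hvy : fderiv ℝ (periodic g) z I = 0 := congrArg (periodic · z) hy
    have hv : v = v.re • (1 : ℂ) + v.im • I := by simp [Complex.re_add_im]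
    rw [hv, map_add, map_smul, map_smul, hvx, hvy, smul_zero, smul_zero, add_zero, zero_apply]
  exact ⟨periodic g 0, smoothTorus2_ext fun z =>
    is_const_of_fderiv_eq_zero (differentiable_periodic g) hfderiv z 0⟩

theorem exists_const_of_del_eq_zero {g : SmoothTorus2} (hz : del g = 0) (hzBar : delBar g = 0) :
    ∃ l, g = constTorus2 l := by
  refine exists_const_of_dirDeriv_eq_zero ?_ ?_
  · rw [← del_add_delBar, hz, hzBar, add_zero]
  · simpa [hz, hzBar] using (del_sub_delBar g).symm

theorem exists_eq_const_add_del_sub_delBar (h : SmoothTorus2) :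
    ∃ l f g, h = constTorus2 l + (del g - delBar f) := by
  obtain ⟨p, q, c, -, hcx, hcy, rfl⟩ := exists_eq_apply_add_apply_add (commute_dirDeriv 1 I)
    (isCompl_range_ker_dirDeriv one_mem_intLattice) (isCompl_range_ker_dirDeriv I_mem_intLattice) h
  obtain ⟨l, rfl⟩ := exists_const_of_dirDeriv_eq_zero hcx hcy
  refine ⟨l, I • q - p, p + I • q, ?_⟩
  simp only [del_apply, delBar_apply, map_add, map_sub, map_smul]
  linear_combination (norm := module) I_mul_I • dirDeriv I q

theorem eq_zero_of_const_eq_del_sub_delBar {l : ℂ} {f g : SmoothTorus2}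
    (h : constTorus2 l = del g - delBar f) : l = 0 := by
  have hsum : del g - delBar f = dirDeriv 1 ((2⁻¹ : ℂ) • (g - f)) +
      dirDeriv I ((-(2⁻¹ * I) : ℂ) • (g + f)) := by
    simp only [del_apply, delBar_apply, map_add, map_sub, map_smul]
    module
  have hzero := apply_add_apply_eq_zero (commute_dirDeriv 1 I)
    (isCompl_range_ker_dirDeriv one_mem_intLattice) (isCompl_range_ker_dirDeriv I_mem_intLattice)
    (f := (2⁻¹ : ℂ) • (g - f)) (g := (-(2⁻¹ * I) : ℂ) • (g + f))
    (by rw [← hsum, ← h, dirDeriv_const]) (by rw [← hsum, ← h, dirDeriv_const])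
  refine constTorus2_injective (h.trans ?_)
  rw [hsum, hzero, map_zero]

theorem exists_eq_const_add_del_of_delBar_eq_del {f g : SmoothTorus2} (hfg : delBar f = del g) :
    ∃ l m h, f = constTorus2 l + del h ∧ g = constTorus2 m + delBar h := by
  have hclosed : dirDeriv I (f + g) = dirDeriv 1 (I • (f - g)) := by
    simp only [del_apply, delBar_apply] at hfg
    simp only [map_add, map_sub, map_smul]
    linear_combination (norm := module) (-2 * I : ℂ) • hfg + I_mul_I • (dirDeriv I f + dirDeriv I g)
  obtain ⟨h, a, b, ⟨hax, hay⟩, ⟨hbx, hby⟩, hsum, hdiff⟩ := exists_potential (commute_dirDeriv 1 I)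
    (isCompl_range_ker_dirDeriv one_mem_intLattice) (isCompl_range_ker_dirDeriv I_mem_intLattice)
    hclosed
  obtain ⟨l, rfl⟩ := exists_const_of_dirDeriv_eq_zero hax hay
  obtain ⟨m, rfl⟩ := exists_const_of_dirDeriv_eq_zero hbx hby
  refine ⟨(2⁻¹ : ℂ) • (l - I • m), (2⁻¹ : ℂ) • (l + I • m), h, ?_, ?_⟩ <;>
    simp only [del_apply, delBar_apply, map_add, map_sub, map_smul]
  · linear_combination (norm := module) (2⁻¹ : ℂ) • hsum - (2⁻¹ * I : ℂ) • hdiff +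
      I_mul_I • ((2⁻¹ : ℂ) • (f - g))
  · linear_combination (norm := module) (2⁻¹ : ℂ) • hsum + (2⁻¹ * I : ℂ) • hdiff -
      I_mul_I • ((2⁻¹ : ℂ) • (f - g))

theorem mem_spaceV_iff {p : SmoothTorus2 × SmoothTorus2 × SmoothTorus2} :
    p ∈ spaceV ↔ delBar p.1 = del p.2.1 ∧ delBar p.2.1 = del p.2.2 := by
  constructor
  · intro hp
    constructor <;> refine smoothTorus2_ext fun z => ?_ <;> rw [periodic_delBar, periodic_del]
    exacts [sub_eq_zero.1 (hp z).1, sub_eq_zero.1 (hp z).2]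
  · intro hp z
    simp only [← periodic_delBar, ← periodic_del, hp.1, hp.2, sub_self, and_self]

theorem exists_eq_const_add_delBar_sub_del_pair (p q : SmoothTorus2) :
    ∃ l m b c e, p = constTorus2 l + (delBar b - del c) ∧
      q = constTorus2 m + (delBar c - del e) := by
  have hx := isCompl_range_ker_dirDeriv one_mem_intLattice
  have hy := isCompl_range_ker_dirDeriv I_mem_intLattice
  obtain ⟨r, s, k, hs, hky, hkx, hsum⟩ :=
    exists_eq_apply_add_apply_add (commute_dirDeriv I 1) hy hx (p + q)
  obtain ⟨u, t, j, ht, hjx, hjy, hdiff⟩ :=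
    exists_eq_apply_add_apply_add (commute_dirDeriv 1 I) hx hy (p - q)
  obtain ⟨k, rfl⟩ := exists_const_of_dirDeriv_eq_zero hkx hky
  obtain ⟨j, rfl⟩ := exists_const_of_dirDeriv_eq_zero hjx hjy
  -- For `b = B + T` and `e = B - T` the sum and the difference of the two right-hand sides are
  -- `i ∂y (B + c) + ∂x T` and `∂x (B - c) + i ∂y T`. One `T = s - i t` serves both, since
  -- `∂y s = 0` and `∂x t = 0`.
  refine ⟨(2⁻¹ : ℂ) • (k + j), (2⁻¹ : ℂ) • (k - j), (2⁻¹ : ℂ) • (u - I • r) + (s - I • t),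
    (-2⁻¹ : ℂ) • (u + I • r), (2⁻¹ : ℂ) • (u - I • r) - (s - I • t), ?_, ?_⟩ <;>
    simp only [del_apply, delBar_apply, map_add, map_sub, map_smul]
  · linear_combination (norm := module) (2⁻¹ : ℂ) • (hsum + hdiff) + (2⁻¹ * I : ℂ) • (ht - hs) +
      I_mul_I • ((2⁻¹ : ℂ) • (dirDeriv I r + dirDeriv I t))
  · linear_combination (norm := module) (2⁻¹ : ℂ) • (hsum - hdiff) + (2⁻¹ * I : ℂ) • (ht + hs) +
      I_mul_I • ((2⁻¹ : ℂ) • (dirDeriv I r - dirDeriv I t))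

/-! ### Forms on a uniformized manifold -/

section Pullback

variable {E E' W : Type*} [NormedAddCommGroup E] [NormedSpace ℝ E] [NormedAddCommGroup E']
  [NormedSpace ℝ E'] [NormedAddCommGroup W] [NormedSpace ℝ W] {k : ℕ}

theorem continuous_alternatization : Continuous (ContinuousMultilinearMap.alternatization :
    ContinuousMultilinearMap ℝ (fun _ : Fin k => E) W →+ E [⋀^Fin k]→L[ℝ] W) := by
  refine ContinuousAlternatingMap.isEmbedding_toContinuousMultilinearMap.continuous_iff.2 ?_
  change Continuous fun f : ContinuousMultilinearMap ℝ (fun _ : Fin k => E) W =>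
    ∑ σ : Equiv.Perm (Fin k), Equiv.Perm.sign σ • f.domDomCongr σ
  exact continuous_finsetSum _ fun σ _ =>
    (ContinuousMultilinearMap.domDomCongrₗᵢ ℝ E W σ).continuous.const_smul _

theorem alternatization_toContinuousMultilinearMap (f : E [⋀^Fin k]→L[ℝ] W) :
    ContinuousMultilinearMap.alternatization f.toContinuousMultilinearMap =
      (k.factorial : ℝ) • f := by
  refine ContinuousAlternatingMap.toAlternatingMap_injective ?_
  rw [ContinuousMultilinearMap.alternatization_apply_toAlternatingMap]
  have h := f.toAlternatingMap.coe_alternatization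
  rw [Fintype.card_fin, ← Nat.cast_smul_eq_nsmul ℝ] at h
  exact h

/- Smoothness of `compContinuousLinearMap` is available for multilinear maps only; alternatization
is a continuous left inverse, up to `k!`, of the inclusion of alternating maps into these. -/
theorem contDiff_compContinuousLinearMap {n : ℕ∞ω} :
    ContDiff ℝ n fun p : (E [⋀^Fin k]→L[ℝ] W) × (E' →L[ℝ] E) =>
      p.1.compContinuousLinearMap p.2 := by
  have hforget : ContDiff ℝ n fun p : (E [⋀^Fin k]→L[ℝ] W) × (E' →L[ℝ] E) =>
      p.1.toContinuousMultilinearMap :=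
    (ContinuousAlternatingMap.toContinuousMultilinearMapCLM
      (𝕜 := ℝ) (E := E) (F := W) (ι := Fin k) ℝ).contDiff.comp contDiff_fst
  have hmulti : ContDiff ℝ n fun p : (E [⋀^Fin k]→L[ℝ] W) × (E' →L[ℝ] E) =>
      p.1.toContinuousMultilinearMap.compContinuousLinearMap fun _ => p.2 :=
    ((ContinuousMultilinearMap.compContinuousLinearMapContinuousMultilinear ℝ
      (fun _ : Fin k => E') (fun _ => E) W).contDiff.comp
        (contDiff_pi.2 fun _ => contDiff_snd)).clm_apply hforget
  convert ((ContinuousMultilinearMap.alternatization.toRealLinearMap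
    continuous_alternatization).contDiff.comp hmulti).const_smul
      ((k.factorial : ℝ)⁻¹) using 2 with p
  change _ = (k.factorial : ℝ)⁻¹ • ContinuousMultilinearMap.alternatization
    (p.1.compContinuousLinearMap p.2).toContinuousMultilinearMap
  rw [alternatization_toContinuousMultilinearMap, inv_smul_smul₀ (by positivity)]

end Pullback

section Uniformization

variable {E : Type*} [NormedAddCommGroup E] [NormedSpace ℝ E]
  {Q : Type*} [TopologicalSpace Q] [ChartedSpace E Q]
  {W : Type*} [NormedAddCommGroup W] [NormedSpace ℝ W] {k : ℕ} {π : E → Q}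

namespace RoughForm

/-- The pullback of a form along `π : E → Q`, with the tangent spaces of `E` identified with `E`. -/
noncomputable def lift (π : E → Q) (α : RoughForm E Q W k) : E → E [⋀^Fin k]→L[ℝ] W :=
  fun x => pullback (E' := E) (N := E) π α x

theorem lift_congr_of_eventuallyEq {π' : E → Q} {x : E} (h : π =ᶠ[𝓝 x] π')
    (α : RoughForm E Q W k) : lift π α x = lift π' α x := by
  have hα : ∀ {p q : Q}, p = q → (α p : E [⋀^Fin k]→L[ℝ] W) = α q := by rintro p _ rfl; rfl
  exact congrArg₂ (fun (a : E [⋀^Fin k]→L[ℝ] W) (L : E →L[ℝ] E) => a.compContinuousLinearMap L)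
    (hα h.self_of_nhds) h.mfderiv_eq

theorem lift_comp {g : E → E} {x : E} (hπ : MDifferentiableAt 𝓘(ℝ, E) 𝓘(ℝ, E) π (g x))
    (hg : DifferentiableAt ℝ g x) (α : RoughForm E Q W k) :
    lift (π ∘ g) α x = (lift π α (g x)).compContinuousLinearMap (fderiv ℝ g x) := by
  have hcomp := mfderiv_comp x hπ hg.mdifferentiableAt
  rw [mfderiv_eq_fderiv] at hcomp
  exact congrArg (fun L : E →L[ℝ] E =>
    (α (π (g x)) : E [⋀^Fin k]→L[ℝ] W).compContinuousLinearMap L) hcomp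

/-- The form on `Q` whose value at `q` is that of `η` at the coordinates of `q` in the preferred
chart at `q`; for `η` invariant under the deck transformations of `π`, it is the inverse of
`lift π`. -/
noncomputable def descend (η : E → E [⋀^Fin k]→L[ℝ] W) : RoughForm E Q W k :=
  fun q => (η (chartAt E q q)).compContinuousLinearMap
    (mfderiv 𝓘(ℝ, E) 𝓘(ℝ, E) (chartAt E q) q)

end RoughForm

namespace IsUniformization

open RoughForm

variable (h : IsUniformization ℝ π)
include h

theorem mdifferentiableAt (x : E) : MDifferentiableAt 𝓘(ℝ, E) 𝓘(ℝ, E) π x :=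
  (h.contMDiff x).mdifferentiableAt (by simp)

theorem exists_mfderiv_eq {ι : Type*} (x : E) (u : ι → E) :
    ∃ v : ι → E, (fun i => (mfderiv 𝓘(ℝ, E) 𝓘(ℝ, E) π x : E →L[ℝ] E) (v i)) = u := by
  choose v hv using fun i => h.surjective_mfderiv x (u i)
  exact ⟨v, funext hv⟩

theorem lift_injective : Function.Injective (lift (W := W) (k := k) π) := by
  intro α β hαβ
  funext q
  obtain ⟨x, rfl⟩ := h.surjective q
  refine ContinuousAlternatingMap.ext fun u => ?_
  obtain ⟨v, rfl⟩ := h.exists_mfderiv_eq x u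
  exact DFunLike.congr_fun (congrFun hαβ x) v

theorem lift_compContinuousLinearMap {g : E → E} {x : E} (hg : DifferentiableAt ℝ g x)
    (hπg : π ∘ g = π) (α : RoughForm E Q W k) :
    (lift π α (g x)).compContinuousLinearMap (fderiv ℝ g x) = lift π α x := by
  rw [← lift_comp (h.mdifferentiableAt _) hg, hπg]

theorem inChart_eventuallyEq_lift {e : OpenPartialHomeomorph Q E} (he : e ∈ atlas E Q)
    (α : RoughForm E Q W k) {y : E} (hy : y ∈ e.target) : inChart e α =ᶠ[𝓝 y] lift π α := by
  filter_upwards [e.open_target.mem_nhds hy] with z hz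
  refine lift_congr_of_eventuallyEq (π := e.symm) ?_ α
  filter_upwards [e.open_target.mem_nhds hz] with z' hz'
  exact h.chart_symm e he z' hz'

theorem map_chartAt (q : Q) : π (chartAt E q q) = q :=
  (h.eventually_chart q).self_of_nhds

theorem chartAt_comp_eventuallyEq {g : E → E} (hg : Continuous g) (hπg : π ∘ g = π) {x : E}
    (hgx : g x = chartAt E (π x) (π x)) : chartAt E (π x) ∘ π =ᶠ[𝓝 x] g := by
  have hmem : g x ∈ (chartAt E (π x)).target := hgx ▸ mem_chart_target E (π x)
  filter_upwards [hg.continuousAt.eventually_mem ((chartAt E (π x)).open_target.mem_nhds hmem)]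
    with y hy
  rw [Function.comp_apply, ← congrFun hπg y, Function.comp_apply,
    ← h.chart_symm _ (chart_mem_atlas _ _) _ hy, (chartAt E (π x)).right_inv hy]

theorem mfderiv_chartAt_comp_mfderiv {g : E → E} (hg : Continuous g) (hπg : π ∘ g = π) {x : E}
    (hgx : g x = chartAt E (π x) (π x)) :
    (mfderiv 𝓘(ℝ, E) 𝓘(ℝ, E) (chartAt E (π x)) (π x)).comp (mfderiv 𝓘(ℝ, E) 𝓘(ℝ, E) π x) =
      fderiv ℝ g x := by
  have := h.isManifold
  have hchart : MDifferentiableAt 𝓘(ℝ, E) 𝓘(ℝ, E) (chartAt E (π x)) (π x) :=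
    ((contMDiffOn_chart (I := 𝓘(ℝ, E)) (n := ω) (x := π x)).contMDiffAt
      ((chartAt E (π x)).open_source.mem_nhds (mem_chart_source E _))).mdifferentiableAt (by simp)
  rw [← mfderiv_comp x hchart (h.mdifferentiableAt x),
    (h.chartAt_comp_eventuallyEq hg hπg hgx).mfderiv_eq, mfderiv_eq_fderiv]

theorem contDiff_lift_iff {α : RoughForm E Q W k} : ContDiff ℝ ∞ (lift π α) ↔ α.IsSmooth := by
  refine ⟨fun hα e he y hy =>
    (hα.contDiffAt.congr_of_eventuallyEq
      (h.inChart_eventuallyEq_lift he α hy)).contDiffWithinAt, fun hα => ?_⟩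
  refine contDiff_iff_contDiffAt.2 fun x => ?_
  obtain ⟨g, hg, hgx, hπg⟩ := h.deck x _ (h.map_chartAt (π x)).symm
  have hmem : g x ∈ (chartAt E (π x)).target := hgx ▸ mem_chart_target E (π x)
  have hlift : ContDiffAt ℝ ∞ (lift π α) (g x) :=
    ((hα _ (chart_mem_atlas E (π x))).contDiffAt
      ((chartAt E (π x)).open_target.mem_nhds hmem)).congr_of_eventuallyEq
      (h.inChart_eventuallyEq_lift (chart_mem_atlas _ _) α hmem).symm
  have hpullback : ContDiffAt ℝ ∞
      (fun y => (lift π α (g y)).compContinuousLinearMap (fderiv ℝ g y)) x :=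
    contDiff_compContinuousLinearMap.contDiffAt.comp x
      ((hlift.comp x (hg.of_le le_top).contDiffAt).prodMk (hg.contDiffAt.fderiv_right le_top))
  exact hpullback.congr_of_eventuallyEq (Filter.Eventually.of_forall fun y =>
    (h.lift_compContinuousLinearMap (hg.differentiable (by simp) y) (funext hπg) α).symm)

theorem lift_d {α : RoughForm E Q W k} (hα : α.IsSmooth) :
    lift π (d α) = extDeriv (lift π α) := by
  funext x
  obtain ⟨g, hg, hgx, hπg⟩ := h.deck x _ (h.map_chartAt (π x)).symm
  have hpullback : extDeriv (lift π α) x =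
      (extDeriv (lift π α) (g x)).compContinuousLinearMap (fderiv ℝ g x) := by
    rw [← extDeriv_pullback (r := ∞) ((h.contDiff_lift_iff.2 hα).differentiable (by simp) (g x))
      (hg.of_le le_top).contDiffAt (by
        rw [minSmoothness_of_isRCLikeNormedField]; exact WithTop.coe_le_coe.2 le_top)]
    congr 1
    exact funext fun y =>
      (h.lift_compContinuousLinearMap (hg.differentiable (by simp) y) (funext hπg) α).symm
  have hchart : extDeriv (inChart (chartAt E (π x)) α) (g x) = extDeriv (lift π α) (g x) :=
    (h.inChart_eventuallyEq_lift (chart_mem_atlas _ _) α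
      (hgx ▸ mem_chart_target E (π x))).extDeriv_eq
  rw [hpullback, ← h.mfderiv_chartAt_comp_mfderiv hg.continuous (funext hπg) hgx, ← hchart, hgx]
  rfl

theorem lift_descend {η : E → E [⋀^Fin k]→L[ℝ] W}
    (hη : ∀ x y, π x = π y → ∃ g : E → E, Continuous g ∧ π ∘ g = π ∧ g x = y ∧
      (η y).compContinuousLinearMap (fderiv ℝ g x) = η x) :
    lift π (descend η) = η := by
  funext x
  obtain ⟨g, hg, hπg, hgx, hinv⟩ := hη x _ (h.map_chartAt (π x)).symm
  rw [← hinv, ← h.mfderiv_chartAt_comp_mfderiv hg hπg hgx]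
  rfl

theorem isHorizontal_iff {E' : Type*} [NormedAddCommGroup E'] [NormedSpace ℝ E']
    {T : Type*} [TopologicalSpace T] [ChartedSpace E' T] {F : Foliation E Q E' T} {K : Set E}
    (hK : ∀ x u, F.IsTangent (π x) (mfderiv 𝓘(ℝ, E) 𝓘(ℝ, E) π x u) ↔ u ∈ K)
    (α : RoughForm E Q W k) :
    F.IsHorizontal α ↔ ∀ x (u : Fin k → E), (∃ j, u j ∈ K) → lift π α x u = 0 := by
  refine ⟨fun hα x u ⟨j, hj⟩ => hα (π x) _ ⟨j, (hK x (u j)).2 hj⟩, ?_⟩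
  rintro hα q u ⟨j, hj⟩
  obtain ⟨x, rfl⟩ := h.surjective q
  obtain ⟨v, rfl⟩ := h.exists_mfderiv_eq x u
  exact hα x v ⟨j, (hK x (v j)).1 hj⟩

theorem mfderiv_injective [FiniteDimensional ℝ E] (x : E) :
    Function.Injective (mfderiv 𝓘(ℝ, E) 𝓘(ℝ, E) π x : E →L[ℝ] E) := by
  let T : E →L[ℝ] E := mfderiv 𝓘(ℝ, E) 𝓘(ℝ, E) π x
  exact (LinearMap.injective_iff_surjective (f := (T : E →ₗ[ℝ] E))).2 (h.surjective_mfderiv x)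

theorem mfderiv_apply_mfderiv_eq_zero_iff {E' : Type*} [NormedAddCommGroup E'] [NormedSpace ℝ E']
    [FiniteDimensional ℝ E'] {T : Type*} [TopologicalSpace T] [ChartedSpace E' T] {ρ : E' → T}
    (hρ : IsUniformization ℝ ρ) {f : Q → T} {x : E} {S : E →L[ℝ] E'}
    (hf : MDifferentiableAt 𝓘(ℝ, E) 𝓘(ℝ, E') f (π x)) (hfS : f ∘ π =ᶠ[𝓝 x] ρ ∘ S) (u : E) :
    mfderiv 𝓘(ℝ, E) 𝓘(ℝ, E') f (π x) (mfderiv 𝓘(ℝ, E) 𝓘(ℝ, E) π x u) = 0 ↔ S u = 0 := by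
  have hcomp : (mfderiv 𝓘(ℝ, E) 𝓘(ℝ, E') f (π x)).comp (mfderiv 𝓘(ℝ, E) 𝓘(ℝ, E) π x) =
      (mfderiv 𝓘(ℝ, E') 𝓘(ℝ, E') ρ (S x) : E' →L[ℝ] E').comp S := by
    rw [← mfderiv_comp x hf (h.mdifferentiableAt x), hfS.mfderiv_eq,
      mfderiv_comp (I' := 𝓘(ℝ, E')) x (hρ.mdifferentiableAt _)
        S.differentiableAt.mdifferentiableAt, mfderiv_eq_fderiv, S.fderiv]
    rfl
  have happly : mfderiv 𝓘(ℝ, E) 𝓘(ℝ, E') f (π x) (mfderiv 𝓘(ℝ, E) 𝓘(ℝ, E) π x u) =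
      (mfderiv 𝓘(ℝ, E') 𝓘(ℝ, E') ρ (S x) : E' →L[ℝ] E') (S u) := DFunLike.congr_fun hcomp u
  rw [happly]
  exact (hρ.mfderiv_injective (S x)).eq_iff' (map_zero _)

end IsUniformization

end Uniformization

/-! ### Forms on the suspension -/

namespace Suspension

/-- The covering space `ℂ² × ℝ` of the suspension. -/
abbrev Cov : Type := (ℂ × ℂ) × ℝ

/-- The linear part `((w, z), s) ↦ ((w + n z, z), s)` of the deck transformations of `proj`. -/
noncomputable def shearCLM (n : ℤ) : Cov →L[ℝ] Cov :=
  ((.fst ℝ ℂ ℂ + (n : ℝ) • .snd ℝ ℂ ℂ : ℂ × ℂ →L[ℝ] ℂ).prod (.snd ℝ ℂ ℂ)).prodMap (.id ℝ ℝ)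

theorem shearCLM_apply (n : ℤ) (u : Cov) : shearCLM n u = ((u.1.1 + n * u.1.2, u.1.2), u.2) := by
  simp [shearCLM, Prod.map]

/-- The deck transformations of `proj`. -/
noncomputable def deck (n : ℤ) (l : ℂ × ℂ) (x : Cov) : Cov := shearCLM n x + (l, (n : ℝ))

theorem deck_apply (n : ℤ) (l : ℂ × ℂ) (x : Cov) :
    deck n l x = ((x.1.1 + n * x.1.2 + l.1, x.1.2 + l.2), x.2 + n) := by
  rw [deck, shearCLM_apply]; rfl

theorem hasFDerivAt_deck (n : ℤ) (l : ℂ × ℂ) (x : Cov) :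
    HasFDerivAt (deck n l) (shearCLM n) x :=
  (shearCLM n).hasFDerivAt.add_const _

theorem proj_comp_deck (n : ℤ) {l : ℂ × ℂ} (hl : l ∈ intLattice.prod intLattice) :
    proj ∘ deck n l = proj := by
  refine funext fun x => (mk_eq_iff.2 ⟨n, ?_, by rw [deck_apply]⟩).symm
  rw [torusShear_zpow_mk, deck_apply]
  exact (QuotientAddGroup.mk_add_of_mem _ hl).symm

theorem exists_deck_eq {x y : Cov} (h : proj x = proj y) :
    ∃ n : ℤ, ∃ l ∈ intLattice.prod intLattice, deck n l x = y := by
  obtain ⟨n, hshear, hadd⟩ := mk_eq_iff.1 h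
  rw [torusShear_zpow_mk] at hshear
  refine ⟨n, _, QuotientAddGroup.eq.1 hshear, ?_⟩
  rw [deck_apply]
  exact Prod.ext (add_neg_cancel_left (x.1.1 + n * x.1.2, x.1.2) y.1) hadd

variable {k : ℕ}

/-- The forms on the covering that are invariant under the deck transformations. -/
def IsDeckInvariant (η : Cov → Cov [⋀^Fin k]→L[ℝ] ℂ) : Prop :=
  ∀ (n : ℤ), ∀ l ∈ intLattice.prod intLattice, ∀ x,
    (η (deck n l x)).compContinuousLinearMap (shearCLM n) = η x

open RoughForm

theorem isDeckInvariant_lift (α : RoughForm Cov Suspension ℂ k) :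
    IsDeckInvariant (lift proj α) := fun n l hl x => by
  rw [← (hasFDerivAt_deck n l x).fderiv]
  exact uniformization_proj.lift_compContinuousLinearMap
    (hasFDerivAt_deck n l x).differentiableAt (proj_comp_deck n hl) α

theorem lift_descend {η : Cov → Cov [⋀^Fin k]→L[ℝ] ℂ} (hη : IsDeckInvariant η) :
    lift proj (descend η) = η :=
  uniformization_proj.lift_descend fun x y hxy => by
    obtain ⟨n, l, hl, rfl⟩ := exists_deck_eq hxy
    refine ⟨deck n l, (shearCLM n).continuous.add continuous_const, proj_comp_deck n hl, rfl, ?_⟩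
    rw [(hasFDerivAt_deck n l x).fderiv]
    exact hη n l hl x

theorem transverseProj_comp_proj_eventuallyEq {a : ℝ} {x : Cov} (hx : proj x ∈ chartDomain a) :
    ∃ n : ℤ, transverseProj a ∘ proj =ᶠ[𝓝 x] (QuotientAddGroup.mk : ℂ × ℂ → Torus4) ∘
      (ContinuousLinearMap.fst ℝ (ℂ × ℂ) ℝ).comp (shearCLM n) := by
  obtain ⟨⟨p, s⟩, ⟨-, hs⟩, hx⟩ := hx
  obtain ⟨n, -, rfl⟩ := mk_eq_iff.1 hx.symm
  refine ⟨n, ?_⟩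
  have hmem : ∀ᶠ y : Cov in 𝓝 x, y.2 + n ∈ Ioo a (a + 1 / 2) :=
    ContinuousAt.eventually_mem (by fun_prop) (isOpen_Ioo.mem_nhds hs)
  filter_upwards [hmem] with y hy
  have hfloor : -⌊y.2 - a⌋ = n := by
    rw [neg_eq_iff_eq_neg, Int.floor_eq_iff]
    constructor <;> push_cast <;> linarith [hy.1, hy.2]
  change (torusShear ^ (-⌊y.2 - a⌋)) (y.1 : Torus4) = ((shearCLM n y).1 : Torus4)
  rw [hfloor, torusShear_zpow_mk, shearCLM_apply]

theorem fst_shearCLM_eq_zero_iff (n : ℤ) (u : Cov) : (shearCLM n u).1 = 0 ↔ u.1 = 0 := by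
  rw [shearCLM_apply, Prod.ext_iff, Prod.ext_iff]
  exact ⟨fun ⟨hw, hz⟩ => ⟨by simpa [show u.1.2 = 0 from hz] using hw, hz⟩,
    fun ⟨hw, hz⟩ => ⟨by simp_all, hz⟩⟩

theorem mfderiv_transverseProj_eq_zero_iff {a : ℝ} {x : Cov} (hx : proj x ∈ chartDomain a)
    (u : Cov) : mfderiv 𝓘(ℝ, Cov) 𝓘(ℝ, ℂ × ℂ) (transverseProj a) (proj x)
      (mfderiv 𝓘(ℝ, Cov) 𝓘(ℝ, Cov) proj x u) = 0 ↔ u.1 = 0 := by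
  obtain ⟨n, hev⟩ := transverseProj_comp_proj_eventuallyEq hx
  have hopen : IsOpen (chartDomain a) := isOpenMap_mk _ (isOpen_univ.prod isOpen_Ioo)
  have hdiff := ((contMDiffOn_transverseProj a).contMDiffAt
    (hopen.mem_nhds hx)).mdifferentiableAt (by simp)
  exact (uniformization_proj.mfderiv_apply_mfderiv_eq_zero_iff (uniformization_torus4 ℝ)
    hdiff hev u).trans (fst_shearCLM_eq_zero_iff n u)

theorem isTangent_iff (x u : Cov) :
    foliation.IsTangent (proj x) (mfderiv 𝓘(ℝ, Cov) 𝓘(ℝ, Cov) proj x u) ↔ u.1 = 0 := by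
  refine ⟨fun ⟨a, ha, h⟩ => (mfderiv_transverseProj_eq_zero_iff ha u).1 h, fun h => ?_⟩
  have hmem : proj x ∈ chartDomain (x.2 - 1 / 4) :=
    ⟨_, ⟨trivial, by constructor <;> simp only <;> linarith⟩, rfl⟩
  exact ⟨_, hmem, (mfderiv_transverseProj_eq_zero_iff hmem u).2 h⟩

/-- The alternating forms on `ℂ² × ℝ` that vanish on the direction of the leaves. -/
def horizontalCovectors (k : ℕ) : Submodule ℂ (Cov [⋀^Fin k]→L[ℝ] ℂ) where
  carrier := {θ | ∀ u : Fin k → Cov, (∃ j, (u j).1 = 0) → θ u = 0}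
  add_mem' hθ hψ u hu := by
    rw [ContinuousAlternatingMap.add_apply, hθ u hu, hψ u hu, add_zero]
  zero_mem' _ _ := rfl
  smul_mem' c θ hθ u hu := by
    rw [ContinuousAlternatingMap.smul_apply, hθ u hu, smul_zero]

theorem mem_basicForms_iff {α : RoughForm Cov Suspension ℂ k} : α ∈ foliation.basicForms ℂ k ↔
    ContDiff ℝ ∞ (lift proj α) ∧ (∀ x, lift proj α x ∈ horizontalCovectors k) ∧
      ∀ x, extDeriv (lift proj α) x ∈ horizontalCovectors (k + 1) := by
  have hhor : ∀ {m : ℕ} (β : RoughForm Cov Suspension ℂ m), foliation.IsHorizontal β ↔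
      ∀ x, lift proj β x ∈ horizontalCovectors m := fun β =>
    uniformization_proj.isHorizontal_iff (K := {u | u.1 = 0}) isTangent_iff β
  rw [uniformization_proj.contDiff_lift_iff]
  refine and_congr_right fun hα => ?_
  rw [← uniformization_proj.lift_d hα, hhor, hhor]

end Suspension

/-! ### The coefficients of basic forms -/

section Coefficients

open Filter Polynomial

theorem eval_eq_eval_of_norm_eval_natCast_le {p : ℂ[X]} {C : ℝ}
    (h : ∀ n : ℕ, ‖p.eval (n : ℂ)‖ ≤ C) (a b : ℂ) : p.eval a = p.eval b := by
  rcases le_or_gt p.degree 0 with hp | hp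
  · rw [eq_C_of_degree_le_zero hp, eval_C, eval_C]
  · have hunbounded := p.tendsto_norm_atTop hp (l := atTop) (z := fun n : ℕ => (n : ℂ))
      (by simpa using tendsto_natCast_atTop_atTop)
    obtain ⟨n, hn⟩ := (hunbounded.eventually_gt_atTop C).exists
    exact absurd (h n) hn.not_ge

theorem exists_polynomial_apply_add_smul {ι E : Type*} [Finite ι] [AddCommGroup E] [Module ℝ E]
    (θ : MultilinearMap ℝ (fun _ : ι => E) ℂ) (u v : ι → E) :
    ∃ p : ℂ[X], ∀ t : ℝ, θ (u + t • v) = p.eval (t : ℂ) := by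
  classical
  have := Fintype.ofFinite ι
  refine ⟨∑ s : Finset ι, C (θ (s.piecewise v u)) * X ^ s.card, fun t => ?_⟩
  rw [add_comm, θ.map_add_univ, eval_finsetSum]
  refine Finset.sum_congr rfl fun s _ => ?_
  have hsmul : s.piecewise (t • v) u =
      s.piecewise (fun i => t • s.piecewise v u i) (s.piecewise v u) := by
    funext i
    by_cases hi : i ∈ s <;> simp [hi]
  rw [hsmul, θ.map_piecewise_smul (fun _ => t), Finset.prod_const, eval_mul, eval_C, eval_pow,
    eval_X, Complex.real_smul, Complex.ofReal_pow, mul_comm]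

theorem exists_mem_intLattice_norm_sub_le (z : ℂ) : ∃ l ∈ intLattice, ‖l - z‖ ≤ 2 := by
  refine ⟨_, ⟨⌊z.re⌋, ⌊z.im⌋, rfl⟩, (Complex.norm_le_abs_re_add_abs_im _).trans ?_⟩
  have hre : |⌊z.re⌋ - z.re| < 1 := by
    rw [abs_sub_comm, Int.self_sub_floor, Int.abs_fract]; exact Int.fract_lt_one _
  have him : |⌊z.im⌋ - z.im| < 1 := by
    rw [abs_sub_comm, Int.self_sub_floor, Int.abs_fract]; exact Int.fract_lt_one _
  simpa using (add_lt_add hre him).le.trans_eq one_add_one_eq_two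

theorem exists_tendsto_mul_sub_mem_intLattice (a z : ℂ) : ∃ ζ : ℕ → ℂ,
    Tendsto ζ atTop (𝓝 z) ∧ ∀ n : ℕ, (n + 1 : ℕ) * ζ n - a ∈ intLattice := by
  choose r hr hrz using exists_mem_intLattice_norm_sub_le
  have hne : ∀ n : ℕ, ((n + 1 : ℕ) : ℂ) ≠ 0 := fun n => Nat.cast_ne_zero.2 n.succ_ne_zero
  refine ⟨fun n => (a + r ((n + 1 : ℕ) * z - a)) / (n + 1 : ℕ), ?_, fun n => ?_⟩
  · refine tendsto_iff_norm_sub_tendsto_zero.2 (squeeze_zero (fun _ => norm_nonneg _) (fun n => ?_)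
      ((tendsto_const_div_atTop_nhds_zero_nat 2).comp (tendsto_add_atTop_nat 1)))
    have hdiff : (a + r ((n + 1 : ℕ) * z - a)) / (n + 1 : ℕ) - z =
        (r ((n + 1 : ℕ) * z - a) - ((n + 1 : ℕ) * z - a)) / (n + 1 : ℕ) := by
      field_simp [hne n]
      ring
    rw [hdiff, norm_div, Complex.norm_natCast]
    exact div_le_div_of_nonneg_right (hrz _) (Nat.cast_nonneg _)
  · rw [mul_div_cancel₀ _ (hne n), add_sub_cancel_left]
    exact hr _

theorem eq_of_comp_shear_eq {X : Type*} [TopologicalSpace X] [T2Space X] {f : ℂ × ℂ → X}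
    (hf : Continuous f)
    (h : ∀ n : ℕ, ∀ l ∈ intLattice, ∀ w z, f (w + n * z + l, z) = f (w, z)) (w w' z : ℂ) :
    f (w, z) = f (w', z) := by
  obtain ⟨ζ, hζ, hlattice⟩ := exists_tendsto_mul_sub_mem_intLattice (w' - w) z
  have hlim : ∀ a, Tendsto (fun n => f (a, ζ n)) atTop (𝓝 (f (a, z))) := fun a =>
    (hf.tendsto _).comp (tendsto_const_nhds.prodMk_nhds hζ)
  have hfiber : ∀ n, f (w', ζ n) = f (w, ζ n) := fun n => by
    rw [← h (n + 1) 0 intLattice.zero_mem w (ζ n), ← h 0 _ (hlattice n) w' (ζ n)]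
    congr 2
    push_cast
    ring
  exact tendsto_nhds_unique (hlim w) ((hlim w').congr hfiber)

end Coefficients

namespace Suspension

open RoughForm

variable {k : ℕ} {α : RoughForm Cov Suspension ℂ k}

theorem contDiff_lift_apply (hα : α ∈ foliation.basicForms ℂ k) (u : Fin k → Cov) :
    ContDiff ℝ ∞ fun x => lift proj α x u :=
  (ContinuousAlternatingMap.apply ℝ Cov ℂ u).contDiff.comp (mem_basicForms_iff.1 hα).1

theorem fderiv_lift_apply_leaf (hα : α ∈ foliation.basicForms ℂ k) (x : Cov) (u : Fin k → Cov) :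
    fderiv ℝ (fun y => lift proj α y u) x (0, 1) = 0 := by
  obtain ⟨hsmooth, hhor, hdhor⟩ := mem_basicForms_iff.1 hα
  have hd := hdhor x (Fin.cons (0, 1) u : Fin (k + 1) → Cov) ⟨0, rfl⟩
  have hrest : ∀ i : Fin k,
      (fun y => lift proj α y (i.succ.removeNth (Fin.cons (0, 1) u : Fin (k + 1) → Cov))) =
        fun _ => 0 := fun i => funext fun y => by
    cases k with
    | zero => exact i.elim0
    | succ k => exact hhor y _ ⟨0, rfl⟩
  rw [extDeriv_apply (hsmooth.differentiable (by simp) x), Fin.sum_univ_succ] at hd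
  simpa only [hrest, Fin.removeNth_zero, Fin.tail_cons, Fin.cons_zero, Fin.val_zero, pow_zero,
    one_smul, fderiv_fun_const, Pi.zero_apply, zero_apply, smul_zero, Finset.sum_const_zero,
    add_zero] using hd

theorem lift_apply_eq_of_fst_eq (hα : α ∈ foliation.basicForms ℂ k) (p : ℂ × ℂ) (s s' : ℝ)
    (u : Fin k → Cov) : lift proj α (p, s) u = lift proj α (p, s') u := by
  have hderiv : ∀ t : ℝ, HasDerivAt (fun t : ℝ => lift proj α (p, t) u) 0 t := fun t => by
    rw [← fderiv_lift_apply_leaf hα (p, t) u]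
    exact ((contDiff_lift_apply hα u).differentiable (by simp) _).hasFDerivAt.comp_hasDerivAt t
      ((hasDerivAt_const t p).prodMk (hasDerivAt_id t))
  exact is_const_of_deriv_eq_zero (fun t => (hderiv t).differentiableAt)
    (fun t => (hderiv t).deriv) s s'

theorem lift_deck_apply (α : RoughForm Cov Suspension ℂ k) (n : ℤ) {l : ℂ × ℂ}
    (hl : l ∈ intLattice.prod intLattice) (x : Cov) (u : Fin k → Cov) :
    lift proj α (deck n l x) (fun i => shearCLM n (u i)) = lift proj α x u :=
  DFunLike.congr_fun (isDeckInvariant_lift α n l hl x) u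

theorem exists_norm_lift_apply_le (hα : α ∈ foliation.basicForms ℂ k) (u : Fin k → Cov) :
    ∃ C, ∀ x, ‖lift proj α x u‖ ≤ C := by
  obtain ⟨C, hC⟩ := (((isCompact_closedBall (0 : ℂ) 2).prod (isCompact_closedBall 0 2)).prod
    (isCompact_singleton (x := (0 : ℝ)))).exists_bound_of_continuousOn
      (contDiff_lift_apply hα u).continuous.continuousOn
  refine ⟨C, fun x => ?_⟩
  obtain ⟨l, hl, hlx⟩ := exists_mem_intLattice_norm_sub_le (-x.1.1)
  obtain ⟨m, hm, hmx⟩ := exists_mem_intLattice_norm_sub_le (-x.1.2)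
  have hdeck := lift_deck_apply α 0 (l := (l, m)) ⟨hl, hm⟩ x u
  simp only [shearCLM_apply, Int.cast_zero, zero_mul, add_zero, deck_apply] at hdeck
  rw [← hdeck, lift_apply_eq_of_fst_eq hα _ _ 0]
  refine hC _ ⟨⟨?_, ?_⟩, rfl⟩
  · simpa [add_comm] using hlx
  · simpa [add_comm] using hmx

theorem lift_shearCLM_apply (hα : α ∈ foliation.basicForms ℂ k) (n : ℤ) (x : Cov)
    (u : Fin k → Cov) : lift proj α x (fun i => shearCLM n (u i)) = lift proj α x u := by
  obtain ⟨C, hC⟩ := exists_norm_lift_apply_le hα u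
  let v : Fin k → Cov := fun i => (((u i).1.2, 0), 0)
  obtain ⟨p, hp⟩ := exists_polynomial_apply_add_smul (lift proj α x).toMultilinearMap u v
  have hpoly : ∀ m : ℤ, lift proj α x (fun i => shearCLM m (u i)) = p.eval (m : ℂ) := fun m => by
    have hshear : (fun i => shearCLM m (u i)) = u + (m : ℝ) • v :=
      funext fun i => by rw [shearCLM_apply]; ext <;> simp [v]
    rw [hshear, ← Complex.ofReal_intCast]
    exact hp m
  have hbound : ∀ m : ℕ, ‖p.eval (m : ℂ)‖ ≤ C := fun m => by
    have hdeck := lift_deck_apply α (-m) (zero_mem _) x fun i => shearCLM m (u i)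
    have hcancel : ∀ i, shearCLM (-m : ℤ) (shearCLM m (u i)) = u i := fun i => by
      simp [shearCLM_apply]
    simp only [hcancel] at hdeck
    rw [← Int.cast_natCast, ← hpoly, ← hdeck]
    exact hC _
  rw [hpoly, eval_eq_eval_of_norm_eval_natCast_le hbound n 0, ← Int.cast_zero, ← hpoly]
  simp [shearCLM_apply]

theorem lift_deck (hα : α ∈ foliation.basicForms ℂ k) (n : ℤ) {l : ℂ × ℂ}
    (hl : l ∈ intLattice.prod intLattice) (x : Cov) :
    lift proj α (deck n l x) = lift proj α x :=
  ContinuousAlternatingMap.ext fun u => by rw [← lift_deck_apply α n hl x u, lift_shearCLM_apply hα]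

theorem lift_eq_lift_zero (hα : α ∈ foliation.basicForms ℂ k) (x : Cov) :
    lift proj α x = lift proj α ((0, x.1.2), 0) := by
  have hleaf : ∀ p s, lift proj α (p, s) = lift proj α (p, 0) := fun p s =>
    ContinuousAlternatingMap.ext fun u => lift_apply_eq_of_fst_eq hα p s 0 u
  rw [show lift proj α x = lift proj α (x.1, 0) from hleaf x.1 x.2]
  refine eq_of_comp_shear_eq (f := fun p => lift proj α (p, 0))
    ((mem_basicForms_iff.1 hα).1.continuous.comp (by fun_prop)) (fun n l hl w z => ?_) x.1.1 0 x.1.2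
  have hdeck := lift_deck hα n (l := (l, 0)) ⟨hl, zero_mem _⟩ ((w, z), 0)
  rwa [deck_apply, hleaf, Int.cast_natCast, add_zero] at hdeck

theorem lift_add_intLattice (hα : α ∈ foliation.basicForms ℂ k) {v : ℂ} (hv : v ∈ intLattice)
    (z : ℂ) : lift proj α ((0, z + v), 0) = lift proj α ((0, z), 0) := by
  have hdeck := lift_deck hα 0 (l := (0, v)) ⟨zero_mem _, hv⟩ ((0, z), 0)
  rw [deck_apply] at hdeck
  simpa using hdeck

end Suspension

/-! ### Invariant covectors -/

theorem alternatingMap_ext_of_strictMono {R M N ι : Type*} [CommSemiring R] [AddCommMonoid M]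
    [AddCommGroup N] [Module R M] [Module R N] [LinearOrder ι] {k : ℕ} (b : Module.Basis ι R M)
    {f g : M [⋀^Fin k]→ₗ[R] N} (h : ∀ v : Fin k → ι, StrictMono v → f (b ∘ v) = g (b ∘ v)) :
    f = g := by
  refine Module.Basis.ext_alternating b fun v hv => ?_
  have hsort := h (v ∘ Tuple.sort v)
    ((Tuple.monotone_sort v).strictMono_of_injective (hv.comp (Equiv.injective _)))
  rw [← Function.comp_assoc, f.map_perm, g.map_perm] at hsort
  exact smul_left_cancel _ hsort

section DetNeZero

variable {K V ι : Type*} [Field K] [AddCommGroup V] [Module K V] [Fintype ι] [DecidableEq ι]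
  {ev : V →ₗ[K] ι → K} {p : Submodule K V} {v : ι → p}

theorem linearIndependent_of_det_ne_zero (hv : (Matrix.of fun i => ev (v i)).det ≠ 0) :
    LinearIndependent K v :=
  (Matrix.linearIndependent_rows_of_det_ne_zero hv).of_comp (ev.domRestrict p)

theorem span_eq_top_of_det_ne_zero (hev : ∀ x ∈ p, ev x = 0 → x = 0)
    (hv : (Matrix.of fun i => ev (v i)).det ≠ 0) : Submodule.span K (Set.range v) = ⊤ := by
  have hinj : Function.Injective (ev.domRestrict p) :=
    (injective_iff_map_eq_zero _).2 fun x hx => Subtype.ext (hev x x.2 hx)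
  have : FiniteDimensional K p := FiniteDimensional.of_injective _ hinj
  have hli := linearIndependent_of_det_ne_zero hv
  exact hli.span_eq_top_of_card_eq_finrank' <| le_antisymm hli.fintype_card_le_finrank <|
    (LinearMap.finrank_le_finrank_of_injective hinj).trans_eq (Module.finrank_fintype_fun_eq_card K)

end DetNeZero

namespace Suspension

variable {k m : ℕ}

/-- The horizontal alternating forms on `ℂ² × ℝ` that are invariant under the powers of the shear,
i.e. the possible values of the pullback of a basic form. -/
def invariantCovectors (k : ℕ) : Submodule ℂ (Cov [⋀^Fin k]→L[ℝ] ℂ) where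
  carrier := {θ | θ ∈ horizontalCovectors k ∧
    ∀ (n : ℤ) (u : Fin k → Cov), θ (shearCLM n ∘ u) = θ u}
  add_mem' hθ hψ := ⟨add_mem hθ.1 hψ.1, fun n u => by
    rw [ContinuousAlternatingMap.add_apply, hθ.2, hψ.2, ContinuousAlternatingMap.add_apply]⟩
  zero_mem' := ⟨zero_mem _, fun _ _ => rfl⟩
  smul_mem' c θ hθ := ⟨Submodule.smul_mem _ c hθ.1, fun n u => by
    rw [ContinuousAlternatingMap.smul_apply, hθ.2, ContinuousAlternatingMap.smul_apply]⟩

/-- The vectors `∂/∂x₁, ∂/∂y₁, ∂/∂x₂, ∂/∂y₂`. -/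
noncomputable def coordVec : Fin 4 → Cov :=
  ![((1, 0), 0), ((I, 0), 0), ((0, 1), 0), ((0, I), 0)]

/-- The real basis of `ℂ² × ℝ` that starts with `coordVec`. -/
noncomputable def coordBasis : Module.Basis (Fin 5) ℝ Cov :=
  (((Complex.basisOneI.prod Complex.basisOneI).reindex finSumFinEquiv).prod
    (Module.Basis.singleton (Fin 1) ℝ)).reindex finSumFinEquiv

theorem coordBasis_castSucc (i : Fin 4) : coordBasis i.castSucc = coordVec i := by
  have hi : finSumFinEquiv.symm (i.castSucc : Fin (4 + 1)) = Sum.inl i :=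
    finSumFinEquiv_symm_apply_castAdd i
  rw [coordBasis, Module.Basis.reindex_apply, hi]
  fin_cases i <;> simp [coordVec, finSumFinEquiv, Fin.addCases]

theorem fst_coordBasis_last : (coordBasis (Fin.last 4)).1 = 0 := by
  have hlast : finSumFinEquiv.symm (Fin.last 4 : Fin (4 + 1)) = Sum.inr 0 :=
    finSumFinEquiv_symm_apply_natAdd (0 : Fin 1)
  rw [coordBasis, Module.Basis.reindex_apply, hlast]
  simp

theorem eq_zero_of_mem_horizontalCovectors {θ : Cov [⋀^Fin k]→L[ℝ] ℂ}
    (hθ : θ ∈ horizontalCovectors k)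
    (h : ∀ v : Fin k → Fin 4, StrictMono v → θ (coordVec ∘ v) = 0) : θ = 0 := by
  refine ContinuousAlternatingMap.toAlternatingMap_injective
    (alternatingMap_ext_of_strictMono coordBasis fun v hv => ?_)
  by_cases hlast : ∃ i, v i = Fin.last 4
  · obtain ⟨i, hi⟩ := hlast
    exact hθ _ ⟨i, by rw [Function.comp_apply, hi, fst_coordBasis_last]⟩
  · choose w hw using fun i => Fin.exists_castSucc_eq.2 (not_exists.1 hlast i)
    obtain rfl : Fin.castSucc ∘ w = v := funext hw
    have hcomp : coordBasis ∘ Fin.castSucc ∘ w = coordVec ∘ w :=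
      funext fun i => coordBasis_castSucc (w i)
    rw [hcomp]
    exact h w fun i j hij => Fin.castSucc_lt_castSucc_iff.1 (hv hij)

theorem shearCLM_coordVec_zero : shearCLM 1 (coordVec 0) = coordVec 0 := by
  simp [shearCLM_apply, coordVec]

theorem shearCLM_coordVec_one : shearCLM 1 (coordVec 1) = coordVec 1 := by
  simp [shearCLM_apply, coordVec]

theorem shearCLM_coordVec_two : shearCLM 1 (coordVec 2) = coordVec 2 + coordVec 0 := by
  simp [shearCLM_apply, coordVec]

theorem shearCLM_coordVec_three : shearCLM 1 (coordVec 3) = coordVec 3 + coordVec 1 := by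
  simp [shearCLM_apply, coordVec]

theorem eq_zero_of_mem_invariantCovectors_one {θ : Cov [⋀^Fin 1]→L[ℝ] ℂ}
    (hθ : θ ∈ invariantCovectors 1) (h2 : θ ![coordVec 2] = 0) (h3 : θ ![coordVec 3] = 0) :
    θ = 0 := by
  have hshear : ∀ a, θ ![shearCLM 1 a] = θ ![a] := fun a => by
    rw [← hθ.2 1 ![a], ← FinVec.map_eq]; rfl
  have h0 : θ ![coordVec 0] = 0 := by
    simpa only [shearCLM_coordVec_two, θ.vecCons_add, add_eq_left] using hshear (coordVec 2)
  have h1 : θ ![coordVec 1] = 0 := by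
    simpa only [shearCLM_coordVec_three, θ.vecCons_add, add_eq_left] using hshear (coordVec 3)
  have hmono : ∀ v : Fin 1 → Fin 4, v = ![0] ∨ v = ![1] ∨ v = ![2] ∨ v = ![3] := by decide
  refine eq_zero_of_mem_horizontalCovectors hθ.1 fun v _ => ?_
  rw [← FinVec.map_eq]
  rcases hmono v with rfl | rfl | rfl | rfl
  exacts [h0, h1, h2, h3]

theorem eq_zero_of_mem_invariantCovectors_two {θ : Cov [⋀^Fin 2]→L[ℝ] ℂ}
    (hθ : θ ∈ invariantCovectors 2) (h02 : θ ![coordVec 0, coordVec 2] = 0)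
    (h03 : θ ![coordVec 0, coordVec 3] = 0) (h13 : θ ![coordVec 1, coordVec 3] = 0)
    (h23 : θ ![coordVec 2, coordVec 3] = 0) : θ = 0 := by
  have hshear : ∀ a b, θ ![shearCLM 1 a, shearCLM 1 b] = θ ![a, b] := fun a b => by
    rw [← hθ.2 1 ![a, b], ← FinVec.map_eq]; rfl
  have hadd : ∀ a b c, θ ![a, b + c] = θ ![a, b] + θ ![a, c] := fun a b c =>
    (θ.toAlternatingMap.curryLeft a).map_vecCons_add ![] b c
  have hself : ∀ a, θ ![a, a] = 0 := fun a =>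
    θ.map_eq_zero_of_eq ![a, a] (i := 0) (j := 1) rfl (by decide)
  have hswap : ∀ a b, θ ![a, b] = -θ ![b, a] := fun a b => by
    have hab := hself (a + b)
    rw [θ.vecCons_add, hadd, hadd, hself, hself, zero_add, add_zero] at hab
    exact eq_neg_of_add_eq_zero_left hab
  have h01 : θ ![coordVec 0, coordVec 1] = 0 := by
    simpa only [shearCLM_coordVec_one, shearCLM_coordVec_two, θ.vecCons_add, add_eq_left]
      using hshear (coordVec 2) (coordVec 1)
  have h12 : θ ![coordVec 1, coordVec 2] = 0 := by
    have := hshear (coordVec 2) (coordVec 3)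
    simpa only [shearCLM_coordVec_two, shearCLM_coordVec_three, θ.vecCons_add, hadd, h23, h03, h01,
      add_zero, zero_add, hswap (coordVec 2), neg_eq_zero] using this
  have hmono : ∀ v : Fin 2 → Fin 4, StrictMono v → v = ![0, 1] ∨ v = ![0, 2] ∨ v = ![0, 3] ∨
      v = ![1, 2] ∨ v = ![1, 3] ∨ v = ![2, 3] := by
    simp only [Fin.strictMono_iff_lt_succ]; decide
  refine eq_zero_of_mem_horizontalCovectors hθ.1 fun v hv => ?_
  rw [← FinVec.map_eq]
  rcases hmono v hv with rfl | rfl | rfl | rfl | rfl | rfl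
  exacts [h01, h02, h03, h12, h13, h23]

theorem eq_zero_of_mem_invariantCovectors_three {θ : Cov [⋀^Fin 3]→L[ℝ] ℂ}
    (hθ : θ ∈ invariantCovectors 3) (h023 : θ ![coordVec 0, coordVec 2, coordVec 3] = 0)
    (h123 : θ ![coordVec 1, coordVec 2, coordVec 3] = 0) : θ = 0 := by
  have hshear : ∀ a b c, θ ![shearCLM 1 a, shearCLM 1 b, shearCLM 1 c] = θ ![a, b, c] :=
    fun a b c => by rw [← hθ.2 1 ![a, b, c], ← FinVec.map_eq]; rfl
  have hadd₂ : ∀ a b b' c, θ ![a, b + b', c] = θ ![a, b, c] + θ ![a, b', c] := fun a b b' c =>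
    (θ.toAlternatingMap.curryLeft a).map_vecCons_add ![c] b b'
  have hadd₃ : ∀ a b c c', θ ![a, b, c + c'] = θ ![a, b, c] + θ ![a, b, c'] := fun a b c c' =>
    ((θ.toAlternatingMap.curryLeft a).curryLeft b).map_vecCons_add ![] c c'
  have h13 : ∀ a b, θ ![a, b, a] = 0 := fun a b =>
    θ.map_eq_zero_of_eq ![a, b, a] (i := 0) (j := 2) rfl (by decide)
  have h23 : ∀ a b, θ ![a, b, b] = 0 := fun a b =>
    θ.map_eq_zero_of_eq ![a, b, b] (i := 1) (j := 2) rfl (by decide)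
  have h012 : θ ![coordVec 0, coordVec 1, coordVec 2] = 0 := by
    simpa only [shearCLM_coordVec_zero, shearCLM_coordVec_two, shearCLM_coordVec_three, hadd₂,
      hadd₃, h13, add_zero, add_eq_left] using hshear (coordVec 0) (coordVec 3) (coordVec 2)
  have h013 : θ ![coordVec 0, coordVec 1, coordVec 3] = 0 := by
    simpa only [shearCLM_coordVec_one, shearCLM_coordVec_two, shearCLM_coordVec_three,
      θ.vecCons_add, hadd₃, h23, add_zero, add_eq_left]
      using hshear (coordVec 2) (coordVec 1) (coordVec 3)
  have hmono : ∀ v : Fin 3 → Fin 4, StrictMono v →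
      v = ![0, 1, 2] ∨ v = ![0, 1, 3] ∨ v = ![0, 2, 3] ∨ v = ![1, 2, 3] := by
    simp only [Fin.strictMono_iff_lt_succ]; decide
  refine eq_zero_of_mem_horizontalCovectors hθ.1 fun v hv => ?_
  rw [← FinVec.map_eq]
  rcases hmono v hv with rfl | rfl | rfl | rfl
  exacts [h012, h013, h023, h123]

theorem eq_zero_of_mem_horizontalCovectors_four {θ : Cov [⋀^Fin 4]→L[ℝ] ℂ}
    (hθ : θ ∈ horizontalCovectors 4) (h : θ coordVec = 0) : θ = 0 :=
  eq_zero_of_mem_horizontalCovectors hθ fun v hv => by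
    rwa [show v = id from hv.eq_id, Function.comp_id]

/-- The covector `dw` on the transversal `ℂ²`. -/
noncomputable def dwCLM : ℂ × ℂ →L[ℝ] ℂ := .fst ℝ ℂ ℂ

/-- The covector `dz` on the transversal `ℂ²`. -/
noncomputable def dzCLM : ℂ × ℂ →L[ℝ] ℂ := .snd ℝ ℂ ℂ

/-- The covector `dw̄` on the transversal `ℂ²`. -/
noncomputable def dwBarCLM : ℂ × ℂ →L[ℝ] ℂ := Complex.conjCLE.toContinuousLinearMap ∘L dwCLM

/-- The covector `dz̄` on the transversal `ℂ²`. -/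
noncomputable def dzBarCLM : ℂ × ℂ →L[ℝ] ℂ := Complex.conjCLE.toContinuousLinearMap ∘L dzCLM

/-- The wedge product of covectors of the transversal `ℂ²`, as an alternating form on `ℂ² × ℝ`: the
pullback of the determinant. -/
noncomputable def wedgeForm (θ : Fin k → ℂ × ℂ →L[ℝ] ℂ) : Cov [⋀^Fin k]→L[ℝ] ℂ :=
  (ContinuousAlternatingMap.restrictScalars ℝ
    { (Matrix.detRowAlternating : (Fin k → ℂ) [⋀^Fin k]→ₗ[ℂ] ℂ) with
      cont := continuous_id.matrix_det }).compContinuousLinearMap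
    (.pi θ ∘L .fst ℝ (ℂ × ℂ) ℝ)

theorem wedgeForm_apply (θ : Fin k → ℂ × ℂ →L[ℝ] ℂ) (u : Fin k → Cov) :
    wedgeForm θ u = wedge (fun i v => θ i v.1) u :=
  (Matrix.det_transpose _).symm

theorem wedgeForm_mem_horizontalCovectors (θ : Fin k → ℂ × ℂ →L[ℝ] ℂ) :
    wedgeForm θ ∈ horizontalCovectors k := by
  rintro u ⟨j, hj⟩
  rw [wedgeForm_apply]
  exact Matrix.det_eq_zero_of_column_eq_zero j fun i => by
    simp only [Matrix.of_apply, hj, map_zero]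

theorem wedge_one (θ : Fin 1 → Cov → ℂ) (u : Fin 1 → Cov) : wedge θ u = θ 0 (u 0) :=
  Matrix.det_fin_one _

theorem wedge_two (θ : Fin 2 → Cov → ℂ) (u : Fin 2 → Cov) :
    wedge θ u = θ 0 (u 0) * θ 1 (u 1) - θ 0 (u 1) * θ 1 (u 0) :=
  Matrix.det_fin_two _

theorem wedge_three (θ : Fin 3 → Cov → ℂ) (u : Fin 3 → Cov) : wedge θ u =
    θ 0 (u 0) * θ 1 (u 1) * θ 2 (u 2) - θ 0 (u 0) * θ 1 (u 2) * θ 2 (u 1)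
      - θ 0 (u 1) * θ 1 (u 0) * θ 2 (u 2) + θ 0 (u 1) * θ 1 (u 2) * θ 2 (u 0)
      + θ 0 (u 2) * θ 1 (u 0) * θ 2 (u 1) - θ 0 (u 2) * θ 1 (u 1) * θ 2 (u 0) :=
  Matrix.det_fin_three _

theorem wedge_four (θ : Fin 4 → Cov → ℂ) (u : Fin 4 → Cov) : wedge θ u =
    θ 0 (u 0) * wedge ![θ 1, θ 2, θ 3] ![u 1, u 2, u 3]
      - θ 0 (u 1) * wedge ![θ 1, θ 2, θ 3] ![u 0, u 2, u 3]
      + θ 0 (u 2) * wedge ![θ 1, θ 2, θ 3] ![u 0, u 1, u 3]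
      - θ 0 (u 3) * wedge ![θ 1, θ 2, θ 3] ![u 0, u 1, u 2] := by
  simp only [wedge_three]
  simp [wedge, Matrix.det_succ_row_zero, Fin.sum_univ_succ, Fin.succAbove]
  ring

theorem dwCLM_shearCLM (n : ℤ) (u : Cov) : dwCLM (shearCLM n u).1 = dwCLM u.1 + n * dzCLM u.1 := by
  rw [shearCLM_apply]; rfl

theorem dzCLM_shearCLM (n : ℤ) (u : Cov) : dzCLM (shearCLM n u).1 = dzCLM u.1 := by
  rw [shearCLM_apply]; rfl

theorem dwBarCLM_shearCLM (n : ℤ) (u : Cov) :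
    dwBarCLM (shearCLM n u).1 = dwBarCLM u.1 + n * dzBarCLM u.1 := by
  simp [dwBarCLM, dzBarCLM, dwCLM_shearCLM]

theorem dzBarCLM_shearCLM (n : ℤ) (u : Cov) : dzBarCLM (shearCLM n u).1 = dzBarCLM u.1 := by
  rw [shearCLM_apply]; rfl

/-- Evaluation of alternating forms at finitely many tuples of vectors. -/
noncomputable def evalTuples (S : Fin m → Fin k → Cov) :
    (Cov [⋀^Fin k]→L[ℝ] ℂ) →ₗ[ℂ] Fin m → ℂ where
  toFun θ i := θ (S i)
  map_add' _ _ := rfl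
  map_smul' _ _ := rfl

/-- The basis of the invariant covectors given by elements whose values at a separating system of
tuples of vectors form an invertible matrix. -/
noncomputable def invariantBasis (T : Fin m → Cov [⋀^Fin k]→L[ℝ] ℂ)
    (hT : ∀ j, T j ∈ invariantCovectors k) (S : Fin m → Fin k → Cov)
    (hS : ∀ θ ∈ invariantCovectors k, (∀ i, θ (S i) = 0) → θ = 0)
    (hdet : (Matrix.of fun j i => T j (S i)).det ≠ 0) :
    Module.Basis (Fin m) ℂ (invariantCovectors k) :=
  have hdet' : (Matrix.of fun j => evalTuples S (⟨T j, hT j⟩ : invariantCovectors k)).det ≠ 0 :=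
    hdet
  .mk (linearIndependent_of_det_ne_zero hdet')
    (span_eq_top_of_det_ne_zero (fun θ hθ h => hS θ hθ (congrFun h)) hdet').ge

theorem coe_invariantBasis {T : Fin m → Cov [⋀^Fin k]→L[ℝ] ℂ}
    (hT : ∀ j, T j ∈ invariantCovectors k) {S : Fin m → Fin k → Cov}
    (hS : ∀ θ ∈ invariantCovectors k, (∀ i, θ (S i) = 0) → θ = 0)
    (hdet : (Matrix.of fun j i => T j (S i)).det ≠ 0) (j : Fin m) :
    (invariantBasis T hT S hS hdet j : Cov [⋀^Fin k]→L[ℝ] ℂ) = T j := by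
  rw [invariantBasis, Module.Basis.mk_apply]

theorem covectors_coordVec_zero : dwCLM (coordVec 0).1 = 1 ∧ dzCLM (coordVec 0).1 = 0 ∧
    dwBarCLM (coordVec 0).1 = 1 ∧ dzBarCLM (coordVec 0).1 = 0 := by
  simp [dwCLM, dzCLM, dwBarCLM, dzBarCLM, coordVec]

theorem covectors_coordVec_one : dwCLM (coordVec 1).1 = I ∧ dzCLM (coordVec 1).1 = 0 ∧
    dwBarCLM (coordVec 1).1 = -I ∧ dzBarCLM (coordVec 1).1 = 0 := by
  simp [dwCLM, dzCLM, dwBarCLM, dzBarCLM, coordVec]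

theorem covectors_coordVec_two : dwCLM (coordVec 2).1 = 0 ∧ dzCLM (coordVec 2).1 = 1 ∧
    dwBarCLM (coordVec 2).1 = 0 ∧ dzBarCLM (coordVec 2).1 = 1 := by
  simp [dwCLM, dzCLM, dwBarCLM, dzBarCLM, coordVec]

theorem covectors_coordVec_three : dwCLM (coordVec 3).1 = 0 ∧ dzCLM (coordVec 3).1 = I ∧
    dwBarCLM (coordVec 3).1 = 0 ∧ dzBarCLM (coordVec 3).1 = -I := by
  simp [dwCLM, dzCLM, dwBarCLM, dzBarCLM, coordVec]

/-- The invariant covector `1`. -/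
noncomputable def covectorsZero : Fin 1 → Cov [⋀^Fin 0]→L[ℝ] ℂ := ![wedgeForm ![]]

/-- The invariant covectors `dz` and `dz̄`. -/
noncomputable def covectorsOne : Fin 2 → Cov [⋀^Fin 1]→L[ℝ] ℂ :=
  ![wedgeForm ![dzCLM], wedgeForm ![dzBarCLM]]

/-- The invariant covectors `dw ∧ dz`, `dw ∧ dz̄ + dw̄ ∧ dz`, `dw̄ ∧ dz̄` and `dz ∧ dz̄`. -/
noncomputable def covectorsTwo : Fin 4 → Cov [⋀^Fin 2]→L[ℝ] ℂ :=
  ![wedgeForm ![dwCLM, dzCLM], wedgeForm ![dwCLM, dzBarCLM] + wedgeForm ![dwBarCLM, dzCLM],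
    wedgeForm ![dwBarCLM, dzBarCLM], wedgeForm ![dzCLM, dzBarCLM]]

/-- The invariant covectors `dw ∧ dz ∧ dz̄` and `dw̄ ∧ dz ∧ dz̄`. -/
noncomputable def covectorsThree : Fin 2 → Cov [⋀^Fin 3]→L[ℝ] ℂ :=
  ![wedgeForm ![dwCLM, dzCLM, dzBarCLM], wedgeForm ![dwBarCLM, dzCLM, dzBarCLM]]

/-- The invariant covector `dw ∧ dz ∧ dw̄ ∧ dz̄`. -/
noncomputable def covectorsFour : Fin 1 → Cov [⋀^Fin 4]→L[ℝ] ℂ :=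
  ![wedgeForm ![dwCLM, dzCLM, dwBarCLM, dzBarCLM]]

theorem covectorsZero_mem (j : Fin 1) : covectorsZero j ∈ invariantCovectors 0 := by
  fin_cases j
  exact ⟨wedgeForm_mem_horizontalCovectors _, fun n u => congrArg _ (Subsingleton.elim _ _)⟩

theorem covectorsOne_mem (j : Fin 2) : covectorsOne j ∈ invariantCovectors 1 := by
  fin_cases j <;> refine ⟨wedgeForm_mem_horizontalCovectors _, fun n u => ?_⟩ <;>
    simp [covectorsOne, wedgeForm_apply, wedge_one, dzCLM_shearCLM, dzBarCLM_shearCLM]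

theorem covectorsTwo_mem (j : Fin 4) : covectorsTwo j ∈ invariantCovectors 2 := by
  constructor
  · fin_cases j
    exacts [wedgeForm_mem_horizontalCovectors _, add_mem (wedgeForm_mem_horizontalCovectors _)
      (wedgeForm_mem_horizontalCovectors _), wedgeForm_mem_horizontalCovectors _,
      wedgeForm_mem_horizontalCovectors _]
  · intro n u
    fin_cases j <;> simp only [covectorsTwo, Fin.zero_eta, Fin.mk_one, Fin.reduceFinMk,
      Matrix.cons_val, ContinuousAlternatingMap.add_apply, wedgeForm_apply, wedge_two,
      Function.comp_apply, dwCLM_shearCLM, dzCLM_shearCLM, dwBarCLM_shearCLM, dzBarCLM_shearCLM] <;>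
      ring

theorem covectorsThree_mem (j : Fin 2) : covectorsThree j ∈ invariantCovectors 3 := by
  fin_cases j <;> refine ⟨wedgeForm_mem_horizontalCovectors _, fun n u => ?_⟩ <;>
    simp only [covectorsThree, Fin.zero_eta, Fin.mk_one, Matrix.cons_val, wedgeForm_apply,
      wedge_three, Function.comp_apply, dwCLM_shearCLM, dzCLM_shearCLM, dwBarCLM_shearCLM,
      dzBarCLM_shearCLM] <;>
    ring

theorem covectorsFour_mem (j : Fin 1) : covectorsFour j ∈ invariantCovectors 4 := by
  fin_cases j
  refine ⟨wedgeForm_mem_horizontalCovectors _, fun n u => ?_⟩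
  simp only [covectorsFour, Fin.zero_eta, Matrix.cons_val, wedgeForm_apply, wedge_four, wedge_three,
    Function.comp_apply, dwCLM_shearCLM, dzCLM_shearCLM, dwBarCLM_shearCLM, dzBarCLM_shearCLM]
  ring

/-- The basis `covectorsZero` of the invariant `0`-covectors. -/
noncomputable def basisZero : Module.Basis (Fin 1) ℂ (invariantCovectors 0) :=
  invariantBasis covectorsZero covectorsZero_mem ![![]]
    (fun _ _ h => ContinuousAlternatingMap.ext fun u => Subsingleton.elim ![] u ▸ h 0)
    (by simp [covectorsZero, wedgeForm_apply, wedge])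

/-- The basis `covectorsOne` of the invariant `1`-covectors. -/
noncomputable def basisOne : Module.Basis (Fin 2) ℂ (invariantCovectors 1) :=
  invariantBasis covectorsOne covectorsOne_mem ![![coordVec 2], ![coordVec 3]]
    (fun _ hθ h => eq_zero_of_mem_invariantCovectors_one hθ (h 0) (h 1)) <|
    ne_of_eq_of_ne (b := -2 * I) (by
      simp only [covectorsOne, Matrix.det_fin_two, Matrix.of_apply, Matrix.cons_val,
        wedgeForm_apply, wedge_one, covectors_coordVec_two, covectors_coordVec_three]
      grind [I_mul_I]) (by norm_num)

/-- Tuples of vectors separating the invariant `2`-covectors. -/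
noncomputable def tuplesTwo : Fin 4 → Fin 2 → Cov :=
  ![![coordVec 0, coordVec 2], ![coordVec 0, coordVec 3], ![coordVec 1, coordVec 3],
    ![coordVec 2, coordVec 3]]

theorem covectorsTwo_tuplesTwo : (Matrix.of fun j i => covectorsTwo j (tuplesTwo i)) =
    !![1, I, -1, 0; 2, 0, 2, 0; 1, -I, -1, 0; 0, 0, 0, -2 * I] := by
  ext j i
  fin_cases j <;> fin_cases i <;>
    simp only [covectorsTwo, tuplesTwo, Fin.zero_eta, Fin.mk_one, Fin.reduceFinMk, Matrix.of_apply,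
      Matrix.cons_val', Matrix.cons_val, ContinuousAlternatingMap.add_apply, wedgeForm_apply,
      wedge_two, covectors_coordVec_zero, covectors_coordVec_one, covectors_coordVec_two,
      covectors_coordVec_three] <;>
    grind [I_mul_I]

/-- The basis `covectorsTwo` of the invariant `2`-covectors. -/
noncomputable def basisTwo : Module.Basis (Fin 4) ℂ (invariantCovectors 2) :=
  invariantBasis covectorsTwo covectorsTwo_mem tuplesTwo
    (fun _ hθ h => eq_zero_of_mem_invariantCovectors_two hθ (h 0) (h 1) (h 2) (h 3)) <| by
      rw [covectorsTwo_tuplesTwo]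
      simp [Matrix.det_succ_row_zero, Fin.sum_univ_succ, Fin.succAbove]
      grind [I_mul_I]

/-- The basis `covectorsThree` of the invariant `3`-covectors. -/
noncomputable def basisThree : Module.Basis (Fin 2) ℂ (invariantCovectors 3) :=
  invariantBasis covectorsThree covectorsThree_mem
    ![![coordVec 0, coordVec 2, coordVec 3], ![coordVec 1, coordVec 2, coordVec 3]]
    (fun _ hθ h => eq_zero_of_mem_invariantCovectors_three hθ (h 0) (h 1)) <|
    ne_of_eq_of_ne (b := 8 * I) (by
      simp only [covectorsThree, Matrix.det_fin_two, Matrix.of_apply, Matrix.cons_val,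
        wedgeForm_apply, wedge_three, covectors_coordVec_zero, covectors_coordVec_one,
        covectors_coordVec_two, covectors_coordVec_three]
      grind [I_mul_I]) (by norm_num)

/-- The basis `covectorsFour` of the invariant `4`-covectors. -/
noncomputable def basisFour : Module.Basis (Fin 1) ℂ (invariantCovectors 4) :=
  invariantBasis covectorsFour covectorsFour_mem ![coordVec]
    (fun _ hθ h => eq_zero_of_mem_horizontalCovectors_four hθ.1 (h 0)) <|
    ne_of_eq_of_ne (b := 4) (by
      simp only [covectorsFour, Matrix.det_unique, Fin.default_eq_zero, Matrix.of_apply,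
        Matrix.cons_val, wedgeForm_apply, wedge_four, wedge_three, covectors_coordVec_zero,
        covectors_coordVec_one, covectors_coordVec_two, covectors_coordVec_three]
      grind [I_mul_I]) (by norm_num)

end Suspension

/-! ### Basic forms in coefficients -/

namespace Suspension

variable {k : ℕ} {ι κ : Type*} [Fintype ι] [Fintype κ]
  (b : Module.Basis ι ℂ (invariantCovectors k))

theorem lift_mem_invariantCovectors {α : RoughForm Cov Suspension ℂ k}
    (hα : α ∈ foliation.basicForms ℂ k) (x : Cov) :
    RoughForm.lift proj α x ∈ invariantCovectors k :=
  ⟨(mem_basicForms_iff.1 hα).2.1 x, fun n u => lift_shearCLM_apply hα n x u⟩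

/-- The form on the covering `ℂ² × ℝ` whose coefficients in a basis of the invariant covectors are
the pullbacks of given functions of `z`. -/
noncomputable def coverForm (g : ι → SmoothTorus2) (x : Cov) : Cov [⋀^Fin k]→L[ℝ] ℂ :=
  b.equivFun.symm fun j => periodic (g j) x.1.2

theorem coverForm_eq_sum (g : ι → SmoothTorus2) (x : Cov) :
    coverForm b g x = ∑ j, periodic (g j) x.1.2 • (b j : Cov [⋀^Fin k]→L[ℝ] ℂ) := by
  rw [coverForm, b.equivFun_symm_apply]
  simp only [Submodule.coe_sum, Submodule.coe_smul]

theorem coverForm_apply (g : ι → SmoothTorus2) (x : Cov) (u : Fin k → Cov) :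
    coverForm b g x u =
      ∑ j, periodic (g j) x.1.2 * (b j : Cov [⋀^Fin k]→L[ℝ] ℂ) u := by
  simp only [coverForm_eq_sum, ContinuousAlternatingMap.sum_apply,
    ContinuousAlternatingMap.smul_apply, smul_eq_mul]

theorem coverForm_add (f g : ι → SmoothTorus2) :
    coverForm b (f + g) = coverForm b f + coverForm b g := funext fun x =>
  congrArg Subtype.val <| map_add b.equivFun.symm (fun j => periodic (f j) x.1.2)
    fun j => periodic (g j) x.1.2

theorem coverForm_smul (c : ℂ) (g : ι → SmoothTorus2) :
    coverForm b (c • g) = c • coverForm b g := funext fun x =>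
  congrArg Subtype.val <| map_smul b.equivFun.symm c fun j => periodic (g j) x.1.2

theorem coverForm_injective : Function.Injective (coverForm b) := fun _ _ h =>
  funext fun j => smoothTorus2_ext fun z =>
    congrFun (b.equivFun.symm.injective (Subtype.ext (congrFun h ((0, z), 0)))) j

theorem contDiff_coverForm (g : ι → SmoothTorus2) : ContDiff ℝ ∞ (coverForm b g) := by
  simp only [funext (coverForm_eq_sum b g)]
  exact ContDiff.sum fun j _ =>
    ((contDiff_periodic (g j)).comp (contDiff_snd.comp contDiff_fst)).smul contDiff_const

theorem isDeckInvariant_coverForm (g : ι → SmoothTorus2) : IsDeckInvariant (coverForm b g) := by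
  intro n l hl x
  have hz : coverForm b g (deck n l x) = coverForm b g x := by
    simp only [coverForm, deck_apply, (isSmoothPeriodic_periodic _).periodic _ hl.2 _]
  rw [hz]
  exact ContinuousAlternatingMap.ext fun u => (Subtype.prop (b.equivFun.symm _)).2 n u

theorem coverForm_mem_horizontalCovectors (g : ι → SmoothTorus2) (x : Cov) :
    coverForm b g x ∈ horizontalCovectors k :=
  (Subtype.prop (b.equivFun.symm _)).1

theorem extDeriv_coverForm_apply (g : ι → SmoothTorus2) (x : Cov) (u : Fin (k + 1) → Cov) :
    extDeriv (coverForm b g) x u = ∑ i : Fin (k + 1), (-1) ^ (i : ℕ) * ∑ j,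
      (periodic (del (g j)) x.1.2 * dz (u i) + periodic (delBar (g j)) x.1.2 * dzBar (u i)) *
        (b j : Cov [⋀^Fin k]→L[ℝ] ℂ) (i.removeNth u) := by
  rw [extDeriv_apply ((contDiff_coverForm b g).differentiable (by simp) x)]
  refine Finset.sum_congr rfl fun i _ => ?_
  have hderiv : HasFDerivAt (fun y => coverForm b g y (i.removeNth u)) (∑ j,
      (b j : Cov [⋀^Fin k]→L[ℝ] ℂ) (i.removeNth u) • ((fderiv ℝ (periodic (g j)) x.1.2).comp
        ((ContinuousLinearMap.snd ℝ ℂ ℂ).comp (ContinuousLinearMap.fst ℝ (ℂ × ℂ) ℝ)))) x := by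
    simp only [coverForm_apply]
    exact HasFDerivAt.fun_sum fun j _ =>
      ((differentiable_periodic (g j) _).hasFDerivAt.comp x
        ((ContinuousLinearMap.snd ℝ ℂ ℂ).comp
          (ContinuousLinearMap.fst ℝ (ℂ × ℂ) ℝ)).hasFDerivAt).mul_const _
  rw [hderiv.fderiv]
  simp only [sum_apply, smul_apply, smul_eq_mul, ContinuousLinearMap.comp_apply,
    ContinuousLinearMap.coe_fst', ContinuousLinearMap.coe_snd', zsmul_eq_mul,
    fderiv_periodic_eq_del_add_delBar, Int.cast_pow, Int.cast_neg, Int.cast_one]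
  exact congrArg _ (Finset.sum_congr rfl fun j _ => mul_comm _ _)

theorem extDeriv_coverForm_mem_horizontalCovectors (g : ι → SmoothTorus2) (x : Cov) :
    extDeriv (coverForm b g) x ∈ horizontalCovectors (k + 1) := by
  rintro u ⟨i₀, hi₀⟩
  rw [extDeriv_coverForm_apply]
  refine Finset.sum_eq_zero fun i _ => mul_eq_zero_of_right _ (Finset.sum_eq_zero fun j _ => ?_)
  by_cases hi : i₀ = i
  · have hdz : dz (u i) = 0 := congrArg Prod.snd (hi ▸ hi₀)
    have hdzBar : dzBar (u i) = 0 := (congrArg (starRingEnd ℂ) hdz).trans (map_zero _)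
    rw [hdz, hdzBar, mul_zero, mul_zero, add_zero, zero_mul]
  · obtain ⟨r, hr⟩ := Fin.exists_succAbove_eq hi
    exact mul_eq_zero_of_right _ ((b j).2.1 _ ⟨r, by rw [Fin.removeNth_apply, hr, hi₀]⟩)

/-- The form on the suspension whose coefficients in a basis of the invariant covectors are given
functions of `z`. -/
noncomputable def form : (ι → SmoothTorus2) →ₗ[ℂ] RoughForm Cov Suspension ℂ k where
  toFun g := RoughForm.descend (coverForm b g)
  map_add' f g := by rw [coverForm_add]; rfl
  map_smul' c g := by rw [coverForm_smul]; rfl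

theorem lift_form (g : ι → SmoothTorus2) : RoughForm.lift proj (form b g) = coverForm b g :=
  lift_descend (isDeckInvariant_coverForm b g)

theorem form_injective : Function.Injective (form b) := fun _ _ h =>
  coverForm_injective b (by rw [← lift_form, ← lift_form, h])

theorem form_mem_basicForms (g : ι → SmoothTorus2) : form b g ∈ foliation.basicForms ℂ k := by
  rw [mem_basicForms_iff, lift_form]
  exact ⟨contDiff_coverForm b g, coverForm_mem_horizontalCovectors b g,
    extDeriv_coverForm_mem_horizontalCovectors b g⟩

theorem exists_form_eq {α : RoughForm Cov Suspension ℂ k} (hα : α ∈ foliation.basicForms ℂ k) :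
    ∃ g, form b g = α := by
  have : FiniteDimensional ℂ (invariantCovectors k) := b.finiteDimensional_of_finite
  have hcoord : ∀ j, IsSmoothPeriodic fun z =>
      b.coord j ⟨_, lift_mem_invariantCovectors hα ((0, z), 0)⟩ := by
    intro j
    obtain ⟨c, hc, -⟩ := exists_extension_norm_eq (𝕜 := ℂ) (invariantCovectors k)
      (LinearMap.toContinuousLinearMap (b.coord j))
    have hcomp : (fun z => b.coord j ⟨_, lift_mem_invariantCovectors hα ((0, z), 0)⟩) =
        fun z => c (RoughForm.lift proj α ((0, z), 0)) := funext fun z => (hc _).symm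
    rw [hcomp]
    refine ⟨?_, fun v hv z => congrArg c (lift_add_intLattice hα hv z)⟩
    exact (c.restrictScalars ℝ).contDiff.comp ((mem_basicForms_iff.1 hα).1.comp (by fun_prop))
  refine ⟨fun j => (hcoord j).toTorus, uniformization_proj.lift_injective (funext fun x => ?_)⟩
  rw [lift_form, lift_eq_lift_zero hα x, coverForm]
  exact congrArg Subtype.val (b.equivFun.symm_apply_apply _)

theorem d_form_eq (b' : Module.Basis κ ℂ (invariantCovectors (k + 1))) {g : ι → SmoothTorus2}
    {g' : κ → SmoothTorus2} (h : ∀ x u, extDeriv (coverForm b g) x u = coverForm b' g' x u) :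
    RoughForm.d (form b g) = form b' g' := by
  refine uniformization_proj.lift_injective ?_
  rw [uniformization_proj.lift_d (form_mem_basicForms b g).1, lift_form, lift_form]
  exact funext fun x => ContinuousAlternatingMap.ext (h x)

theorem coverForm_basisZero (g : Fin 1 → SmoothTorus2) (x : Cov) (u : Fin 0 → Cov) :
    coverForm basisZero g x u = periodic (g 0) x.1.2 := by
  rw [coverForm_apply, Fin.sum_univ_one, basisZero, coe_invariantBasis]
  simp [covectorsZero, wedgeForm_apply, wedge]

theorem coverForm_basisOne (g : Fin 2 → SmoothTorus2) (x : Cov) (u : Fin 1 → Cov) :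
    coverForm basisOne g x u =
      periodic (g 0) x.1.2 * wedge ![dz] u + periodic (g 1) x.1.2 * wedge ![dzBar] u := by
  rw [coverForm_apply, Fin.sum_univ_two]
  simp only [basisOne, coe_invariantBasis, covectorsOne, Matrix.cons_val, wedgeForm_apply,
    wedge_one]
  rfl

theorem coverForm_basisTwo (g : Fin 4 → SmoothTorus2) (x : Cov) (u : Fin 2 → Cov) :
    coverForm basisTwo g x u = periodic (g 0) x.1.2 * wedge ![dw, dz] u
      + periodic (g 1) x.1.2 * (wedge ![dw, dzBar] u + wedge ![dwBar, dz] u)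
      + periodic (g 2) x.1.2 * wedge ![dwBar, dzBar] u
      + periodic (g 3) x.1.2 * wedge ![dz, dzBar] u := by
  rw [coverForm_apply, Fin.sum_univ_four]
  simp only [basisTwo, coe_invariantBasis, covectorsTwo, Matrix.cons_val,
    ContinuousAlternatingMap.add_apply, wedgeForm_apply, wedge_two]
  rfl

theorem coverForm_basisThree (g : Fin 2 → SmoothTorus2) (x : Cov) (u : Fin 3 → Cov) :
    coverForm basisThree g x u = periodic (g 0) x.1.2 * wedge ![dw, dz, dzBar] u
      + periodic (g 1) x.1.2 * wedge ![dwBar, dz, dzBar] u := by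
  rw [coverForm_apply, Fin.sum_univ_two]
  simp only [basisThree, coe_invariantBasis, covectorsThree, Matrix.cons_val, wedgeForm_apply,
    wedge_three]
  rfl

theorem coverForm_basisFour (g : Fin 1 → SmoothTorus2) (x : Cov) (u : Fin 4 → Cov) :
    coverForm basisFour g x u = periodic (g 0) x.1.2 * wedge ![dw, dz, dwBar, dzBar] u := by
  rw [coverForm_apply, Fin.sum_univ_one]
  simp only [basisFour, coe_invariantBasis, covectorsFour, Matrix.cons_val, wedgeForm_apply,
    wedge_four, wedge_three]
  rfl

theorem d_form_basisZero (g : Fin 1 → SmoothTorus2) :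
    RoughForm.d (form basisZero g) = form basisOne ![del (g 0), delBar (g 0)] := by
  refine d_form_eq _ _ fun x u => ?_
  rw [extDeriv_coverForm_apply, coverForm_basisOne]
  simp [basisZero, coe_invariantBasis, covectorsZero, wedgeForm_apply, wedge]

theorem d_form_basisOne (g : Fin 2 → SmoothTorus2) :
    RoughForm.d (form basisOne g) = form basisTwo ![0, 0, 0, del (g 1) - delBar (g 0)] := by
  refine d_form_eq _ _ fun x u => ?_
  rw [extDeriv_coverForm_apply, coverForm_basisTwo]
  simp [Fin.sum_univ_two, basisOne, coe_invariantBasis, covectorsOne, wedgeForm_apply, wedge_one,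
    wedge_two, periodic_zero, periodic_sub, Fin.removeNth_apply, dzCLM, dzBarCLM, dz, dzBar]
  ring

theorem d_form_basisTwo (g : Fin 4 → SmoothTorus2) :
    RoughForm.d (form basisTwo g) =
      form basisThree ![delBar (g 0) - del (g 1), delBar (g 1) - del (g 2)] := by
  refine d_form_eq _ _ fun x u => ?_
  rw [extDeriv_coverForm_apply, coverForm_basisThree]
  simp [Fin.sum_univ_three, Fin.sum_univ_four, basisTwo, coe_invariantBasis, covectorsTwo,
    wedgeForm_apply, wedge_two, wedge_three, periodic_sub, Fin.removeNth_apply, Fin.succAbove,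
    dwCLM, dzCLM, dwBarCLM, dzBarCLM, dw, dz, dwBar, dzBar]
  ring

theorem d_form_basisThree (g : Fin 2 → SmoothTorus2) : RoughForm.d (form basisThree g) = 0 := by
  rw [← map_zero (form basisFour)]
  refine d_form_eq _ _ fun x u => ?_
  rw [extDeriv_coverForm_apply, coverForm_basisFour]
  simp [Fin.sum_univ_four, basisThree, coe_invariantBasis, covectorsThree, wedgeForm_apply,
    wedge_three, periodic_zero, Fin.removeNth_apply, Fin.succAbove, dwCLM, dzCLM, dwBarCLM,
    dzBarCLM, dz, dzBar]
  ring

theorem d_form_basisFour (g : Fin 1 → SmoothTorus2) : RoughForm.d (form basisFour g) = 0 := by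
  refine uniformization_proj.lift_injective ?_
  rw [uniformization_proj.lift_d (form_mem_basicForms basisFour g).1, lift_form]
  refine funext fun x => eq_zero_of_mem_horizontalCovectors
    (extDeriv_coverForm_mem_horizontalCovectors basisFour g x) fun v hv => ?_
  simpa using Fintype.card_le_of_injective v hv.injective

end Suspension

/-! ### The basic cohomology -/

namespace Foliation

section ClosedExact

variable {E : Type*} [NormedAddCommGroup E] [NormedSpace ℝ E]
  {M : Type*} [TopologicalSpace M] [ChartedSpace E M]
  {E' : Type*} [NormedAddCommGroup E'] [NormedSpace ℝ E']
  {T : Type*} [TopologicalSpace T] [ChartedSpace E' T] {F : Foliation E M E' T}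
  {W : Type*} [NormedAddCommGroup W] [NormedSpace ℝ W] [NormedSpace ℂ W] [SMulCommClass ℝ ℂ W]
  {k : ℕ}

theorem mem_closedForms_iff {α : RoughForm E M W k} :
    α ∈ F.closedForms W k ↔ α ∈ F.basicForms W k ∧ RoughForm.d α = 0 := by
  constructor
  · rintro ⟨β, hβ, rfl⟩
    exact ⟨β.2, hβ⟩
  · rintro ⟨hα, hdα⟩
    exact ⟨⟨α, hα⟩, hdα, rfl⟩

theorem mem_exactForms_succ_iff {α : RoughForm E M W (k + 1)} :
    α ∈ F.exactForms W (k + 1) ↔ ∃ β ∈ F.basicForms W k, RoughForm.d β = α :=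
  ⟨fun ⟨β, hd⟩ => ⟨β.1, β.2, hd⟩, fun ⟨β, hβ, hd⟩ => ⟨⟨β, hβ⟩, hd⟩⟩

theorem exists_equiv_basicCohomology {C : Type*} [AddCommGroup C] [Module ℂ C]
    (L : C →ₗ[ℂ] RoughForm E M W k) (hL : ∀ c, L c ∈ F.closedForms W k)
    (hinj : ∀ c, L c ∈ F.exactForms W k → c = 0)
    (hsurj : ∀ α ∈ F.closedForms W k, ∃ c, α - L c ∈ F.exactForms W k) :
    ∃ Φ : C ≃ₗ[ℂ] F.basicCohomology W k,
      ∀ c, Φ c = Submodule.Quotient.mk (⟨L c, hL c⟩ : F.closedForms W k) := by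
  let exacts := (F.exactForms W k).submoduleOf (F.closedForms W k)
  let toClass := exacts.mkQ ∘ₗ L.codRestrict _ hL
  have hinjective : Function.Injective toClass := (injective_iff_map_eq_zero toClass).2 fun c hc =>
    have hexact : L.codRestrict _ hL c ∈ exacts := (Submodule.Quotient.mk_eq_zero exacts).1 hc
    hinj c hexact
  have hsurjective : Function.Surjective toClass := fun q => by
    obtain ⟨α, rfl⟩ := Submodule.mkQ_surjective _ q
    obtain ⟨c, hc⟩ := hsurj α.1 α.2
    exact ⟨c, ((Submodule.Quotient.eq exacts).2 hc).symm⟩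
  exact ⟨.ofBijective toClass ⟨hinjective, hsurjective⟩, fun c => rfl⟩

end ClosedExact

end Foliation

namespace Suspension

section Coefficients

variable {k : ℕ} {ι κ : Type*} [Fintype ι] [Fintype κ] (b : Module.Basis ι ℂ (invariantCovectors k))

theorem form_mem_exactForms_iff {b' : Module.Basis κ ℂ (invariantCovectors (k + 1))}
    {g : κ → SmoothTorus2} : form b' g ∈ foliation.exactForms ℂ (k + 1) ↔
      ∃ f, RoughForm.d (form b f) = form b' g := by
  rw [Foliation.mem_exactForms_succ_iff]
  constructor
  · rintro ⟨β, hβ, hd⟩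
    obtain ⟨f, rfl⟩ := exists_form_eq b hβ
    exact ⟨f, hd⟩
  · rintro ⟨f, hf⟩
    exact ⟨_, form_mem_basicForms b f, hf⟩

theorem exists_equiv_basicCohomology_of_form {C : Type*} [AddCommGroup C] [Module ℂ C]
    (L : C →ₗ[ℂ] ι → SmoothTorus2) (hclosed : ∀ c, RoughForm.d (form b (L c)) = 0)
    (hinj : ∀ c, form b (L c) ∈ foliation.exactForms ℂ k → c = 0)
    (hsurj : ∀ g, RoughForm.d (form b g) = 0 →
      ∃ c, form b (g - L c) ∈ foliation.exactForms ℂ k)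
    {η : C → Cov → (Fin k → Cov) → ℂ} (hη : ∀ c x u, coverForm b (L c) x u = η c x u) :
    ∃ Φ : C ≃ₗ[ℂ] foliation.basicCohomology ℂ k, ∀ c, IsRepresentedBy (Φ c) (η c) := by
  have hmem : ∀ c, (form b ∘ₗ L) c ∈ foliation.closedForms ℂ k := fun c =>
    Foliation.mem_closedForms_iff.2 ⟨form_mem_basicForms b _, hclosed c⟩
  obtain ⟨Φ, hΦ⟩ := Foliation.exists_equiv_basicCohomology _ hmem hinj fun α hα => by
    obtain ⟨hbasic, hdα⟩ := Foliation.mem_closedForms_iff.1 hα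
    obtain ⟨g, rfl⟩ := exists_form_eq b hbasic
    simpa only [map_sub, LinearMap.comp_apply] using hsurj g hdα
  refine ⟨Φ, fun c => ⟨⟨_, hmem c⟩, (hΦ c).symm, fun x u => ?_⟩⟩
  rw [← hη, ← lift_form]
  rfl

end Coefficients

theorem form_basisZero_mem_exactForms_iff {g : Fin 1 → SmoothTorus2} :
    form basisZero g ∈ foliation.exactForms ℂ 0 ↔ g = 0 :=
  map_eq_zero_iff _ (form_injective basisZero)

theorem form_basisOne_mem_exactForms_iff {g : Fin 2 → SmoothTorus2} :
    form basisOne g ∈ foliation.exactForms ℂ 1 ↔ ∃ h, g 0 = del h ∧ g 1 = delBar h := by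
  simp only [form_mem_exactForms_iff basisZero, d_form_basisZero, (form_injective basisOne).eq_iff]
  constructor
  · rintro ⟨f, rfl⟩
    exact ⟨f 0, rfl, rfl⟩
  · rintro ⟨h, h0, h1⟩
    exact ⟨fun _ => h, funext (Fin.forall_fin_two.2 ⟨h0.symm, h1.symm⟩)⟩

theorem form_basisTwo_mem_exactForms_iff {g : Fin 4 → SmoothTorus2} :
    form basisTwo g ∈ foliation.exactForms ℂ 2 ↔
      g 0 = 0 ∧ g 1 = 0 ∧ g 2 = 0 ∧ ∃ p q, g 3 = del q - delBar p := by
  simp only [form_mem_exactForms_iff basisOne, d_form_basisOne, (form_injective basisTwo).eq_iff]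
  constructor
  · rintro ⟨f, rfl⟩
    exact ⟨rfl, rfl, rfl, f 0, f 1, rfl⟩
  · rintro ⟨h0, h1, h2, p, q, h3⟩
    refine ⟨![p, q], funext fun j => ?_⟩
    fin_cases j
    exacts [h0.symm, h1.symm, h2.symm, h3.symm]

theorem form_basisThree_mem_exactForms_iff {g : Fin 2 → SmoothTorus2} :
    form basisThree g ∈ foliation.exactForms ℂ 3 ↔
      ∃ b c e, g 0 = delBar b - del c ∧ g 1 = delBar c - del e := by
  simp only [form_mem_exactForms_iff basisTwo, d_form_basisTwo, (form_injective basisThree).eq_iff]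
  constructor
  · rintro ⟨f, rfl⟩
    exact ⟨f 0, f 1, f 2, rfl, rfl⟩
  · rintro ⟨b, c, e, h0, h1⟩
    exact ⟨![b, c, e, 0], funext (Fin.forall_fin_two.2 ⟨h0.symm, h1.symm⟩)⟩

theorem form_basisFour_mem_exactForms_iff {g : Fin 1 → SmoothTorus2} :
    form basisFour g ∈ foliation.exactForms ℂ 4 ↔ g = 0 := by
  simp only [form_mem_exactForms_iff basisThree, d_form_basisThree, exists_const]
  rw [eq_comm, map_eq_zero_iff _ (form_injective basisFour)]

theorem d_form_basisZero_eq_zero_iff {g : Fin 1 → SmoothTorus2} :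
    RoughForm.d (form basisZero g) = 0 ↔ del (g 0) = 0 ∧ delBar (g 0) = 0 := by
  rw [d_form_basisZero, map_eq_zero_iff _ (form_injective basisOne), funext_iff,
    Fin.forall_fin_two]
  rfl

theorem d_form_basisOne_eq_zero_iff {g : Fin 2 → SmoothTorus2} :
    RoughForm.d (form basisOne g) = 0 ↔ delBar (g 0) = del (g 1) := by
  rw [d_form_basisOne, map_eq_zero_iff _ (form_injective basisTwo)]
  simp [sub_eq_zero, eq_comm (a := delBar (g 0))]

theorem d_form_basisTwo_eq_zero_iff {g : Fin 4 → SmoothTorus2} :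
    RoughForm.d (form basisTwo g) = 0 ↔ (g 0, g 1, g 2) ∈ spaceV := by
  rw [d_form_basisTwo, map_eq_zero_iff _ (form_injective basisThree), mem_spaceV_iff]
  simp [sub_eq_zero]

/-- The coefficients of the representatives in degrees `1` and `3`: two constants. -/
def constPair : ℂ × ℂ →ₗ[ℂ] Fin 2 → SmoothTorus2 :=
  .pi ![constTorus2 ∘ₗ .fst ℂ ℂ ℂ, constTorus2 ∘ₗ .snd ℂ ℂ ℂ]

/-- The coefficients `b`, `c`, `e`, `l` of the representatives in degree `2`. -/
def coeffTwo : spaceV × ℂ →ₗ[ℂ] Fin 4 → SmoothTorus2 where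
  toFun p := ![p.1.1.1, p.1.1.2.1, p.1.1.2.2, constTorus2 p.2]
  map_add' _ _ := by ext j; fin_cases j <;> rfl
  map_smul' _ _ := by ext j; fin_cases j <;> rfl

theorem exists_equiv_basicCohomology_zero : ∃ Φ : ℂ ≃ₗ[ℂ] foliation.basicCohomology ℂ 0,
    ∀ l, IsRepresentedBy (Φ l) fun _ _ => l := by
  refine exists_equiv_basicCohomology_of_form basisZero (.pi fun _ => constTorus2)
    (fun l => ?_) (fun l hl => ?_) (fun g hg => ?_) fun l x u => coverForm_basisZero _ x u
  · exact d_form_basisZero_eq_zero_iff.2 ⟨del_const l, delBar_const l⟩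
  · have hconst : constTorus2 l = 0 := congrFun (form_basisZero_mem_exactForms_iff.1 hl) 0
    exact constTorus2_injective (hconst.trans (map_zero _).symm)
  · obtain ⟨hdel, hdelBar⟩ := d_form_basisZero_eq_zero_iff.1 hg
    obtain ⟨l, hl⟩ := exists_const_of_del_eq_zero hdel hdelBar
    exact ⟨l, form_basisZero_mem_exactForms_iff.2
      (funext (Fin.forall_fin_one.2 (sub_eq_zero.2 hl)))⟩

theorem exists_equiv_basicCohomology_one : ∃ Φ : (ℂ × ℂ) ≃ₗ[ℂ] foliation.basicCohomology ℂ 1,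
    ∀ p, IsRepresentedBy (Φ p) fun _ u => p.1 * wedge ![dz] u + p.2 * wedge ![dzBar] u := by
  refine exists_equiv_basicCohomology_of_form basisOne constPair (fun p => ?_) (fun p hp => ?_)
    (fun g hg => ?_) fun p x u => coverForm_basisOne _ x u
  · exact d_form_basisOne_eq_zero_iff.2 ((delBar_const p.1).trans (del_const p.2).symm)
  · obtain ⟨h, hdel, hdelBar⟩ := form_basisOne_mem_exactForms_iff.1 hp
    refine Prod.ext (eq_zero_of_const_eq_del_sub_delBar (f := 0) (g := h) ?_)
      (eq_zero_of_const_eq_del_sub_delBar (f := -h) (g := 0) ?_)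
    · rw [map_zero, sub_zero]
      exact hdel
    · rw [map_zero, map_neg, sub_neg_eq_add, zero_add]
      exact hdelBar
  · obtain ⟨l, m, h, hdel, hdelBar⟩ :=
      exists_eq_const_add_del_of_delBar_eq_del (d_form_basisOne_eq_zero_iff.1 hg)
    exact ⟨(l, m), form_basisOne_mem_exactForms_iff.2
      ⟨h, sub_eq_of_eq_add' hdel, sub_eq_of_eq_add' hdelBar⟩⟩

theorem exists_equiv_basicCohomology_two : ∃ Φ : (spaceV × ℂ) ≃ₗ[ℂ] foliation.basicCohomology ℂ 2,
    ∀ p, IsRepresentedBy (Φ p) fun x u =>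
      periodic p.1.1.1 x.1.2 * wedge ![dw, dz] u
      + periodic p.1.1.2.1 x.1.2 * (wedge ![dw, dzBar] u + wedge ![dwBar, dz] u)
      + periodic p.1.1.2.2 x.1.2 * wedge ![dwBar, dzBar] u
      + p.2 * wedge ![dz, dzBar] u := by
  refine exists_equiv_basicCohomology_of_form (C := spaceV × ℂ) basisTwo coeffTwo
    (fun p => ?_) (fun p hp => ?_) (fun g hg => ?_) fun p x u => coverForm_basisTwo _ x u
  · exact d_form_basisTwo_eq_zero_iff.2 p.1.2
  · obtain ⟨hb, hc, he, _, _, hl⟩ := form_basisTwo_mem_exactForms_iff.1 hp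
    exact Prod.ext (Subtype.ext (Prod.ext hb (Prod.ext hc he)))
      (eq_zero_of_const_eq_del_sub_delBar hl)
  · obtain ⟨l, p, q, hl⟩ := exists_eq_const_add_del_sub_delBar (g 3)
    exact ⟨(⟨_, d_form_basisTwo_eq_zero_iff.1 hg⟩, l), form_basisTwo_mem_exactForms_iff.2
      ⟨sub_self _, sub_self _, sub_self _, p, q, sub_eq_of_eq_add' hl⟩⟩

theorem exists_equiv_basicCohomology_three : ∃ Φ : (ℂ × ℂ) ≃ₗ[ℂ] foliation.basicCohomology ℂ 3,
    ∀ p, IsRepresentedBy (Φ p) fun _ u =>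
      p.1 * wedge ![dw, dz, dzBar] u + p.2 * wedge ![dwBar, dz, dzBar] u := by
  refine exists_equiv_basicCohomology_of_form basisThree constPair (fun p => d_form_basisThree _)
    (fun p hp => ?_) (fun g _ => ?_) fun p x u => coverForm_basisThree _ x u
  · obtain ⟨b, c, e, hl, hm⟩ := form_basisThree_mem_exactForms_iff.1 hp
    refine Prod.ext (eq_zero_of_const_eq_del_sub_delBar (f := -b) (g := -c) ?_)
      (eq_zero_of_const_eq_del_sub_delBar (f := -c) (g := -e) ?_)
    · rw [map_neg, map_neg, neg_sub_neg]
      exact hl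
    · rw [map_neg, map_neg, neg_sub_neg]
      exact hm
  · obtain ⟨l, m, b, c, e, hl, hm⟩ := exists_eq_const_add_delBar_sub_del_pair (g 0) (g 1)
    exact ⟨(l, m), form_basisThree_mem_exactForms_iff.2
      ⟨b, c, e, sub_eq_of_eq_add' hl, sub_eq_of_eq_add' hm⟩⟩

theorem exists_equiv_basicCohomology_four : ∃ Φ : SmoothTorus2 ≃ₗ[ℂ] foliation.basicCohomology ℂ 4,
    ∀ g, IsRepresentedBy (Φ g) fun x u =>
      periodic g x.1.2 * wedge ![dw, dz, dwBar, dzBar] u := by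
  refine exists_equiv_basicCohomology_of_form basisFour (.pi fun _ => .id)
    (fun g => d_form_basisFour _)
    (fun g hg => congrFun (form_basisFour_mem_exactForms_iff.1 hg) 0) (fun g _ => ⟨g 0, ?_⟩)
    fun g x u => coverForm_basisFour _ x u
  exact form_basisFour_mem_exactForms_iff.2 (funext (Fin.forall_fin_one.2 (sub_self (g 0))))

end Suspension

/-! ### Infinite dimension and transverse structure -/

theorem isSmoothPeriodic_exp (n : ℤ) :
    IsSmoothPeriodic fun z => Complex.exp (2 * Real.pi * I * n * z.re) where
  contDiff := (contDiff_const.mul (Complex.ofRealCLM.contDiff.comp Complex.reCLM.contDiff)).cexp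
  periodic := by
    rintro _ ⟨m, l, rfl⟩ z
    refine Complex.exp_eq_exp_iff_exists_int.2 ⟨n * m, ?_⟩
    simp only [Complex.add_re, Complex.intCast_re, Complex.mul_re, Complex.I_re, mul_zero,
      Complex.intCast_im, Complex.I_im, mul_one, sub_self, add_zero, Complex.ofReal_add,
      Complex.ofReal_intCast, Int.cast_mul]
    ring

/-- The character `exp (2 π i n x)` of `𝕋²`. -/
noncomputable def torusCharacter (n : ℤ) : SmoothTorus2 := (isSmoothPeriodic_exp n).toTorus

theorem dirDeriv_torusCharacter (n : ℤ) (v : ℂ) :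
    dirDeriv v (torusCharacter n) = (2 * Real.pi * I * n * v.re) • torusCharacter n := by
  refine smoothTorus2_ext fun z => ?_
  have hderiv := ((Complex.ofRealCLM.comp Complex.reCLM).hasFDerivAt (x := z)).const_mul
    (2 * Real.pi * I * n) |>.cexp
  exact (DFunLike.congr_fun hderiv.fderiv v).trans (mul_comm _ _)

theorem linearIndependent_torusCharacter : LinearIndependent ℂ torusCharacter := by
  refine Module.End.eigenvectors_linearIndependent' (dirDeriv 1) (fun n : ℤ => 2 * Real.pi * I * n)
    (fun m n h => Int.cast_injective (mul_left_cancel₀ Complex.two_pi_I_ne_zero h)) _ fun n => ?_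
  refine ⟨Module.End.mem_eigenspace_iff.2 ?_, fun h => ?_⟩
  · rw [dirDeriv_torusCharacter, Complex.one_re, Complex.ofReal_one, mul_one]
  · exact Complex.exp_ne_zero _ (congrArg (periodic · 0) h)

theorem not_finite_smoothTorus2 : ¬ Module.Finite ℂ SmoothTorus2 := fun _ =>
  not_finite_iff_infinite.2 inferInstance linearIndependent_torusCharacter.finite

theorem diag_torusCharacter_mem_spaceV (n : ℤ) :
    (torusCharacter n, torusCharacter n, torusCharacter n) ∈ spaceV := by
  have hI : dirDeriv I (torusCharacter n) = 0 := by
    rw [dirDeriv_torusCharacter, Complex.I_re, Complex.ofReal_zero, mul_zero, zero_smul]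
  have hdel : delBar (torusCharacter n) = del (torusCharacter n) := by
    rw [del_apply, delBar_apply, hI, smul_zero, sub_zero, add_zero]
  exact mem_spaceV_iff.2 ⟨hdel, hdel⟩

theorem not_finite_spaceV : ¬ Module.Finite ℂ spaceV := fun _ =>
  have hindep : LinearIndependent ℂ fun n : ℤ => (⟨_, diag_torusCharacter_mem_spaceV n⟩ : spaceV) :=
    .of_comp (.fst ℂ _ _ ∘ₗ spaceV.subtype) linearIndependent_torusCharacter
  not_finite_iff_infinite.2 inferInstance hindep.finite

namespace Suspension

theorem mdifferentiable_torusShear_zpow (n : ℤ) :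
    MDifferentiable 𝓘(ℂ, ℂ × ℂ) 𝓘(ℂ, ℂ × ℂ) (torusShear ^ n) := by
  have hsmooth : ContMDiff 𝓘(ℂ, ℂ × ℂ) 𝓘(ℂ, ℂ × ℂ) ω (torusShear ^ n) := fun q => by
    refine (uniformization_torus4 ℂ).contMDiffAt_of_comp fun y _ => ?_
    have hlift : (torusShear ^ n) ∘ (QuotientAddGroup.mk : ℂ × ℂ → Torus4) =
        (QuotientAddGroup.mk : ℂ × ℂ → Torus4) ∘ fun x => (x.1 + (n : ℂ) * x.2, x.2) :=
      funext fun x => torusShear_zpow_mk n x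
    rw [hlift]
    exact (uniformization_torus4 ℂ).contMDiff.contMDiffAt.comp y
      (ContDiffAt.contMDiffAt (by fun_prop))
  exact hsmooth.mdifferentiable (by simp)

theorem isTransverselyHolomorphic_foliation : foliation.IsTransverselyHolomorphic := by
  refine ⟨inferInstance, fun (a b : ℝ) _ => ⟨?_, ?_⟩⟩
  · exact (mdifferentiable_torusShear_zpow (round (b - a))).mdifferentiableOn
  · have hsymm : ⇑(torusShear ^ round (b - a)).toOpenPartialHomeomorph.symm =
        ⇑(torusShear ^ (-round (b - a))) := by rw [zpow_neg]; rfl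
    change MDifferentiableOn _ _ (torusShear ^ round (b - a)).toOpenPartialHomeomorph.symm _
    rw [hsymm]
    exact (mdifferentiable_torusShear_zpow _).mdifferentiableOn

theorem codimension_foliation : foliation.codimension = 4 := by
  rw [Foliation.codimension, Module.finrank_prod, Complex.finrank_real_complex]

end Suspension

open Suspension in
theorem mainTheorem6 :
    foliation.codimension = 4 ∧
    foliation.IsTransverselyHolomorphic ∧
    -- degree 0: constants
    (∃ Φ : ℂ ≃ₗ[ℂ] foliation.basicCohomology ℂ 0,
      ∀ l, IsRepresentedBy (Φ l) fun _ _ => l) ∧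
    -- degree 1: `l dz + m dz̄`
    (∃ Φ : (ℂ × ℂ) ≃ₗ[ℂ] foliation.basicCohomology ℂ 1,
      ∀ l m, IsRepresentedBy (Φ (l, m)) fun _ u =>
        l * wedge ![dz] u + m * wedge ![dzBar] u) ∧
    -- degree 2: `b dw ∧ dz + c (dw ∧ dz̄ + dw̄ ∧ dz) + e dw̄ ∧ dz̄ + l dz ∧ dz̄`
    (∃ Φ : (spaceV × ℂ) ≃ₗ[ℂ] foliation.basicCohomology ℂ 2,
      ∀ (v : spaceV) (l : ℂ), IsRepresentedBy (Φ (v, l)) fun x u =>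
        periodic v.1.1 x.1.2 * wedge ![dw, dz] u
        + periodic v.1.2.1 x.1.2 * (wedge ![dw, dzBar] u + wedge ![dwBar, dz] u)
        + periodic v.1.2.2 x.1.2 * wedge ![dwBar, dzBar] u
        + l * wedge ![dz, dzBar] u) ∧
    -- degree 3: `l dw ∧ dz ∧ dz̄ + m dw̄ ∧ dz ∧ dz̄`
    (∃ Φ : (ℂ × ℂ) ≃ₗ[ℂ] foliation.basicCohomology ℂ 3,
      ∀ l m, IsRepresentedBy (Φ (l, m)) fun _ u =>
        l * wedge ![dw, dz, dzBar] u + m * wedge ![dwBar, dz, dzBar] u) ∧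
    -- degree 4: `g dw ∧ dz ∧ dw̄ ∧ dz̄`
    (∃ Φ : SmoothTorus2 ≃ₗ[ℂ] foliation.basicCohomology ℂ 4,
      ∀ g, IsRepresentedBy (Φ g) fun x u =>
        periodic g x.1.2 * wedge ![dw, dz, dwBar, dzBar] u) ∧
    ¬ Module.Finite ℂ spaceV ∧
    ¬ Module.Finite ℂ (foliation.basicCohomology ℂ 2) ∧
    Module.Finite ℂ (foliation.basicCohomology ℂ 3) ∧
    ¬ Module.Finite ℂ (foliation.basicCohomology ℂ 4) := by
  obtain ⟨Φ0, h0⟩ := exists_equiv_basicCohomology_zero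
  obtain ⟨Φ1, h1⟩ := exists_equiv_basicCohomology_one
  obtain ⟨Φ2, h2⟩ := exists_equiv_basicCohomology_two
  obtain ⟨Φ3, h3⟩ := exists_equiv_basicCohomology_three
  obtain ⟨Φ4, h4⟩ := exists_equiv_basicCohomology_four
  refine ⟨codimension_foliation, isTransverselyHolomorphic_foliation, ⟨Φ0, h0⟩,
    ⟨Φ1, fun l m => h1 (l, m)⟩, ⟨Φ2, fun v l => h2 (v, l)⟩, ⟨Φ3, fun l m => h3 (l, m)⟩, ⟨Φ4, h4⟩,
    not_finite_spaceV, fun h => ?_, Module.Finite.equiv Φ3, fun h => ?_⟩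
  · have : Module.Finite ℂ (spaceV × ℂ) := Module.Finite.equiv Φ2.symm
    exact not_finite_spaceV
      (Module.Finite.of_surjective (LinearMap.fst ℂ spaceV ℂ) LinearMap.fst_surjective)
  · exact not_finite_smoothTorus2 (Module.Finite.equiv Φ4.symm)
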